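/- **Definitions.** Let $A$ be a ring (associative, unital, nonzero, not necessarily commutative; modules are left modules). Chain complexes $X=(X_j,\partial_j)_{j\in\mathbb Z}$ are indexed by $\mathbb Z$. The suspension $\Sigma X$ has $(\Sigma X)_j=X_{j-1}$ and differential $-\partial^X_{j-1}$. The mapping cone of a chain map $f\colon X\to Y$ has $\operatorname{Cone}(f)_j=X_{j-1}\oplus Y_j$ and $\partial(x,y)=(-\partial x,\partial y+f(x))$. A *bootstrappable property of $A$-chain complexes* is a sequence $\mathsf B_*=(\mathsf B_n)_{n\in\mathbb Z}$ of classes of $A$-chain complexes, closed under isomorphism, such that for all $n\in\mathbb N=\{0,1,2,\dots\}$ and all $A$-chain complexes $X,Y$: - (degree) if $X_j=0$ for all $j<0$, then $X\in\mathsf B_m$ for all $m<0$; - (suspension) $X\in\mathsf B_n$ if and only if $\Sigma X\in\mathsf B_{n+1}$; - (mapping cone) if $f\colon X\to Y$ is a chain map, $X\in\mathsf B_{n-1}$ and $Y\in\mathsf B_n$, then $\operatorname{Cone}(f)\in\mathsf B_n$. Let $R$ be a nonzero ring and let $\mathcal C$ be an *is-class* of groups, i.e. a class of groups closed under isomorphisms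 and under passing to subgroups. An *equivariantly bootstrappable property of $R[\mathcal C]$-chain complexes* is a family $(\mathsf B^\Gamma_n)_{\Gamma\in\mathcal C,\,n\in\mathbb Z}$ of classes of $R\Gamma$-chain complexes such that $\mathsf B^\Gamma_*$ is a bootstrappable property of $R\Gamma$-chain complexes for every $\Gamma\in\mathcal C$, and - (induction) for all $n\in\mathbb Z$, $\Gamma\in\mathcal C$, every subgroup $\Delta\le\Gamma$ and every $X\in\mathsf B^\Delta_n$, the complex $R\Gamma\otimes_{R\Delta}X$ lies in $\mathsf B^\Gamma_n$. The associated *bootstrappable property of the is-class $\mathcal C$ of groups over $R$* is the sequence $\mathsf B_*$ in which $\mathsf B_n$ is the class of all groups $\Gamma\in\mathcal C$ for which the trivial $R\Gamma$-module $R$ admits a projective resolution lying in $\mathsf B^\Gamma_n$. **Theorem.** Let $\mathsf B_*$ be a bootstrappable property of an is-class $\mathcal C$ of groups over a nonzero ring $R$. Let $\Gamma\in\mathcal C$ and $n\in\mathbb N$. 1. (Algebraic form.) Let $X$ be an $R\Gamma$-chain complex with $X_j=0$ for all $j<0$ such that (i) $H_0(X)\cong R$ as $R\Gamma$-modules, where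 $R$ is the trivial module, and $H_j(X)=0$ for all $j\le n-1$ with $j\ne 0$; (ii) for every $0\le j\le n$ the $R\Gamma$-module $X_j$ is isomorphic to a finite direct sum $\bigoplus_{\sigma\in S_j}R[\Gamma/\Gamma_\sigma]$ of permutation modules, where each $\Gamma_\sigma$ is a subgroup of $\Gamma$ lying in $\mathsf B_{n-j}$. Then $\Gamma\in\mathsf B_n$. 2. (Geometric form.) Let $\Omega$ be a nonempty $\Gamma$-CW-complex, i.e. a CW-complex with an action of the discrete group $\Gamma$ by homeomorphisms that permute the open cells, such that every group element mapping an open cell to itself fixes it pointwise. Suppose that (i) $\Omega$ is $(n-1)$-acyclic over $R$, i.e. $H_j(\Omega;R)\cong H_j(\mathrm{pt};R)$ as $R$-modules for all $0\le j\le n-1$ (if $R$ does not have invariant basis number, the isomorphism for $j=0$ is required to be the one induced by the map $\Omega\to\mathrm{pt}$), where $H_*$ is singular homology; (ii) the quotient $\Gamma\backslash\Omega^{(n)}$ of the $n$-skeleton is compact; (iii) for every cell $\sigma$ of $\Omega$ with $\dim\sigma\le n$, the stabiliser $\Gamma_\sigma$ lies in $\mathsf B_{n-\dim\sigma}$. Then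 $\Gamma\in\mathsf B_n$. -/

import Mathlib

open CategoryTheory CategoryTheory.Limits
open scoped TensorProduct Pointwise

universe u

noncomputable section

/-! ### Chain complexes -/

/-- `ℤ`-indexed chain complexes of left modules over a (not necessarily commutative) ring `A`. -/
abbrev ModComplex (A : Type u) [Ring A] : Type (u + 1) :=
  ChainComplex (ModuleCat.{u} A) ℤ

namespace ModComplex

variable {A : Type u} [Ring A]

/-- The suspension: `(ΣX)_j = X_{j-1}` with differential `-∂`. -/
def suspension (X : ModComplex A) : ModComplex A where
  X j := X.X (j - 1)
  d i j := -X.d (i - 1) (j - 1)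
  shape i j h := by
    rw [X.shape, neg_zero]
    simp only [ComplexShape.down_Rel] at h ⊢
    omega
  d_comp_d' i j k _ _ := by simp

open Classical in
/-- The mapping cone: `Cone(f)_j = X_{j-1} ⊕ Y_j` with `∂(x, y) = (-∂x, ∂y + f x)`.
Mathlib calls it the homotopy cofiber. -/
def cone {X Y : ModComplex A} (f : X ⟶ Y) : ModComplex A :=
  HomologicalComplex.homotopyCofiber f

/-- `X_j = 0` for all `j < 0`. -/
def IsNonneg (X : ModComplex A) : Prop :=
  ∀ j : ℤ, j < 0 → IsZero (X.X j)

/-- `P` is a projective resolution of the module `M`: it is concentrated in degrees `≥ 0`,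
its chain modules are projective, and it admits a quasi-isomorphism to `M`
(regarded as a complex concentrated in degree `0`). -/
def IsProjectiveResolution (P : ModComplex A) (M : ModuleCat.{u} A) : Prop :=
  P.IsNonneg ∧ (∀ j, Projective (P.X j)) ∧
    ∃ ε : P ⟶ (HomologicalComplex.single (ModuleCat.{u} A) (ComplexShape.down ℤ) 0).obj M,
      QuasiIso ε

end ModComplex

/-- A bootstrappable property of `A`-chain complexes: a sequence `(B_n)_{n ∈ ℤ}` of classes of
`A`-chain complexes, closed under isomorphisms, satisfying the degree, suspension and mapping
cone axioms. -/
structure IsBootstrappable (A : Type u) [Ring A] (B : ℤ → ModComplex A → Prop) : Prop where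
  of_iso : ∀ (n : ℤ) (X Y : ModComplex A), (X ≅ Y) → B n X → B n Y
  degree : ∀ X : ModComplex A, X.IsNonneg → ∀ m : ℤ, m < 0 → B m X
  suspension : ∀ (n : ℕ) (X : ModComplex A), B n X ↔ B (n + 1) X.suspension
  cone : ∀ (n : ℕ) (X Y : ModComplex A) (f : X ⟶ Y),
    B (n - 1) X → B n Y → B n (ModComplex.cone f)

/-! ### Induction `S ⊗_A M` along a ring homomorphism `A → S` of noncommutative rings -/

namespace Induction

variable {A S : Type u} [Ring A] [Ring S] (f : A →+* S)

section

variable (M : Type u) [AddCommGroup M] [Module A M]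

/-- The `S`-submodule of `S ⊗_ℤ M` generated by the elements `s f(a) ⊗ m - s ⊗ a m`. -/
def relations : Submodule S (S ⊗[ℤ] M) :=
  Submodule.span S {t | ∃ (s : S) (a : A) (m : M), t = (s * f a) ⊗ₜ[ℤ] m - s ⊗ₜ[ℤ] (a • m)}

/-- The left `S`-module `S ⊗_A M`, where `A` acts on the right of `S` through `f`. -/
abbrev Obj : Type u := (S ⊗[ℤ] M) ⧸ relations f M

end

variable {M N K : Type u} [AddCommGroup M] [Module A M] [AddCommGroup N] [Module A N]
  [AddCommGroup K] [Module A K]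

/-- The map `id ⊗ φ` on `S ⊗_ℤ M`. -/
def baseMap (φ : M →ₗ[A] N) : S ⊗[ℤ] M →ₗ[S] S ⊗[ℤ] N :=
  TensorProduct.AlgebraTensorModule.map LinearMap.id φ.toAddMonoidHom.toIntLinearMap

@[simp] theorem baseMap_tmul (φ : M →ₗ[A] N) (s : S) (m : M) :
    baseMap φ (s ⊗ₜ[ℤ] m) = s ⊗ₜ[ℤ] φ m := rfl

theorem relations_le (φ : M →ₗ[A] N) :
    relations f M ≤ (relations f N).comap (baseMap φ) := by
  refine Submodule.span_le.2 ?_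
  rintro _ ⟨s, a, m, rfl⟩
  refine Submodule.subset_span ⟨s, a, φ m, ?_⟩
  simp

/-- The map `id ⊗ φ` on `S ⊗_A M`. -/
def map (φ : M →ₗ[A] N) : Obj f M →ₗ[S] Obj f N :=
  Submodule.mapQ _ _ (baseMap φ) (relations_le f φ)

theorem hom_ext {L : Type u} [AddCommGroup L] [Module S L] {φ ψ : Obj f M →ₗ[S] L}
    (h : ∀ (s : S) (m : M), φ (Submodule.Quotient.mk (s ⊗ₜ[ℤ] m)) =
      ψ (Submodule.Quotient.mk (s ⊗ₜ[ℤ] m))) : φ = ψ := by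
  refine LinearMap.ext fun x => ?_
  obtain ⟨t, rfl⟩ := Submodule.Quotient.mk_surjective _ x
  induction t with
  | zero => simp
  | tmul s m => exact h s m
  | add a b ha hb => rw [Submodule.Quotient.mk_add, map_add, map_add, ha, hb]

@[simp] theorem map_mk (φ : M →ₗ[A] N) (s : S) (m : M) :
    map f φ (Submodule.Quotient.mk (s ⊗ₜ[ℤ] m)) = Submodule.Quotient.mk (s ⊗ₜ[ℤ] φ m) := rfl

/-- The functor `M ↦ S ⊗_A M` from left `A`-modules to left `S`-modules. -/
def functor : ModuleCat.{u} A ⥤ ModuleCat.{u} S where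
  obj M := ModuleCat.of S (Obj f M)
  map φ := ModuleCat.ofHom (map f φ.hom)
  map_id M := by
    ext1
    exact hom_ext f fun s m => rfl
  map_comp φ ψ := by
    ext1
    exact hom_ext f fun s m => rfl

instance functor_additive : (functor f).Additive where
  map_add {M N φ ψ} := by
    ext1
    refine hom_ext f fun s m => ?_
    change Submodule.Quotient.mk (s ⊗ₜ[ℤ] (φ.hom m + ψ.hom m)) = _
    rw [TensorProduct.tmul_add]
    rfl

end Induction

/-! ### Modules over group rings -/

section GroupRing

variable (R : Type u) [Ring R] (Γ : Type u) [Group Γ]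

/-- The underlying group of the trivial module. -/
def TrivialModule (_Γ : Type u) : Type u := R

instance : AddCommGroup (TrivialModule R Γ) := inferInstanceAs (AddCommGroup R)

/-- The trivial `RΓ`-module `R`: the left `R`-module `R` with every element of `Γ` acting as the
identity, that is, `RΓ` acts through the augmentation `RΓ → R`. -/
instance : Module (MonoidAlgebra R Γ) (TrivialModule R Γ) :=
  Module.compHom R (MonoidAlgebra.liftNCRingHom (RingHom.id R) (1 : Γ →* R)
    (fun x _ => Commute.one_right x))

variable (T : Type u) [MulAction Γ T]

/-- The action of `Γ` on `R[T]` that permutes the basis `T`. -/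
def permAction : Γ →* AddMonoid.End (T →₀ R) where
  toFun g := Finsupp.mapDomain.addMonoidHom (g • ·)
  map_one' := by
    refine AddMonoidHom.ext fun x => ?_
    change Finsupp.mapDomain (fun t : T => (1 : Γ) • t) x = x
    simp only [one_smul]
    exact Finsupp.mapDomain_id
  map_mul' g h := by
    refine AddMonoidHom.ext fun x => ?_
    change Finsupp.mapDomain (fun t : T => (g * h) • t) x =
      Finsupp.mapDomain (fun t : T => g • t) (Finsupp.mapDomain (fun t : T => h • t) x)
    rw [← Finsupp.mapDomain_comp]
    simp only [mul_smul, Function.comp_def]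

theorem permAction_commute (r : R) (g : Γ) :
    Commute (Module.toAddMonoidEnd R (T →₀ R) r) (permAction R Γ T g) := by
  refine AddMonoidHom.ext fun x => ?_
  change r • Finsupp.mapDomain (fun t : T => g • t) x =
    Finsupp.mapDomain (fun t : T => g • t) (r • x)
  rw [Finsupp.mapDomain_smul]

/-- The underlying group of the permutation module `R[T]`. -/
def PermutationModule (_Γ : Type u) : Type u := T →₀ R

instance : AddCommGroup (PermutationModule R T Γ) := inferInstanceAs (AddCommGroup (T →₀ R))

/-- The permutation module `R[T]` of a `Γ`-set `T`: the free left `R`-module on `T`, with `Γ`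
permuting the basis. -/
instance : Module (MonoidAlgebra R Γ) (PermutationModule R T Γ) :=
  Module.compHom (T →₀ R) (MonoidAlgebra.liftNCRingHom (Module.toAddMonoidEnd R (T →₀ R))
    (permAction R Γ T) (permAction_commute R Γ T))

/-- The induction functor `ind_Δ^Γ = RΓ ⊗_{RΔ} -` on chain complexes. -/
def indComplex {Γ : Type u} [Group Γ] (Δ : Subgroup Γ) (X : ModComplex (MonoidAlgebra R Δ)) :
    ModComplex (MonoidAlgebra R Γ) :=
  ((Induction.functor (MonoidAlgebra.mapDomainRingHom R Δ.subtype)).mapHomologicalComplex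
    (ComplexShape.down ℤ)).obj X

end GroupRing

/-! ### Bootstrappable properties of groups -/

/-- A class of groups. -/
abbrev GroupClass : Type (u + 1) := ∀ (Γ : Type u) [Group Γ], Prop

/-- A class of groups is an is-class if it is closed under isomorphisms and subgroups. -/
structure IsISClass (C : GroupClass.{u}) : Prop where
  of_iso : ∀ (Γ Γ' : Type u) [Group Γ] [Group Γ'], (Γ ≃* Γ') → C Γ → C Γ'
  subgroup : ∀ (Γ : Type u) [Group Γ] (Δ : Subgroup Γ), C Γ → C Δ

/-- A family `(B^Γ_n)` of classes of `RΓ`-chain complexes. -/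
abbrev EquivariantFamily (R : Type u) [Ring R] : Type (u + 1) :=
  ∀ (Γ : Type u) [Group Γ], ℤ → ModComplex (MonoidAlgebra R Γ) → Prop

/-- An equivariantly bootstrappable property of `R[C]`-chain complexes, for a class `C` of groups
(the values of the family at groups outside `C` are irrelevant). -/
structure IsEquivariantlyBootstrappable (R : Type u) [Ring R] (C : GroupClass.{u})
    (B : EquivariantFamily R) : Prop where
  bootstrappable : ∀ (Γ : Type u) [Group Γ], C Γ → IsBootstrappable (MonoidAlgebra R Γ) (B Γ)
  induction : ∀ (n : ℤ) (Γ : Type u) [Group Γ] (Δ : Subgroup Γ)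
    (X : ModComplex (MonoidAlgebra R Δ)), C Γ → B Δ n X → B Γ n (indComplex R Δ X)

/-- The class of groups `Γ` in `C` for which the trivial `RΓ`-module `R` admits a projective
resolution lying in `B^Γ_n`. -/
def associatedClass (R : Type u) [Ring R] (C : GroupClass.{u}) (B : EquivariantFamily R) (n : ℤ) :
    GroupClass.{u} := fun Γ _ =>
  C Γ ∧ ∃ P : ModComplex (MonoidAlgebra R Γ),
    P.IsProjectiveResolution (ModuleCat.of (MonoidAlgebra R Γ) (TrivialModule R Γ)) ∧ B Γ n P

/-- A bootstrappable property of the class `C` of groups over `R`: a sequence of classes of groups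
that is associated to some equivariantly bootstrappable property of `R[C]`-chain complexes. -/
def IsBootstrappableGroupProperty (R : Type u) [Ring R] (C : GroupClass.{u})
    (B : ℤ → GroupClass.{u}) : Prop :=
  ∃ F : EquivariantFamily R, IsEquivariantlyBootstrappable R C F ∧
    ∀ (n : ℤ) (Γ : Type u) [Group Γ], B n Γ ↔ associatedClass R C F n Γ

/-! ### `Γ`-CW-complexes and singular homology -/

/-- A `Γ`-CW-complex structure, for a discrete group `Γ`: a CW-complex `Ω` on which `Γ` acts by
homeomorphisms that permute the open cells, such that every group element that maps an open cell
to itself fixes that cell pointwise. -/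
structure IsGammaCWComplex (Γ : Type u) [Group Γ] (Ω : Type u) [TopologicalSpace Ω]
    [MulAction Γ Ω] [Topology.CWComplex (Set.univ : Set Ω)] : Prop where
  continuous_smul : ∀ g : Γ, Continuous fun x : Ω => g • x
  exists_smul_openCell : ∀ (g : Γ) (k : ℕ) (σ : Topology.CWComplex.cell (Set.univ : Set Ω) k),
    ∃ τ : Topology.CWComplex.cell (Set.univ : Set Ω) k,
      g • Topology.CWComplex.openCell (C := (Set.univ : Set Ω)) k σ =
        Topology.CWComplex.openCell (C := (Set.univ : Set Ω)) k τ
  fixes_of_smul_openCell_eq : ∀ (g : Γ) (k : ℕ)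
    (σ : Topology.CWComplex.cell (Set.univ : Set Ω) k),
    g • Topology.CWComplex.openCell (C := (Set.univ : Set Ω)) k σ =
      Topology.CWComplex.openCell (C := (Set.univ : Set Ω)) k σ →
    ∀ x ∈ Topology.CWComplex.openCell (C := (Set.univ : Set Ω)) k σ, g • x = x

/-- The stabiliser `Γ_σ` of a cell `σ`. -/
def cellStabilizer (Γ : Type u) [Group Γ] {Ω : Type u} [TopologicalSpace Ω]
    [MulAction Γ Ω] [Topology.CWComplex (Set.univ : Set Ω)] {k : ℕ}
    (σ : Topology.CWComplex.cell (Set.univ : Set Ω) k) : Subgroup Γ :=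
  MulAction.stabilizer Γ (Topology.CWComplex.openCell (C := (Set.univ : Set Ω)) k σ)

/-- `Γ \ Ω^(n)` is compact. Here `Γ \ Ω^(n)` is the image of the `n`-skeleton in `Γ \ Ω`; as the
orbit map of `Ω` is open and the skeleton is invariant, the subspace topology on this image is the
quotient topology. -/
def HasCocompactSkeleton (Γ : Type u) [Group Γ] (Ω : Type u) [TopologicalSpace Ω] [T2Space Ω]
    [MulAction Γ Ω] [Topology.CWComplex (Set.univ : Set Ω)] (n : ℕ) : Prop :=
  IsCompact ((Quotient.mk (MulAction.orbitRel Γ Ω)) ''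
    (Topology.CWComplex.skeleton (Set.univ : Set Ω) n : Set Ω))

/-- Singular homology `H_j(-; R)`, a functor from topological spaces to left `R`-modules. -/
abbrev singularHomology (R : Type u) [Ring R] (j : ℕ) : TopCat.{u} ⥤ ModuleCat.{u} R :=
  (AlgebraicTopology.singularHomologyFunctor (ModuleCat.{u} R) j).obj (ModuleCat.of R R)

/-- The map `Ω → pt`. -/
def toPoint (Ω : Type u) [TopologicalSpace Ω] : TopCat.of Ω ⟶ TopCat.of PUnit.{u + 1} :=
  TopCat.ofHom ⟨fun _ => PUnit.unit, continuous_const⟩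

/-- `H_j(Ω; R) ≅ H_j(pt; R)` for all `j ≤ n - 1`. Over a ring without invariant basis number
(where `R ≅ R ⊕ R` is possible) the isomorphism on `H_0` is understood to be the one induced by
the map `Ω → pt`; over other rings this is automatic. -/
def IsAcyclicBelow (R : Type u) [Ring R] (n : ℕ) (Ω : Type u) [TopologicalSpace Ω] : Prop :=
  ∀ j : ℕ, j < n →
    Nonempty ((singularHomology R j).obj (TopCat.of Ω) ≅
      (singularHomology R j).obj (TopCat.of PUnit.{u + 1})) ∧
    (j = 0 → ¬ InvariantBasisNumber R → IsIso ((singularHomology R j).map (toPoint Ω)))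

end

/-!
Both forms of the theorem are instances of one argument about complexes. Suppose that an
`RΓ`-complex is filtered, `F 0 ⟶ F 1 ⟶ ⋯ ⟶ F n`, that the `k`-th graded piece has homology only in
degree `k`, where it is a finite sum `M k` of permutation modules `R[Γ/Δ]` with `Δ` in `B (n - k)`,
and that `F n` is a resolution of the trivial module `R` up to degree `n - 1`.

* Inducing up resolutions of `R` over the groups `Δ` yields resolutions of the `M k` lying in
  `B (n - k)` (`Induction.isResolutionAt_indComplex`). Since `RΓ` is free over `RΔ`, induction
  is exact (`Induction.map_exact`).
* These resolutions, suitably suspended, are attached one after the other: a projective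
  resolution of the homology of the next graded piece maps to the cone of `T ⟶ F (k + 1)`
  (`IsResolutionAt.exists_hom`), and this map is a quasi-isomorphism, so it is the attaching datum of
  a larger projective complex quasi-isomorphic to `F (k + 1)`
  (`HasRelHomologyOnlyAt.exists_attach`). That complex is a cone, so it stays in `B n`
  (`IsBootstrappable.cone_of_suspension`). The result is a projective complex in `B n`,
  quasi-isomorphic to `F n`.
* It becomes a resolution of `R` after attaching modules in degrees `> n`
  (`IsAugmentation.exists_cone_isResolutionAt`), and such modules do not affect membership in
  `B n`: desuspended `n` times, the attached complex is concentrated in nonnegative degrees, so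
  it lies in `B (-1)` by the degree axiom (`IsBootstrappable.cone_of_subsingleton`).

These steps are combined in `IsBootstrappable.exists_isResolutionAt_of_filtration`. For the algebraic
form, the filtration of `X` is by the truncations in degrees `≤ k`.

For the geometric form, `F k` is the singular complex of the `k`-skeleton of `Ω`. Here the relative
homology of consecutive skeleta must be shown to be free on the cells, compatibly with the action of
`Γ`. Iterated barycentric subdivision makes singular chains subordinate to an open cover
(`exists_small`), which gives excision (`IsRelBasis.of_small`). The pair formed by a ball and the
ball without its centre is computed by homotopies and Mayer–Vietoris, and the two together show that
the characteristic maps of the cells give a basis of relative homology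
(`IsCellAttachment.exists_isRelBasis`). For equivariance, characteristic maps are chosen for
representatives of the orbits of cells and translated by `Γ`; this is consistent because the
stabiliser of a cell fixes it pointwise (`GammaCW.charMap_smul`). Relative to the complement of the
centres of the cells, instead of the smaller skeleton, these translates are themselves the basis, so
that the identification with the permutation module on the cells is equivariant
(`GammaCW.exists_skelChains_class`). Compactness of the quotient of the `n`-skeleton makes the number
of orbits of cells finite (`GammaCW.finite_orbits`).

The hypothesis of acyclicity concerns Mathlib's singular homology of `Ω`. It enters only in the form
that cycles of low degree bound (`Singular.exists_bdry_eq_of_isAcyclicBelow`), which then also holds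
in the `n`-skeleton (`GammaCW.exists_bdry_eq_of_skel`). In degree `0` it has to be extracted from an
abstract isomorphism `H_0(Ω) ≅ R`: with invariant basis number this forces `Ω` to be path
connected, and otherwise the isomorphism is the one induced by the map to a point.

Singular simplices are indexed by their number of vertices, and the empty simplex is included, so
that the complex of all chains computes reduced homology and boundaries, cones and subdivisions
need no separate treatment of degree `0`.
-/

noncomputable section

/-! ### Elementwise calculus of chain complexes and mapping cones -/

namespace ModComplex

variable {A : Type u} [Ring A]

theorem d_d_apply (X : ModComplex A) (i j k : ℤ) (x : X.X i) :
    (X.d j k).hom ((X.d i j).hom x) = 0 := by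
  rw [← LinearMap.comp_apply, ← ModuleCat.hom_comp, X.d_comp_d]
  rfl

theorem hom_d_apply {X Y : ModComplex A} (f : X ⟶ Y) (i j : ℤ) (x : X.X i) :
    (f.f j).hom ((X.d i j).hom x) = (Y.d i j).hom ((f.f i).hom x) := by
  rw [← LinearMap.comp_apply, ← ModuleCat.hom_comp, ← f.comm, ModuleCat.hom_comp]
  rfl

/-- A chain map assembled from linear maps that commute with the differentials. -/
def homMk {X Y : ModComplex A} (f : ∀ j, X.X j →ₗ[A] Y.X j)
    (h : ∀ i x, f (i - 1) ((X.d i (i - 1)).hom x) = (Y.d i (i - 1)).hom (f i x)) : X ⟶ Y where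
  f j := ModuleCat.ofHom (f j)
  comm' i j hij := by
    obtain rfl : j = i - 1 := by simp only [ComplexShape.down_Rel] at hij; omega
    ext x
    exact (h i x).symm

@[simp] theorem homMk_f {X Y : ModComplex A} (f : ∀ j, X.X j →ₗ[A] Y.X j) (h) (j : ℤ) :
    ((homMk f h).f j).hom = f j := rfl

/-- An isomorphism of complexes assembled from linear equivalences. -/
def isoMk {X Y : ModComplex A} (f : ∀ j, X.X j ≃ₗ[A] Y.X j)
    (h : ∀ i x, f (i - 1) ((X.d i (i - 1)).hom x) = (Y.d i (i - 1)).hom (f i x)) : X ≅ Y :=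
  HomologicalComplex.Hom.isoOfComponents (fun j => (f j).toModuleIso) (by
    intro i j hij
    obtain rfl : j = i - 1 := by simp only [ComplexShape.down_Rel] at hij; omega
    ext x
    exact (h i x).symm)

theorem down_rel (i : ℤ) : (ComplexShape.down ℤ).Rel i (i - 1) := by simp

section Cone

open HomologicalComplex

variable {X Y : ModComplex A} (f : X ⟶ Y) (i : ℤ)

/-- The projection of a mapping cone to its first summand. -/
def coneFst : (cone f).X i →ₗ[A] X.X (i - 1) := by
  classical exact (homotopyCofiber.fstX f i (i - 1) (down_rel i)).hom

/-- The projection of a mapping cone to its second summand. -/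
def coneSnd : (cone f).X i →ₗ[A] Y.X i := by
  classical exact (homotopyCofiber.sndX f i).hom

/-- The inclusion of the first summand of a mapping cone. -/
def coneInl : X.X (i - 1) →ₗ[A] (cone f).X i := by
  classical exact (homotopyCofiber.inlX f (i - 1) i (down_rel i)).hom

/-- The inclusion of the second summand of a mapping cone. -/
def coneInr : Y.X i →ₗ[A] (cone f).X i := by
  classical exact (homotopyCofiber.inrX f i).hom

theorem coneFst_inl (x : X.X (i - 1)) : coneFst f i (coneInl f i x) = x := by
  classical
  exact congrArg (fun g => g.hom x) (homotopyCofiber.inlX_fstX f (i - 1) i (down_rel i))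

theorem coneSnd_inl (x : X.X (i - 1)) : coneSnd f i (coneInl f i x) = 0 := by
  classical
  exact congrArg (fun g => g.hom x) (homotopyCofiber.inlX_sndX f (i - 1) i (down_rel i))

theorem coneFst_inr (y : Y.X i) : coneFst f i (coneInr f i y) = 0 := by
  classical
  exact congrArg (fun g => g.hom y) (homotopyCofiber.inrX_fstX f i (i - 1) (down_rel i))

theorem coneSnd_inr (y : Y.X i) : coneSnd f i (coneInr f i y) = y := by
  classical
  exact congrArg (fun g => g.hom y) (homotopyCofiber.inrX_sndX f i)

theorem coneInl_add_inr (z : (cone f).X i) :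
    coneInl f i (coneFst f i z) + coneInr f i (coneSnd f i z) = z := by
  classical
  have : homotopyCofiber.fstX f i (i - 1) (down_rel i) ≫
      homotopyCofiber.inlX f (i - 1) i (down_rel i) +
      homotopyCofiber.sndX f i ≫ homotopyCofiber.inrX f i = 𝟙 _ := by
    apply homotopyCofiber.ext_to_X f i (i - 1) (down_rel i) <;> simp
  exact congrArg (fun g => g.hom z) this

/-- The chain modules of a mapping cone, as products. -/
def coneEquiv : (cone f).X i ≃ₗ[A] X.X (i - 1) × Y.X i where
  toFun z := (coneFst f i z, coneSnd f i z)
  invFun p := coneInl f i p.1 + coneInr f i p.2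
  map_add' z w := by simp
  map_smul' a z := by simp
  left_inv z := coneInl_add_inr f i z
  right_inv p := by simp [coneFst_inl, coneFst_inr, coneSnd_inl, coneSnd_inr]

theorem coneEquiv_d (z : (cone f).X i) :
    coneEquiv f (i - 1) (((cone f).d i (i - 1)).hom z) =
      (-(X.d (i - 1) (i - 1 - 1)).hom (coneEquiv f i z).1,
        (Y.d i (i - 1)).hom (coneEquiv f i z).2 + (f.f (i - 1)).hom (coneEquiv f i z).1) := by
  classical
  have h1 := homotopyCofiber.d_fstX f i (i - 1) (i - 1 - 1) (down_rel _) (down_rel _)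
  have h2 := homotopyCofiber.d_sndX f i (i - 1) (down_rel _)
  refine Prod.ext ?_ ?_
  · exact congrArg (fun g => g.hom z) h1
  · rw [add_comm]
    exact congrArg (fun g => g.hom z) h2

theorem coneEquiv_symm_d (p : X.X (i - 1) × Y.X i) :
    ((cone f).d i (i - 1)).hom ((coneEquiv f i).symm p) = (coneEquiv f (i - 1)).symm
      (-(X.d (i - 1) (i - 1 - 1)).hom p.1, (Y.d i (i - 1)).hom p.2 + (f.f (i - 1)).hom p.1) := by
  rw [LinearEquiv.eq_symm_apply, coneEquiv_d, LinearEquiv.apply_symm_apply]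

end Cone

/-- The chain modules of a suspension. -/
def suspEquiv (X : ModComplex A) (i : ℤ) : X.suspension.X i ≃ₗ[A] X.X (i - 1) :=
  LinearEquiv.refl A _

theorem suspEquiv_d (X : ModComplex A) (i : ℤ) (x : X.suspension.X i) :
    suspEquiv X (i - 1) ((X.suspension.d i (i - 1)).hom x) =
      -(X.d (i - 1) (i - 1 - 1)).hom (suspEquiv X i x) := rfl

theorem suspEquiv_symm_d (X : ModComplex A) (i : ℤ) (x : X.X (i - 1)) :
    (X.suspension.d i (i - 1)).hom ((suspEquiv X i).symm x) =
      (suspEquiv X (i - 1)).symm (-(X.d (i - 1) (i - 1 - 1)).hom x) := rfl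

theorem suspEquiv_symm_neg_d (X : ModComplex A) (i : ℤ) (x : X.X (i - 1)) :
    (X.suspension.d i (i - 1)).hom ((suspEquiv X i).symm (-x)) =
      (suspEquiv X (i - 1)).symm ((X.d (i - 1) (i - 1 - 1)).hom x) := by
  rw [suspEquiv_symm_d, LinearMap.map_neg, neg_neg]

/-- The suspension of a chain map. -/
def suspMap {X Y : ModComplex A} (f : X ⟶ Y) : X.suspension ⟶ Y.suspension :=
  homMk (fun j => (suspEquiv Y j).symm.toLinearMap ∘ₗ (f.f (j - 1)).hom ∘ₗ
      (suspEquiv X j).toLinearMap) fun i x => by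
    simp only [LinearMap.comp_apply, LinearEquiv.coe_coe, suspEquiv_d, suspEquiv_symm_d, map_neg,
      hom_d_apply]

theorem suspMap_f {X Y : ModComplex A} (f : X ⟶ Y) (j : ℤ) (x : X.suspension.X j) :
    ((suspMap f).f j).hom x = (suspEquiv Y j).symm ((f.f (j - 1)).hom (suspEquiv X j x)) := rfl

/-- Suspension commutes with mapping cones; the sign is absorbed by the first summand. -/
def coneSuspIso {X Y : ModComplex A} (f : X ⟶ Y) :
    cone (suspMap f) ≅ (cone f).suspension :=
  isoMk (fun j => coneEquiv (suspMap f) j ≪≫ₗ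
      LinearEquiv.prodCongr (suspEquiv X (j - 1) ≪≫ₗ LinearEquiv.neg A) (suspEquiv Y j) ≪≫ₗ
      (coneEquiv f (j - 1)).symm ≪≫ₗ (suspEquiv (cone f) j).symm) fun i z => by
    simp only [LinearEquiv.trans_apply, suspEquiv_symm_d, coneEquiv_symm_d, coneEquiv_d,
      LinearEquiv.prodCongr_apply, suspEquiv_d, LinearEquiv.neg_apply, map_neg, map_add,
      suspMap_f, LinearEquiv.apply_symm_apply]
    refine Eq.trans (congrArg _ (Eq.trans (congrArg _ ?_) (map_neg (coneEquiv f _).symm _)))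
      (map_neg (suspEquiv (cone f) _).symm _)
    simp [add_comm]

theorem exists_suspension_iso (X : ModComplex A) :
    ∃ W : ModComplex A, Nonempty (W.suspension ≅ X) := by
  let W : ModComplex A :=
    { X := fun j => X.X (j + 1)
      d := fun i j => -X.d (i + 1) (j + 1)
      shape := fun i j h => by
        rw [X.shape, neg_zero]
        simp only [ComplexShape.down_Rel] at h ⊢
        omega
      d_comp_d' := fun i j k _ _ => by simp }
  refine ⟨W, ⟨HomologicalComplex.Hom.isoOfComponents
    (fun j => X.XIsoOfEq (by omega : j - 1 + 1 = j)) fun i j _ => ?_⟩⟩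
  change _ ≫ _ = (- -X.d (i - 1 + 1) (j - 1 + 1)) ≫ _
  simp

/-- A family of maps `X_{j-1} → Y_{j-1}` compatible with the differentials is a chain map. -/
theorem exists_hom_of_shifted {X Y : ModComplex A} (a : ∀ i : ℤ, X.X (i - 1) →ₗ[A] Y.X (i - 1))
    (ha : ∀ i x, a (i - 1) ((X.d (i - 1) (i - 1 - 1)).hom x) =
      (Y.d (i - 1) (i - 1 - 1)).hom (a i x)) :
    ∃ f : X ⟶ Y, ∀ i, (f.f (i - 1)).hom = a i := by
  have key : ∀ i j, i - 1 = j → ∃ b : X.X j →ₗ[A] Y.X j, ∀ i' (h : i' - 1 = j),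
      HEq b (a i') := by
    rintro i j rfl
    refine ⟨a i, fun i' h => ?_⟩
    obtain rfl : i' = i := by omega
    rfl
  choose b hb using fun j : ℤ => key (j + 1) j (by omega)
  have hb' : ∀ i, b (i - 1) = a i := fun i => eq_of_heq (hb (i - 1) i rfl)
  refine ⟨homMk b fun i x => ?_, fun i => hb' i⟩
  obtain ⟨i, rfl⟩ : ∃ i', i' - 1 = i := ⟨i + 1, by omega⟩
  rw [hb' i, hb' (i - 1)]
  exact ha i x

end ModComplex

end

noncomputable section

/-! ### Resolutions, lifting, and attaching a resolution to a complex -/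

theorem exists_linearMap_comp_eq {A : Type*} [Ring A] {P M N : Type*} [AddCommGroup P] [Module A P]
    [AddCommGroup M] [Module A M] [AddCommGroup N] [Module A N] [Module.Projective A P]
    (d : M →ₗ[A] N) (a : P →ₗ[A] N) (h : ∀ x, ∃ y, d y = a x) :
    ∃ u : P →ₗ[A] M, ∀ x, d (u x) = a x := by
  obtain ⟨u, hu⟩ := Module.projective_lifting_property d.rangeRestrict
    (a.codRestrict (LinearMap.range d) h) d.surjective_rangeRestrict
  exact ⟨u, fun x => congrArg Subtype.val (LinearMap.congr_fun hu x)⟩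

namespace ModComplex

variable {A : Type u} [Ring A]

/-- Exactness in degree `j`, in terms of elements. -/
def IsExactAt (X : ModComplex A) (j : ℤ) : Prop :=
  ∀ i, i - 1 = j → ∀ x : X.X j, (X.d j (j - 1)).hom x = 0 → ∃ y : X.X i, (X.d i j).hom y = x

/-- Exactness of the mapping cone of `f` in degree `j`, in terms of elements. When it holds in all
degrees, `f` is a quasi-isomorphism. -/
def IsConeExactAt {X Y : ModComplex A} (f : X ⟶ Y) (j : ℤ) : Prop :=
  ∀ i, i - 1 = j → ∀ (x : X.X (j - 1)) (y : Y.X j), (X.d (j - 1) (j - 1 - 1)).hom x = 0 →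
    (f.f (j - 1)).hom x = (Y.d j (j - 1)).hom y →
    ∃ (x' : X.X j) (y' : Y.X i), (X.d j (j - 1)).hom x' = x ∧
      y = (f.f j).hom x' + (Y.d i j).hom y'

/-- `Z` is the `k`-fold suspension of a projective resolution of `M`, up to signs: it vanishes
below degree `k`, is exact above degree `k`, and its homology in degree `k` is `M`. -/
structure IsResolutionAt (k : ℤ) (Z : ModComplex A) (M : Type u) [AddCommGroup M] [Module A M] :
    Prop where
  subsingleton : ∀ j < k, Subsingleton (Z.X j)
  projective : ∀ j, Module.Projective A (Z.X j)
  exact : ∀ j, k < j → Z.IsExactAt j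
  aug : ∃ ε : Z.X k →ₗ[A] M, Function.Surjective ε ∧
    ∀ i, i - 1 = k → ∀ x, ε x = 0 ↔ ∃ y : Z.X i, (Z.d i k).hom y = x

/-- The homology of `C` is concentrated in degree `k`, where it is `M`. -/
structure HasHomologyOnlyAt (C : ModComplex A) (k : ℤ) (M : Type u) [AddCommGroup M] [Module A M] :
    Prop where
  exact : ∀ j, j ≠ k → C.IsExactAt j
  cls : ∃ p : LinearMap.ker (C.d k (k - 1)).hom →ₗ[A] M, Function.Surjective p ∧
    ∀ i, i - 1 = k → ∀ z, p z = 0 ↔ ∃ y : C.X i, (C.d i k).hom y = z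

/-- The monomorphism `ι : F ⟶ F'` is such that the homology of `F' / F` is concentrated in degree
`k`, where it is `M`. -/
structure HasRelHomologyOnlyAt {F F' : ModComplex A} (ι : F ⟶ F') (k : ℤ) (M : Type u)
    [AddCommGroup M] [Module A M] : Prop where
  inj : ∀ j, Function.Injective (ι.f j).hom
  exact : ∀ j, j ≠ k → ∀ i, i - 1 = j → ∀ (y : F'.X j) (x : F.X (j - 1)),
    (ι.f (j - 1)).hom x = (F'.d j (j - 1)).hom y →
    ∃ (x' : F.X j) (y' : F'.X i), y = (ι.f j).hom x' + (F'.d i j).hom y'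
  cls : ∃ p : (LinearMap.range (ι.f (k - 1)).hom).comap (F'.d k (k - 1)).hom →ₗ[A] M,
    Function.Surjective p ∧ ∀ i, i - 1 = k → ∀ y, p y = 0 ↔
      ∃ (x' : F.X k) (y' : F'.X i), (y : F'.X k) = (ι.f k).hom x' + (F'.d i k).hom y'

/-- A map out of a bounded below complex of projective modules can be constructed degree by degree
as long as the target is exact above the lowest degree. -/
theorem exists_lift (Z C : ModComplex A) (k : ℤ) (hZ : ∀ j < k, Subsingleton (Z.X j))
    (hproj : ∀ j, Module.Projective A (Z.X j)) (hC : ∀ j, k < j → C.IsExactAt j)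
    (g₀ : Z.X k →ₗ[A] C.X k) (h₀ : ∀ x, (C.d k (k - 1)).hom (g₀ x) = 0)
    (h₁ : ∀ i, i - 1 = k → ∀ x : Z.X i, ∃ y : C.X i, (C.d i k).hom y = g₀ ((Z.d i k).hom x)) :
    ∃ g : Z ⟶ C, (g.f k).hom = g₀ := by
  classical
  -- `P N f`: the family `f` is a chain map up to degree `k + N` and extends one degree further.
  let P : ℕ → (∀ j, Z.X j →ₗ[A] C.X j) → Prop := fun N f => f k = g₀ ∧
    (∀ i, i ≤ k + N → ∀ x, f (i - 1) ((Z.d i (i - 1)).hom x) = (C.d i (i - 1)).hom (f i x)) ∧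
    ∀ i, i = k + N + 1 → ∀ x : Z.X i, ∃ y : C.X i,
      (C.d i (i - 1)).hom y = f (i - 1) ((Z.d i (i - 1)).hom x)
  have hzero : P 0 (Function.update 0 k g₀) := by
    refine ⟨Function.update_self .., fun i hi x => ?_, fun i hi x => ?_⟩
    · rcases lt_or_eq_of_le (show i ≤ k by simpa using hi) with hi | rfl
      · have := hZ i hi
        simp [Subsingleton.elim x 0]
      · have := hZ (i - 1) (by omega)
        rw [Subsingleton.elim ((Z.d i (i - 1)).hom x) 0, Function.update_self, h₀, map_zero]
    · obtain rfl : k = i - 1 := by simp only [Nat.cast_zero] at hi; omega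
      rw [Function.update_self]
      exact h₁ i rfl x
  have hsucc : ∀ N f, P N f → ∃ f', P (N + 1) f' ∧ ∀ j, j ≤ k + N → f' j = f j := by
    rintro N f ⟨hk, hf, hN⟩
    have := hproj (k + N + 1)
    obtain ⟨u, hu⟩ := exists_linearMap_comp_eq (C.d (k + N + 1) (k + N + 1 - 1)).hom
      (f (k + N + 1 - 1) ∘ₗ (Z.d (k + N + 1) (k + N + 1 - 1)).hom) (hN _ rfl)
    have hf' : ∀ i, i ≤ k + (N + 1 : ℕ) → ∀ x,
        Function.update f (k + N + 1) u (i - 1) ((Z.d i (i - 1)).hom x) =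
          (C.d i (i - 1)).hom (Function.update f (k + N + 1) u i x) := by
      intro i hi x
      by_cases h : i = k + N + 1
      · subst h
        rw [Function.update_self, Function.update_of_ne (by omega), hu]
        rfl
      · rw [Function.update_of_ne h, Function.update_of_ne (by push_cast at hi; omega),
          hf i (by push_cast at hi; omega)]
    refine ⟨Function.update f (k + N + 1) u, ⟨?_, hf', fun i hi x => ?_⟩, fun j hj => ?_⟩
    · rw [Function.update_of_ne (by omega), hk]
    · refine hC (i - 1) (by push_cast at hi; omega) i rfl _ ?_
      rw [← hf' (i - 1) (by push_cast at hi ⊢; omega), d_d_apply, map_zero]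
    · rw [Function.update_of_ne (by omega)]
  choose! next hnext hagree using hsucc
  let s : ℕ → (∀ j, Z.X j →ₗ[A] C.X j) := fun N =>
    Nat.rec (Function.update 0 k g₀) (fun N f => next N f) N
  have hs : ∀ N, P N (s N) := fun N => by
    induction N with
    | zero => exact hzero
    | succ N ih => exact hnext N _ ih
  have hmono : ∀ (N M : ℕ) (j : ℤ), j ≤ k + N → N ≤ M → s M j = s N j := by
    intro N M j hj hNM
    induction M, hNM using Nat.le_induction with
    | base => rfl
    | succ M hM ih => rw [← ih]; exact hagree M _ (hs M) j (by omega)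
  refine ⟨homMk (fun j => s (j - k).toNat j) fun i x => ?_, ?_⟩
  · rw [← (hs (i - k).toNat).2.1 i (by omega) x,
      ← hmono (i - 1 - k).toNat (i - k).toNat (i - 1) (by omega) (by omega)]
  · rw [homMk_f]
    exact (hs _).1

/-- A shifted resolution of `M` admits a quasi-isomorphism to every complex whose only homology
is `M`, in the appropriate degree. -/
theorem IsResolutionAt.exists_hom {k : ℤ} {Z C : ModComplex A} {M : Type u} [AddCommGroup M]
    [Module A M] (hZ : IsResolutionAt k Z M) (hC : HasHomologyOnlyAt C k M) :
    ∃ g : Z ⟶ C, ∀ j, IsConeExactAt g j := by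
  obtain ⟨ε, hε, hεk⟩ := hZ.aug
  obtain ⟨p, hp, hpk⟩ := hC.cls
  have := hZ.projective k
  obtain ⟨g₀, hg₀⟩ := Module.projective_lifting_property p ε hp
  have hg₀ : ∀ x, p (g₀ x) = ε x := fun x => LinearMap.congr_fun hg₀ x
  obtain ⟨g, hg⟩ := exists_lift Z C k hZ.subsingleton hZ.projective
    (fun j hj => hC.exact j hj.ne') (Submodule.subtype _ ∘ₗ g₀) (fun x => (g₀ x).2)
    (fun i hi x => (hpk i hi _).1 (by rw [hg₀]; exact (hεk i hi _).2 ⟨x, rfl⟩))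
  have hgk : ∀ x, (g.f k).hom x = g₀ x := fun x => by rw [hg]; rfl
  refine ⟨g, fun j i hi x y hx hxy => ?_⟩
  -- It suffices to fill `x`, as `C` is exact in degree `j`.
  have fill : j ≠ k → ∀ x' : Z.X j, (Z.d j (j - 1)).hom x' = x →
      ∃ (x' : Z.X j) (y' : C.X i), (Z.d j (j - 1)).hom x' = x ∧
        y = (g.f j).hom x' + (C.d i j).hom y' := by
    intro hj x' hx'
    obtain ⟨y', hy'⟩ := hC.exact j hj i hi (y - (g.f j).hom x') (by
      rw [map_sub, ← hxy, ← hx', hom_d_apply, sub_self])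
    exact ⟨x', y', hx', by rw [hy']; abel⟩
  rcases lt_trichotomy (j - 1) k with hjk | hjk | hjk
  · have := hZ.subsingleton _ hjk
    by_cases h : j = k
    · subst h
      obtain ⟨q, hq⟩ := hε (p ⟨y, by rw [LinearMap.mem_ker, ← hxy, Subsingleton.elim x 0, map_zero]⟩)
      obtain ⟨y', hy'⟩ := (hpk i hi (⟨y, by
        rw [LinearMap.mem_ker, ← hxy, Subsingleton.elim x 0, map_zero]⟩ - g₀ q)).1 (by
          rw [map_sub, hg₀, hq, sub_self])
      refine ⟨q, y', Subsingleton.elim _ _, ?_⟩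
      rw [hy', hgk]
      simp
    · exact fill h 0 (Subsingleton.elim _ _)
  · subst hjk
    obtain ⟨x', hx'⟩ := (hεk j rfl x).1 (by
      rw [← hg₀]
      refine (hpk j rfl _).2 ⟨y, ?_⟩
      rw [← hgk, hxy])
    exact fill (by omega) x' hx'
  · obtain ⟨x', hx'⟩ := hZ.exact _ hjk j rfl x hx
    exact fill (by omega) x' hx'

/-- If `T ⟶ F` is a quasi-isomorphism, the cone of `T ⟶ F ⟶ F'` computes the homology of
`F' / F`. -/
theorem HasRelHomologyOnlyAt.cone {T F F' : ModComplex A} {ι : F ⟶ F'} {k : ℤ} {M : Type u}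
    [AddCommGroup M] [Module A M] (hι : HasRelHomologyOnlyAt ι k M) (φ : T ⟶ F)
    (hφ : ∀ j, IsConeExactAt φ j) : HasHomologyOnlyAt (cone (φ ≫ ι)) k M := by
  have hcomp : ∀ j x, ((φ ≫ ι).f j).hom x = (ι.f j).hom ((φ.f j).hom x) := fun j x => rfl
  have cyc : ∀ j (c : (ModComplex.cone (φ ≫ ι)).X j),
      ((ModComplex.cone (φ ≫ ι)).d j (j - 1)).hom c = 0 →
      (T.d (j - 1) (j - 1 - 1)).hom (coneEquiv _ j c).1 = 0 ∧
      (ι.f (j - 1)).hom (-(φ.f (j - 1)).hom (coneEquiv _ j c).1) =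
        (F'.d j (j - 1)).hom (coneEquiv _ j c).2 := by
    intro j c hc
    have := coneEquiv_d (φ ≫ ι) j c
    rw [hc, map_zero, hcomp, eq_comm, Prod.mk_eq_zero, neg_eq_zero] at this
    refine ⟨this.1, ?_⟩
    rw [map_neg, eq_comm, eq_neg_iff_add_eq_zero, this.2]
  -- A relative cycle that is a relative boundary yields a boundary of the cone.
  have bdry : ∀ i j, i - 1 = j → ∀ (c : (ModComplex.cone (φ ≫ ι)).X j),
      ((ModComplex.cone (φ ≫ ι)).d j (j - 1)).hom c = 0 →
      (∃ (x' : F.X j) (y' : F'.X i), (coneEquiv _ j c).2 = (ι.f j).hom x' + (F'.d i j).hom y') →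
      ∃ b, ((ModComplex.cone (φ ≫ ι)).d i j).hom b = c := by
    rintro i _ rfl c hc ⟨x', y', hy⟩
    obtain ⟨h1, h2⟩ := cyc _ c hc
    obtain ⟨t', x'', ht', hx''⟩ := hφ (i - 1) i rfl (-(coneEquiv _ _ c).1) x'
      (by rw [map_neg, h1, neg_zero]) (by
        apply hι.inj
        rw [map_neg, h2, hy, map_add, hom_d_apply, d_d_apply, add_zero])
    refine ⟨(coneEquiv _ i).symm (t', (ι.f i).hom x'' + y'), ?_⟩
    rw [coneEquiv_symm_d, LinearEquiv.symm_apply_eq]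
    refine Prod.ext ?_ ?_
    · simp only [ht', neg_neg]
    · simp only [hcomp]
      rw [hy, hx'', map_add, map_add, hom_d_apply]
      abel
  refine ⟨fun j hj i hi c hc => ?_, ?_⟩
  · exact bdry i j hi c hc (hι.exact j hj i hi _ _ (cyc j c hc).2)
  · obtain ⟨p, hp, hpk⟩ := hι.cls
    refine ⟨p ∘ₗ LinearMap.codRestrict _ (LinearMap.snd A _ _ ∘ₗ
      (coneEquiv (φ ≫ ι) k).toLinearMap ∘ₗ Submodule.subtype _)
      (fun c => ⟨_, (cyc k c.1 c.2).2⟩), ?_, ?_⟩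
    · intro m
      obtain ⟨⟨y, x, hy⟩, rfl⟩ := hp m
      have hdx : (F.d (k - 1) (k - 1 - 1)).hom x = 0 := by
        apply hι.inj
        rw [hom_d_apply, hy, d_d_apply, map_zero]
      obtain ⟨t', x'', ht', hx''⟩ := hφ (k - 1) k rfl 0 x (map_zero _) (by rw [hdx, map_zero])
      refine ⟨⟨(coneEquiv _ k).symm (-t', y - (ι.f k).hom x''), ?_⟩, ?_⟩
      · rw [LinearMap.mem_ker, coneEquiv_symm_d, LinearEquiv.symm_apply_eq, map_zero]
        refine Prod.ext ?_ ?_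
        · simp [ht']
        · simp only [hcomp, map_neg, map_sub, ← hy, hx'', map_add, hom_d_apply]
          simp
      · rw [← sub_eq_zero, LinearMap.comp_apply, ← map_sub]
        refine (hpk (k + 1) (by omega) _).2 ⟨-x'', 0, ?_⟩
        change (coneEquiv (φ ≫ ι) k ((coneEquiv (φ ≫ ι) k).symm
          (-t', y - (ι.f k).hom x''))).2 - y = _
        rw [LinearEquiv.apply_symm_apply]
        simp
    · intro i hi c
      rw [LinearMap.comp_apply, hpk i hi]
      constructor
      · rintro ⟨x', y', h⟩
        exact bdry i k hi c.1 c.2 ⟨x', y', h⟩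
      · subst hi
        rintro ⟨b, hb⟩
        refine ⟨(φ.f _).hom (coneEquiv _ i b).1, (coneEquiv _ i b).2, ?_⟩
        have := coneEquiv_d (φ ≫ ι) i b
        rw [hb] at this
        change (coneEquiv _ _ c.1).2 = _
        rw [this, add_comm]
        rfl

/-- A quasi-isomorphism `ΣW ⟶ Cone(ψ : T ⟶ F)` amounts to a map `h : W ⟶ T` together with an
extension of `ψ` to a quasi-isomorphism `Cone(h) ⟶ F`. -/
theorem exists_attach {T F W : ModComplex A} (ψ : T ⟶ F) (g : W.suspension ⟶ cone ψ)
    (hg : ∀ j, IsConeExactAt g j) :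
    ∃ (h : W ⟶ T) (φ : cone h ⟶ F), (∀ j, IsConeExactAt φ j) ∧
      ∀ j y, (φ.f j).hom ((coneEquiv h j).symm (0, y)) = (ψ.f j).hom y := by
  let a : ∀ i : ℤ, W.X (i - 1) →ₗ[A] T.X (i - 1) := fun i =>
    LinearMap.fst A _ _ ∘ₗ (coneEquiv ψ i).toLinearMap ∘ₗ (g.f i).hom ∘ₗ
      (suspEquiv W i).symm.toLinearMap
  let b : ∀ i : ℤ, W.X (i - 1) →ₗ[A] F.X i := fun i =>
    LinearMap.snd A _ _ ∘ₗ (coneEquiv ψ i).toLinearMap ∘ₗ (g.f i).hom ∘ₗ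
      (suspEquiv W i).symm.toLinearMap
  have hab : ∀ i (w : W.X (i - 1)),
      coneEquiv ψ i ((g.f i).hom ((suspEquiv W i).symm w)) = (a i w, b i w) := fun i w => rfl
  have hdiff : ∀ i (w : W.X (i - 1)),
      a (i - 1) ((W.d (i - 1) (i - 1 - 1)).hom w) = (T.d (i - 1) (i - 1 - 1)).hom (a i w) ∧
      -b (i - 1) ((W.d (i - 1) (i - 1 - 1)).hom w) =
        (F.d i (i - 1)).hom (b i w) + (ψ.f (i - 1)).hom (a i w) := by
    intro i w
    have := coneEquiv_d ψ i ((g.f i).hom ((suspEquiv W i).symm w))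
    rw [← hom_d_apply, suspEquiv_symm_d, hab, hab, map_neg, map_neg] at this
    exact ⟨neg_injective (congrArg Prod.fst this), congrArg Prod.snd this⟩
  obtain ⟨h, hh⟩ := exists_hom_of_shifted a fun i w => (hdiff i w).1
  have hh : ∀ i w, (h.f (i - 1)).hom w = a i w := fun i w => by rw [hh]
  let φ : cone h ⟶ F := homMk (fun i => LinearMap.coprod (-b i) (ψ.f i).hom ∘ₗ
    (coneEquiv h i).toLinearMap) fun i z => by
      simp only [LinearMap.comp_apply, LinearEquiv.coe_coe, coneEquiv_d, LinearMap.coprod_apply,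
        LinearMap.neg_apply, map_neg, neg_neg, map_add, hom_d_apply, hh]
      rw [← neg_eq_iff_eq_neg.2 (hdiff i (coneEquiv h i z).1).2.symm]
      simp only [neg_add_rev]
      abel
  have hφ : ∀ i z, (φ.f i).hom z = -b i (coneEquiv h i z).1 + (ψ.f i).hom (coneEquiv h i z).2 :=
    fun i z => rfl
  refine ⟨h, φ, fun j i hi z y hz hzy => ?_, fun j y => by simp [hφ]⟩
  subst hi
  have hz' := coneEquiv_d h (i - 1 - 1) z
  rw [hz, map_zero, eq_comm, Prod.mk_eq_zero, neg_eq_zero, hh] at hz'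
  obtain ⟨w', c', hw', hc'⟩ := hg (i - 1) i rfl
    ((suspEquiv W _).symm (coneEquiv h _ z).1)
    ((coneEquiv ψ (i - 1)).symm ((coneEquiv h _ z).2, -y)) (by
      rw [suspEquiv_symm_d, hz'.1, neg_zero, map_zero]) (by
      rw [coneEquiv_symm_d, ← LinearEquiv.symm_apply_eq, LinearEquiv.symm_symm, hab]
      refine Prod.ext ?_ ?_
      · exact (neg_eq_of_add_eq_zero_right hz'.2).symm
      · rw [hφ] at hzy
        simp only [map_neg, ← hzy]
        abel)
  obtain ⟨w', rfl⟩ := (suspEquiv W _).symm.surjective w'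
  rw [suspEquiv_symm_d, EmbeddingLike.apply_eq_iff_eq] at hw'
  rw [LinearEquiv.symm_apply_eq, map_add, hab, coneEquiv_d] at hc'
  have hc1 := congrArg Prod.fst hc'
  have hc2 := congrArg Prod.snd hc'
  simp only [Prod.fst_add, Prod.snd_add] at hc1 hc2
  refine ⟨(coneEquiv h _).symm (w', -(coneEquiv ψ i c').1), -(coneEquiv ψ i c').2, ?_, ?_⟩
  · rw [coneEquiv_symm_d, LinearEquiv.symm_apply_eq, hh]
    refine Prod.ext hw' ?_
    simp only [map_neg]
    rw [hc1]
    abel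
  · rw [hφ, LinearEquiv.apply_symm_apply, ← neg_neg y, hc2]
    simp only [map_neg]
    abel

/-- Attaching a shifted resolution of the relative homology extends a quasi-isomorphism to `F`
to a quasi-isomorphism to `F'`. -/
theorem HasRelHomologyOnlyAt.exists_attach {T F F' W : ModComplex A} {ι : F ⟶ F'} {k : ℤ}
    {M : Type u} [AddCommGroup M] [Module A M] (hι : HasRelHomologyOnlyAt ι k M) (φ : T ⟶ F)
    (hφ : ∀ j, IsConeExactAt φ j) (hW : IsResolutionAt k W.suspension M) :
    ∃ (h : W ⟶ T) (φ' : ModComplex.cone h ⟶ F'), ∀ j, IsConeExactAt φ' j := by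
  obtain ⟨g, hg⟩ := hW.exists_hom (hι.cone φ hφ)
  obtain ⟨h, φ', hφ', -⟩ := ModComplex.exists_attach _ g hg
  exact ⟨h, φ', hφ'⟩

end ModComplex

end

noncomputable section

/-! ### Consequences of the bootstrapping axioms -/

namespace ModComplex

variable {A : Type u} [Ring A]

/-- The components of an isomorphism of complexes. -/
def isoEquiv {X Y : ModComplex A} (a : X ≅ Y) (j : ℤ) : X.X j ≃ₗ[A] Y.X j where
  __ := (a.hom.f j).hom
  invFun := (a.inv.f j).hom
  left_inv x := congrArg (fun g => (g.f j).hom x) a.hom_inv_id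
  right_inv x := congrArg (fun g => (g.f j).hom x) a.inv_hom_id

/-- Mapping cones of isomorphic maps are isomorphic. -/
def coneCongr {X Y X' Y' : ModComplex A} (f : X ⟶ Y) (f' : X' ⟶ Y') (a : X ≅ X') (b : Y ≅ Y')
    (h : f ≫ b.hom = a.hom ≫ f') : cone f ≅ cone f' :=
  isoMk (fun j => coneEquiv f j ≪≫ₗ LinearEquiv.prodCongr
      (isoEquiv a (j - 1)) (isoEquiv b j) ≪≫ₗ (coneEquiv f' j).symm)
    fun i z => by
      simp only [LinearEquiv.trans_apply, coneEquiv_symm_d, coneEquiv_d,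
        LinearEquiv.prodCongr_apply, map_neg, map_add]
      congr 1
      refine Prod.ext ?_ ?_
      · exact congrArg Neg.neg (hom_d_apply a.hom _ _ _)
      · refine congrArg₂ _ (hom_d_apply b.hom _ _ _) ?_
        exact congrArg (fun g => (g.f (i - 1)).hom (coneEquiv f i z).1) h

theorem exists_suspMap_eq {X Y : ModComplex A} (f : X.suspension ⟶ Y.suspension) :
    ∃ g : X ⟶ Y, suspMap g = f := by
  obtain ⟨g, hg⟩ := exists_hom_of_shifted (X := X) (Y := Y)
    (fun i => (suspEquiv Y i).toLinearMap ∘ₗ (f.f i).hom ∘ₗ (suspEquiv X i).symm.toLinearMap)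
    (fun i x => by
      have := congrArg (suspEquiv Y (i - 1)) (hom_d_apply f i (i - 1) ((suspEquiv X i).symm x))
      rw [suspEquiv_d, suspEquiv_symm_d, map_neg, map_neg, map_neg, neg_inj] at this
      exact this)
  refine ⟨g, ?_⟩
  ext j x
  rw [suspMap_f, hg]
  rfl

theorem isConeExactAt_iff {X Y : ModComplex A} (f : X ⟶ Y) (j : ℤ) :
    IsConeExactAt f j ↔ (cone f).IsExactAt j := by
  constructor
  · rintro h i rfl c hc
    have := coneEquiv_d f (i - 1) c
    rw [hc, map_zero, eq_comm, Prod.mk_eq_zero, neg_eq_zero] at this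
    obtain ⟨x', y', hx', hy'⟩ := h i rfl (-(coneEquiv f _ c).1) (coneEquiv f _ c).2
      (by rw [map_neg, this.1, neg_zero])
      (by rw [map_neg, eq_comm, eq_neg_iff_add_eq_zero, this.2])
    refine ⟨(coneEquiv f i).symm (x', y'), ?_⟩
    rw [coneEquiv_symm_d, LinearEquiv.symm_apply_eq]
    refine Prod.ext ?_ ?_
    · simp only [hx', neg_neg]
    · simp only [hy', add_comm]
  · rintro h i rfl x y hx hxy
    obtain ⟨c, hc⟩ := h i rfl ((coneEquiv f (i - 1)).symm (-x, y)) (by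
      rw [coneEquiv_symm_d, LinearEquiv.symm_apply_eq, map_zero]
      refine Prod.ext ?_ ?_
      · simp [hx]
      · simp [hxy])
    rw [LinearEquiv.eq_symm_apply, coneEquiv_d] at hc
    refine ⟨(coneEquiv f i c).1, (coneEquiv f i c).2, neg_injective (congrArg Prod.fst hc), ?_⟩
    rw [add_comm]
    exact (congrArg Prod.snd hc).symm

theorem isConeExactAt_iso_comp {X X' Y : ModComplex A} (e : X' ≅ X) {f : X ⟶ Y} {j : ℤ}
    (hf : IsConeExactAt f j) : IsConeExactAt (e.hom ≫ f) j :=  by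
  rintro i hi x y hx hxy
  obtain ⟨x', y', hx', hy'⟩ := hf i hi ((e.hom.f _).hom x) y
    (by rw [← hom_d_apply, hx, map_zero]) hxy
  have hinv : ∀ j x, (e.inv.f j).hom ((e.hom.f j).hom x) = x := fun j => (isoEquiv e j).left_inv
  have hinv' : ∀ j x, (e.hom.f j).hom ((e.inv.f j).hom x) = x := fun j => (isoEquiv e j).right_inv
  refine ⟨(e.inv.f _).hom x', y', ?_, ?_⟩
  · rw [← hom_d_apply, hx', hinv]
  · rw [hy']
    refine congrArg (· + _) ?_
    exact (congrArg (f.f j).hom (hinv' j x')).symm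

theorem isConeExactAt_id (X : ModComplex A) (j : ℤ) : IsConeExactAt (𝟙 X) j :=
  fun _ _ _ y _ hxy => ⟨y, 0, hxy.symm, by simp⟩

theorem projective_cone {X Y : ModComplex A} (f : X ⟶ Y)
    (hX : ∀ j, Module.Projective A (X.X j)) (hY : ∀ j, Module.Projective A (Y.X j)) (j : ℤ) :
    Module.Projective A ((cone f).X j) :=
  have := hX (j - 1)
  have := hY j
  Module.Projective.of_equiv (coneEquiv f j).symm

theorem subsingleton_cone {X Y : ModComplex A} (f : X ⟶ Y) (j : ℤ)
    (hX : Subsingleton (X.X (j - 1))) (hY : Subsingleton (Y.X j)) :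
    Subsingleton ((cone f).X j) :=
  (coneEquiv f j).toEquiv.subsingleton

theorem isNonneg_of_subsingleton {X : ModComplex A} (h : ∀ j < 0, Subsingleton (X.X j)) :
    X.IsNonneg := fun j hj =>
  have := h j hj
  ModuleCat.isZero_of_subsingleton _

namespace IsResolutionAt

variable {k : ℤ} {Z P : ModComplex A} {M : Type u} [AddCommGroup M] [Module A M]

/-- A bounded below projective complex quasi-isomorphic to a resolution is a resolution. -/
theorem of_isConeExactAt (hP : IsResolutionAt k P M) (φ : Z ⟶ P) (hφ : ∀ j, IsConeExactAt φ j)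
    (h0 : ∀ j < k, Subsingleton (Z.X j)) (hproj : ∀ j, Module.Projective A (Z.X j)) :
    IsResolutionAt k Z M := by
  refine ⟨h0, hproj, ?_, ?_⟩
  · rintro j hj i rfl x hx
    obtain ⟨y, hy⟩ := hP.exact _ hj i rfl ((φ.f _).hom x) (by rw [← hom_d_apply, hx, map_zero])
    obtain ⟨x', -, hx', -⟩ := hφ i (i + 1) (by omega) x y hx hy.symm
    exact ⟨x', hx'⟩
  · obtain ⟨ε, hε, hεk⟩ := hP.aug
    have := h0 (k - 1) (by omega)
    have := hP.subsingleton (k - 1) (by omega)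
    refine ⟨ε ∘ₗ (φ.f k).hom, fun m => ?_, ?_⟩
    · obtain ⟨y, rfl⟩ := hε m
      obtain ⟨x', y', -, hy⟩ := hφ k (k + 1) (by omega) 0 y (map_zero _) (Subsingleton.elim _ _)
      refine ⟨x', ?_⟩
      rw [hy, map_add, (hεk (k + 1) (by omega) _).2 ⟨y', rfl⟩, add_zero]
      rfl
    · rintro i rfl x
      rw [LinearMap.comp_apply, hεk i rfl]
      constructor
      · rintro ⟨y, hy⟩
        obtain ⟨x', -, hx', -⟩ := hφ i (i + 1) (by omega) x y
          (Subsingleton.elim _ _) hy.symm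
        exact ⟨x', hx'⟩
      · rintro ⟨y, rfl⟩
        exact ⟨(φ.f i).hom y, (hom_d_apply φ _ _ _).symm⟩

theorem of_iso (hP : IsResolutionAt k P M) (e : Z ≅ P) : IsResolutionAt k Z M := by
  refine hP.of_isConeExactAt e.hom (fun j => ?_) (fun j hj => ?_) (fun j => ?_)
  · simpa using isConeExactAt_iso_comp e (isConeExactAt_id P j)
  · have := hP.subsingleton j hj
    exact (isoEquiv e j).toEquiv.subsingleton
  · have := hP.projective j
    exact Module.Projective.of_equiv (isoEquiv e j).symm

theorem suspension (hZ : IsResolutionAt k Z M) : IsResolutionAt (k + 1) Z.suspension M := by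
  obtain ⟨k, rfl⟩ : ∃ k', k = k' - 1 := ⟨k + 1, by omega⟩
  rw [show k - 1 + 1 = k by omega]
  refine ⟨fun j hj => ?_, fun j => ?_, ?_, ?_⟩
  · have := hZ.subsingleton (j - 1) (by omega)
    exact (suspEquiv Z j).toEquiv.subsingleton
  · have := hZ.projective (j - 1)
    exact Module.Projective.of_equiv (suspEquiv Z j).symm
  · rintro _ hj i rfl x hx
    obtain ⟨x, rfl⟩ := (suspEquiv Z _).symm.surjective x
    rw [suspEquiv_symm_d, LinearEquiv.map_eq_zero_iff, neg_eq_zero] at hx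
    obtain ⟨y, hy⟩ := hZ.exact _ (by omega) (i - 1) rfl x hx
    exact ⟨(suspEquiv Z i).symm (-y), by rw [suspEquiv_symm_neg_d, hy]⟩
  · obtain ⟨ε, hε, hεk⟩ := hZ.aug
    refine ⟨ε ∘ₗ (suspEquiv Z k).toLinearMap, hε.comp (suspEquiv Z k).surjective, ?_⟩
    rintro i rfl x
    obtain ⟨x, rfl⟩ := (suspEquiv Z _).symm.surjective x
    simp only [LinearMap.comp_apply, LinearEquiv.coe_coe, LinearEquiv.apply_symm_apply]
    rw [hεk (i - 1) rfl]
    constructor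
    · rintro ⟨y, rfl⟩
      exact ⟨(suspEquiv Z i).symm (-y), suspEquiv_symm_neg_d Z i y⟩
    · rintro ⟨y, hy⟩
      obtain ⟨y, rfl⟩ := (suspEquiv Z _).symm.surjective y
      rw [suspEquiv_symm_d, EmbeddingLike.apply_eq_iff_eq] at hy
      exact ⟨-y, by rw [map_neg, hy]⟩

/-- The direct sum of two resolutions, as the cone of a zero map. -/
theorem cone_zero {W Q : ModComplex A} {M' : Type u} [AddCommGroup M'] [Module A M']
    (hW : IsResolutionAt k W.suspension M') (hQ : IsResolutionAt k Q M) :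
    IsResolutionAt k (cone (0 : W ⟶ Q)) (M' × M) := by
  have hWs : ∀ j (x : W.X (j - 1)), (W.suspension.d j (j - 1)).hom ((suspEquiv W j).symm x) =
      (suspEquiv W (j - 1)).symm (-(W.d (j - 1) (j - 1 - 1)).hom x) := suspEquiv_symm_d W
  have hzero : ∀ j (x : W.X j), ((0 : W ⟶ Q).f j).hom x = 0 := fun j x => rfl
  refine ⟨fun j hj => ?_, fun j => ?_, ?_, ?_⟩
  · have := hW.subsingleton j hj
    exact subsingleton_cone _ j (suspEquiv W j).symm.toEquiv.subsingleton (hQ.subsingleton j hj)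
  · have := hW.projective j
    have := hQ.projective j
    exact Module.Projective.of_equiv ((coneEquiv (0 : W ⟶ Q) j).trans
      (LinearEquiv.prodCongr (suspEquiv W j).symm (LinearEquiv.refl A _))).symm
  · rintro j hj i rfl z hz
    obtain ⟨⟨x, y⟩, rfl⟩ := (coneEquiv (0 : W ⟶ Q) _).symm.surjective z
    rw [coneEquiv_symm_d, LinearEquiv.map_eq_zero_iff, Prod.mk_eq_zero, hzero, add_zero] at hz
    obtain ⟨x', hx'⟩ := hW.exact _ hj i rfl ((suspEquiv W _).symm x) (by
      rw [hWs, hz.1, map_zero])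
    obtain ⟨x', rfl⟩ := (suspEquiv W _).symm.surjective x'
    rw [hWs, EmbeddingLike.apply_eq_iff_eq] at hx'
    obtain ⟨y', hy'⟩ := hQ.exact _ hj i rfl y hz.2
    refine ⟨(coneEquiv _ i).symm (x', y'), ?_⟩
    rw [coneEquiv_symm_d, hx', hzero, hy', add_zero]
  · obtain ⟨ε, hε, hεk⟩ := hQ.aug
    obtain ⟨ε', hε', hεk'⟩ := hW.aug
    refine ⟨LinearMap.prodMap (ε' ∘ₗ (suspEquiv W k).symm.toLinearMap) ε ∘ₗ
      (coneEquiv (0 : W ⟶ Q) k).toLinearMap, ?_, ?_⟩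
    · exact ((hε'.comp (suspEquiv W k).symm.surjective).prodMap hε).comp (coneEquiv _ k).surjective
    · rintro i rfl z
      obtain ⟨⟨x, y⟩, rfl⟩ := (coneEquiv (0 : W ⟶ Q) _).symm.surjective z
      simp only [LinearMap.comp_apply, LinearEquiv.coe_coe, LinearEquiv.apply_symm_apply,
        LinearMap.prodMap_apply, Prod.mk_eq_zero]
      rw [hεk i rfl, hεk' i rfl]
      constructor
      · rintro ⟨⟨x', hx'⟩, y', hy'⟩
        obtain ⟨x', rfl⟩ := (suspEquiv W _).symm.surjective x'
        rw [hWs, EmbeddingLike.apply_eq_iff_eq] at hx'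
        refine ⟨(coneEquiv _ i).symm (x', y'), ?_⟩
        rw [coneEquiv_symm_d, hx', hzero, hy', add_zero]
      · rintro ⟨z, hz⟩
        obtain ⟨⟨x', y'⟩, rfl⟩ := (coneEquiv (0 : W ⟶ Q) _).symm.surjective z
        rw [coneEquiv_symm_d, EmbeddingLike.apply_eq_iff_eq, Prod.mk_inj, hzero, add_zero] at hz
        exact ⟨⟨(suspEquiv W i).symm x', by rw [hWs, hz.1]⟩, y', hz.2⟩

end IsResolutionAt

end ModComplex

namespace IsBootstrappable

open ModComplex

variable {A : Type u} [Ring A] {B : ℤ → ModComplex A → Prop}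

/-- The cone axiom with its hypothesis on `W` replaced by one on `ΣW`. Unlike the original, this
form is available in degree `0` without control over negative degrees. -/
theorem cone_of_suspension (hB : IsBootstrappable A B) (n : ℕ) {W T : ModComplex A} (h : W ⟶ T)
    (hW : B n W.suspension) (hT : B n T) : B n (ModComplex.cone h) := by
  rw [hB.suspension n]
  refine hB.of_iso _ _ _ (coneSuspIso h) ?_
  have := hB.cone (n + 1) _ _ (suspMap h) (by simpa using hW)
    (by simpa using (hB.suspension n T).1 hT)
  simpa using this

/-- Attaching something concentrated in degrees `≥ n` along its boundary preserves `B n`. -/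
theorem cone_of_subsingleton (hB : IsBootstrappable A B) (n : ℕ) {W T : ModComplex A} (h : W ⟶ T)
    (hW : ∀ j < (n : ℤ), Subsingleton (W.X j)) (hT : B n T) : B n (ModComplex.cone h) := by
  induction n generalizing W T with
  | zero =>
    exact hB.cone 0 W T h (hB.degree W (isNonneg_of_subsingleton hW) _ (by simp)) hT
  | succ n ih =>
    obtain ⟨W', ⟨a⟩⟩ := exists_suspension_iso W
    obtain ⟨T', ⟨b⟩⟩ := exists_suspension_iso T
    obtain ⟨h', hh'⟩ := exists_suspMap_eq (a.hom ≫ h ≫ b.inv)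
    refine hB.of_iso _ _ _ (coneCongr (suspMap h') h a b (by simp [hh'])) ?_
    refine hB.of_iso _ _ _ (coneSuspIso h').symm ?_
    push_cast
    rw [← hB.suspension n]
    refine ih h' (fun j hj => ?_) ((hB.suspension n _).2 ?_)
    · have := hW (j + 1) (by push_cast; omega)
      have : Subsingleton (W'.suspension.X (j + 1)) :=
        (isoEquiv a (j + 1)).toEquiv.subsingleton
      have := (suspEquiv W' (j + 1)).symm.toEquiv.subsingleton
      rwa [add_sub_cancel_right] at this
    · exact hB.of_iso _ _ _ b.symm (by exact_mod_cast hT)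

theorem exists_isResolutionAt_add (hB : IsBootstrappable A B) (m : ℕ) {M : Type u} [AddCommGroup M]
    [Module A M] (h : ∃ Q, IsResolutionAt 0 Q M ∧ B m Q) (k : ℕ) :
    ∃ Q, IsResolutionAt k Q M ∧ B (m + k : ℕ) Q := by
  induction k with
  | zero => simpa using h
  | succ k ih =>
    obtain ⟨Q, hQ, hBQ⟩ := ih
    refine ⟨Q.suspension, by exact_mod_cast hQ.suspension, ?_⟩
    have := (hB.suspension _ _).1 hBQ
    exact_mod_cast this

theorem exists_isResolutionAt_prod (hB : IsBootstrappable A B) (m : ℕ) {M M' : Type u}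
    [AddCommGroup M] [Module A M] [AddCommGroup M'] [Module A M']
    (h : ∃ Q, IsResolutionAt 0 Q M ∧ B m Q) (h' : ∃ Q, IsResolutionAt 0 Q M' ∧ B m Q) :
    ∃ Q, IsResolutionAt 0 Q (M × M') ∧ B m Q := by
  obtain ⟨Q, hQ, hBQ⟩ := h
  obtain ⟨Q', hQ', hBQ'⟩ := h'
  obtain ⟨W, ⟨e⟩⟩ := exists_suspension_iso Q
  exact ⟨_, (hQ.of_iso e).cone_zero hQ',
    hB.cone_of_suspension m _ (hB.of_iso _ _ _ e.symm hBQ) hBQ'⟩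

end IsBootstrappable

end

noncomputable section

/-! ### From a partial resolution to a resolution -/

theorem Module.Projective.ker_of_surjective {A : Type*} [Ring A] {M N : Type*} [AddCommGroup M]
    [Module A M] [AddCommGroup N] [Module A N] [Module.Projective A M] [Module.Projective A N]
    (f : M →ₗ[A] N) (hf : Function.Surjective f) : Module.Projective A (LinearMap.ker f) := by
  obtain ⟨s, hs⟩ := Module.projective_lifting_property f LinearMap.id hf
  have hs : ∀ x, f (s x) = x := fun x => LinearMap.congr_fun hs x
  refine Module.Projective.of_split (LinearMap.ker f).subtype
    (LinearMap.codRestrict (LinearMap.ker f) (LinearMap.id - s ∘ₗ f) fun x => by simp [hs]) ?_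
  ext ⟨x, hx⟩
  simp [LinearMap.mem_ker.1 hx]

namespace ModComplex

variable {A : Type u} [Ring A]

/-- The subcomplex formed by a family of submodules preserved by the differential. -/
def subComplex (X : ModComplex A) (S : ∀ j, Submodule A (X.X j))
    (hS : ∀ i j, ∀ x ∈ S i, (X.d i j).hom x ∈ S j) : ModComplex A where
  X j := ModuleCat.of A (S j)
  d i j := ModuleCat.ofHom ((X.d i j).hom.restrict (hS i j))
  shape i j h := by
    rw [← ModuleCat.ofHom_zero]
    congr 1
    ext x
    simp [X.shape i j h]
  d_comp_d' i j k _ _ := by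
    rw [← ModuleCat.ofHom_comp, ← ModuleCat.ofHom_zero]
    congr 1
    ext x
    exact d_d_apply X i j k x.1

section subComplex

variable (X : ModComplex A) (S : ∀ j, Submodule A (X.X j))
    (hS : ∀ i j, ∀ x ∈ S i, (X.d i j).hom x ∈ S j)

/-- The chain modules of a subcomplex. -/
def subEquiv (j : ℤ) : (subComplex X S hS).X j ≃ₗ[A] S j := LinearEquiv.refl A _

theorem subEquiv_d (i j : ℤ) (x : (subComplex X S hS).X i) :
    (subEquiv X S hS j (((subComplex X S hS).d i j).hom x) : X.X j) =
      (X.d i j).hom (subEquiv X S hS i x) := rfl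

/-- The inclusion of a subcomplex. -/
def subIncl : subComplex X S hS ⟶ X :=
  homMk (fun j => (S j).subtype ∘ₗ (subEquiv X S hS j).toLinearMap) fun _ x =>
    subEquiv_d X S hS _ _ x

theorem subIncl_f (j : ℤ) (x : (subComplex X S hS).X j) :
    ((subIncl X S hS).f j).hom x = subEquiv X S hS j x := rfl

end subComplex

/-- A bounded below complex of projective modules that is exact below degree `k` is
quasi-isomorphic to a complex of projective modules that vanishes below degree `k`. -/
theorem exists_truncation (D : ModComplex A) (k : ℤ) (hproj : ∀ j, Module.Projective A (D.X j))
    (h0 : ∀ j < 0, Subsingleton (D.X j)) (hD : ∀ j < k, D.IsExactAt j) :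
    ∃ (D' : ModComplex A) (g : D' ⟶ D), (∀ j, Module.Projective A (D'.X j)) ∧
      (∀ j < k, Subsingleton (D'.X j)) ∧ ∀ j, IsConeExactAt g j := by
  have hker : ∀ N : ℕ, (N : ℤ) ≤ k + 1 →
      Module.Projective A (LinearMap.ker (D.d (N - 1) (N - 1 - 1)).hom) := by
    intro N hN
    induction N with
    | zero =>
      have := h0 ((0 : ℕ) - 1) (by simp)
      infer_instance
    | succ N ih =>
      have := ih (by push_cast at hN; omega)
      rw [show ((N + 1 : ℕ) : ℤ) - 1 = N by push_cast; ring]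
      let f : D.X N →ₗ[A] LinearMap.ker (D.d (N - 1) (N - 1 - 1)).hom :=
        LinearMap.codRestrict _ (D.d N (N - 1)).hom fun x => d_d_apply D _ _ _ x
      have hf : Function.Surjective f := by
        rintro ⟨x, hx⟩
        obtain ⟨y, hy⟩ := hD (N - 1) (by push_cast at hN; omega) N rfl x hx
        exact ⟨y, Subtype.ext hy⟩
      have := hproj N
      have h := Module.Projective.ker_of_surjective f hf
      rwa [show LinearMap.ker f = LinearMap.ker (D.d N (N - 1)).hom from
        LinearMap.ker_codRestrict _ _ _] at h
  have hkerk : Module.Projective A (LinearMap.ker (D.d k (k - 1)).hom) := by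
    by_cases hk : k < 0
    · have := h0 k hk
      infer_instance
    · have := hker (k + 1).toNat (by omega)
      rwa [show ((k + 1).toNat : ℤ) - 1 = k by omega] at this
  let S : ∀ j, Submodule A (D.X j) := fun j =>
    if j < k then ⊥ else if j = k then LinearMap.ker (D.d j (j - 1)).hom else ⊤
  have hlt : ∀ j, j < k → S j = ⊥ := fun j hj => if_pos hj
  have heq : S k = LinearMap.ker (D.d k (k - 1)).hom := by simp [S]
  have hgt : ∀ j, k < j → S j = ⊤ := fun j hj => by
    simp only [S]
    rw [if_neg (by omega), if_neg (by omega)]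
  have hS : ∀ i j, ∀ x ∈ S i, (D.d i j).hom x ∈ S j := by
    intro i j x hx
    by_cases hij : i - 1 = j
    · subst hij
      rcases lt_trichotomy i k with h | rfl | h
      · rw [hlt i h, Submodule.mem_bot] at hx
        rw [hx, map_zero]
        exact zero_mem _
      · rw [heq, LinearMap.mem_ker] at hx
        rw [hx]
        exact zero_mem _
      · by_cases h' : i - 1 = k
        · subst h'
          rw [heq, LinearMap.mem_ker, d_d_apply]
        · rw [hgt (i - 1) (by omega)]
          exact Submodule.mem_top
    · rw [D.shape i j (by simp only [ComplexShape.down_Rel]; omega)]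
      exact zero_mem _
  have hSproj : ∀ j, Module.Projective A (S j) := by
    intro j
    rcases lt_trichotomy j k with h | rfl | h
    · rw [hlt j h]
      infer_instance
    · rwa [heq]
    · rw [hgt j h]
      have := hproj j
      exact Module.Projective.of_equiv Submodule.topEquiv.symm
  refine ⟨subComplex D S hS, subIncl D S hS, fun j => ?_, fun j hj => ?_, ?_⟩
  · have := hSproj j
    exact Module.Projective.of_equiv (subEquiv D S hS j).symm
  · have : Subsingleton (S j) := by
      rw [hlt j hj]
      infer_instance
    exact (subEquiv D S hS j).toEquiv.subsingleton
  · intro j i hi x y hx hxy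
    rw [subIncl_f] at hxy
    -- An element in degree `≥ k` of `D` lifts to the truncation as soon as it lies in `S`.
    have lift : y ∈ S j → ∃ (x' : (subComplex D S hS).X j) (y' : D.X i),
        ((subComplex D S hS).d j (j - 1)).hom x' = x ∧
          y = ((subIncl D S hS).f j).hom x' + (D.d i j).hom y' := by
      intro hy
      refine ⟨(subEquiv D S hS j).symm ⟨y, hy⟩, 0, ?_, ?_⟩
      · apply (subEquiv D S hS _).injective
        apply Subtype.ext
        rw [subEquiv_d, hxy, LinearEquiv.apply_symm_apply]
      · rw [subIncl_f, LinearEquiv.apply_symm_apply, map_zero, add_zero]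
    have hxzero : j - 1 < k → subEquiv D S hS (j - 1) x = 0 := by
      intro h
      have : (subEquiv D S hS (j - 1) x : D.X (j - 1)) ∈ S (j - 1) :=
        (subEquiv D S hS (j - 1) x).2
      have hbot : ∀ z ∈ S (j - 1), z = 0 := by simp [hlt _ h]
      exact Subtype.ext (hbot _ this)
    rcases lt_trichotomy j k with h | rfl | h
    · have hx0 := hxzero (by omega)
      rw [hx0, Submodule.coe_zero] at hxy
      obtain ⟨y', hy'⟩ := hD j h i hi y hxy.symm
      refine ⟨0, y', ?_, by rw [map_zero, hy', zero_add]⟩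
      rw [map_zero, eq_comm]
      exact (LinearEquiv.map_eq_zero_iff _).1 hx0
    · have hx0 := hxzero (by omega)
      rw [hx0, Submodule.coe_zero] at hxy
      exact lift (by rw [heq, LinearMap.mem_ker, hxy])
    · exact lift (by rw [hgt j h]; exact Submodule.mem_top)

/-- `η` makes the nonnegative complex `X` an `n`-connected complex over `L`: the augmented complex
`⋯ ⟶ X₁ ⟶ X₀ ⟶ L ⟶ 0` is exact at `L` and at all `X_j` with `j < n`. -/
structure IsAugmentation (n : ℕ) (X : ModComplex A) {L : Type u} [AddCommGroup L] [Module A L]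
    (η : X.X 0 →ₗ[A] L) : Prop where
  subsingleton : ∀ j < 0, Subsingleton (X.X j)
  surjective : Function.Surjective η
  comp_d : ∀ i, i - 1 = 0 → ∀ x, η ((X.d i 0).hom x) = 0
  ker : 0 < n → ∀ i, i - 1 = 0 → ∀ x, η x = 0 → ∃ y : X.X i, (X.d i 0).hom y = x
  exact : ∀ j : ℤ, 0 < j → j < n → X.IsExactAt j

theorem IsAugmentation.of_isConeExactAt {n : ℕ} {T F : ModComplex A} {L : Type u} [AddCommGroup L]
    [Module A L] {η : F.X 0 →ₗ[A] L} (hη : IsAugmentation n F η) (φ : T ⟶ F)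
    (hφ : ∀ j, IsConeExactAt φ j) (hT : ∀ j < 0, Subsingleton (T.X j)) :
    IsAugmentation n T (η ∘ₗ (φ.f 0).hom) := by
  have := hT (0 - 1) (by simp)
  have := hη.subsingleton (0 - 1) (by simp)
  refine ⟨hT, fun l => ?_, fun i hi x => ?_, fun hn i hi x hx => ?_, fun j hj hjn i hi x hx => ?_⟩
  · obtain ⟨y, rfl⟩ := hη.surjective l
    obtain ⟨x', y', -, hy⟩ := hφ 0 1 (by simp) 0 y (map_zero _) (Subsingleton.elim _ _)
    refine ⟨x', ?_⟩
    rw [hy, map_add, hη.comp_d 1 (by simp), add_zero]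
    rfl
  · rw [LinearMap.comp_apply, hom_d_apply, hη.comp_d i hi]
  · obtain ⟨y, hy⟩ := hη.ker hn i hi ((φ.f 0).hom x) hx
    obtain rfl : i = 1 := by omega
    obtain ⟨x', -, hx', -⟩ := hφ 1 (1 + 1) (by simp) x y (Subsingleton.elim (α := T.X (0 - 1)) _ _)
      hy.symm
    exact ⟨x', hx'⟩
  · subst hi
    obtain ⟨y, hy⟩ := hη.exact _ hj hjn i rfl ((φ.f _).hom x) (by rw [← hom_d_apply, hx, map_zero])
    obtain ⟨x', -, hx', -⟩ := hφ i (i + 1) (by simp) x y hx hy.symm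
    exact ⟨x', hx'⟩

/-- An `n`-connected map from a projective complex `T` to a module with resolution `P` extends to a
resolution of that module by attaching projective modules in degrees `> n`. -/
theorem IsAugmentation.exists_cone_isResolutionAt {n : ℕ} {T P : ModComplex A} {L : Type u}
    [AddCommGroup L] [Module A L] {η : T.X 0 →ₗ[A] L} (hη : IsAugmentation n T η)
    (hT : ∀ j, Module.Projective A (T.X j)) (hP : IsResolutionAt 0 P L) :
    ∃ (W : ModComplex A) (h : W ⟶ T), (∀ j < (n : ℤ), Subsingleton (W.X j)) ∧
      IsResolutionAt 0 (cone h) L := by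
  obtain ⟨ε, hε, hεk⟩ := hP.aug
  have := hT 0
  obtain ⟨g₀, hg₀⟩ := Module.projective_lifting_property ε η hε
  have hg₀ : ∀ x, ε (g₀ x) = η x := fun x => LinearMap.congr_fun hg₀ x
  have := hP.subsingleton (0 - 1) (by simp)
  have := hη.subsingleton (0 - 1) (by simp)
  obtain ⟨g, hg⟩ := exists_lift T P 0 hη.subsingleton hT hP.exact g₀
    (fun x => Subsingleton.elim _ _)
    (fun i hi x => (hεk i hi _).1 (by rw [hg₀, hη.comp_d i hi]))
  have hεg : ∀ x, ε ((g.f 0).hom x) = η x := fun x => by rw [hg, hg₀]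
  have hgn : ∀ j < (n : ℤ) + 1, IsConeExactAt g j := by
    intro j hj i hi x y hx hxy
    have fill : 0 < j → ∀ x' : T.X j, (T.d j (j - 1)).hom x' = x →
        ∃ (x' : T.X j) (y' : P.X i), (T.d j (j - 1)).hom x' = x ∧
          y = (g.f j).hom x' + (P.d i j).hom y' := by
      intro hj x' hx'
      obtain ⟨y', hy'⟩ := hP.exact j hj i hi (y - (g.f j).hom x') (by
        rw [map_sub, ← hxy, ← hx', hom_d_apply, sub_self])
      exact ⟨x', y', hx', by rw [hy']; abel⟩
    rcases lt_trichotomy j 0 with h | rfl | h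
    · have := hP.subsingleton j h
      have := hη.subsingleton (j - 1) (by omega)
      exact ⟨0, 0, Subsingleton.elim _ _, Subsingleton.elim _ _⟩
    · obtain ⟨x', hx'⟩ := hη.surjective (ε y)
      obtain ⟨y', hy'⟩ := (hεk i hi (y - (g.f 0).hom x')).1 (by
        rw [map_sub, hεg, hx', sub_self])
      exact ⟨x', y', Subsingleton.elim _ _, by rw [hy']; abel⟩
    · by_cases h' : j = 1
      · subst h'
        obtain ⟨x', hx'⟩ := hη.ker (by omega) 1 (by simp) x (by
          rw [← hεg]
          exact (hεk 1 (by simp) _).2 ⟨y, hxy.symm⟩)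
        exact fill h x' hx'
      · obtain ⟨x', hx'⟩ := hη.exact (j - 1) (by omega) (by omega) j rfl x hx
        exact fill h x' hx'
  obtain ⟨D', t, hD'proj, hD's, ht⟩ := exists_truncation (cone g) (n + 1)
    (projective_cone g hT hP.projective)
    (fun j hj => subsingleton_cone g j (hη.subsingleton _ (by omega)) (hP.subsingleton j hj))
    (fun j hj => (isConeExactAt_iff g j).1 (hgn j hj))
  obtain ⟨W, ⟨e⟩⟩ := exists_suspension_iso D'
  obtain ⟨h, φ, hφ, -⟩ := exists_attach g (e.hom ≫ t) fun j => isConeExactAt_iso_comp e (ht j)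
  have hWe : ∀ j, Nonempty (W.X (j - 1) ≃ₗ[A] D'.X j) := fun j =>
    ⟨(suspEquiv W j).symm ≪≫ₗ isoEquiv e j⟩
  have hWs : ∀ j < (n : ℤ), Subsingleton (W.X j) := fun j hj => by
    obtain ⟨j, rfl⟩ : ∃ j', j = j' - 1 := ⟨j + 1, by omega⟩
    have := hD's j (by omega)
    exact (hWe j).some.toEquiv.subsingleton
  have hWproj : ∀ j, Module.Projective A (W.X j) := fun j => by
    obtain ⟨j, rfl⟩ : ∃ j', j = j' - 1 := ⟨j + 1, by omega⟩
    have := hD'proj j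
    exact Module.Projective.of_equiv (hWe j).some.symm
  exact ⟨W, h, hWs, hP.of_isConeExactAt φ hφ
    (fun j hj => subsingleton_cone h j (hWs _ (by omega)) (hη.subsingleton j hj))
    (projective_cone h hWproj hT)⟩

end ModComplex

open ModComplex in
/-- The bootstrapping argument: if a filtered complex `F 0 ⟶ F 1 ⟶ ⋯ ⟶ F n` is `n`-connected over
`L` and the graded pieces have homology `M k` in degree `k` only, then resolutions of the `M k` in
`B (n - k)` can be assembled to a resolution of `L` in `B n`. -/
theorem IsBootstrappable.exists_isResolutionAt_of_filtration {A : Type u} [Ring A]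
    {B : ℤ → ModComplex A → Prop} (hB : IsBootstrappable A B) (n : ℕ) (F : ℕ → ModComplex A)
    (ι : ∀ k, F k ⟶ F (k + 1)) (M : ℕ → Type u) [∀ k, AddCommGroup (M k)] [∀ k, Module A (M k)]
    (h0 : HasHomologyOnlyAt (F 0) 0 (M 0))
    (hι : ∀ k < n, HasRelHomologyOnlyAt (ι k) (k + 1 : ℕ) (M (k + 1)))
    (hM0 : ∃ Q, IsResolutionAt 0 Q (M 0) ∧ B n Q)
    (hM : ∀ k, k + 1 ≤ n → Subsingleton (M (k + 1)) ∨
      ∃ Q, IsResolutionAt 0 Q (M (k + 1)) ∧ B (n - (k + 1) : ℕ) Q)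
    {L : Type u} [AddCommGroup L] [Module A L] {P : ModComplex A} (hP : IsResolutionAt 0 P L)
    {η : (F n).X 0 →ₗ[A] L} (hη : IsAugmentation n (F n) η) :
    ∃ Q, IsResolutionAt 0 Q L ∧ B n Q := by
  have key : ∀ k ≤ n, ∃ (T : ModComplex A) (φ : T ⟶ F k), (∀ j < 0, Subsingleton (T.X j)) ∧
      (∀ j, Module.Projective A (T.X j)) ∧ B n T ∧ ∀ j, IsConeExactAt φ j := by
    intro k hk
    induction k with
    | zero =>
      obtain ⟨Q, hQ, hBQ⟩ := hM0
      obtain ⟨g, hg⟩ := hQ.exists_hom h0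
      exact ⟨Q, g, hQ.subsingleton, hQ.projective, hBQ, hg⟩
    | succ k ih =>
      obtain ⟨T, φ, hTs, hTp, hBT, hφ⟩ := ih (by omega)
      rcases hM k hk with hMk | hMk
      · refine ⟨T, φ ≫ ι k, hTs, hTp, hBT, fun j => (isConeExactAt_iff _ j).2 ?_⟩
        have hC := (hι k (by omega)).cone φ hφ
        by_cases hj : j = (k + 1 : ℕ)
        · subst hj
          obtain ⟨p, -, hpk⟩ := hC.cls
          exact fun i hi x hx => (hpk i hi ⟨x, hx⟩).1 (Subsingleton.elim _ _)
        · exact hC.exact j hj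
      · obtain ⟨W, hW, hBW⟩ := hB.exists_isResolutionAt_add _ hMk k
        have hW' := hW.suspension
        have hBW' := (hB.suspension _ _).1 hBW
        rw [show ((n - (k + 1) + k : ℕ) : ℤ) + 1 = n by omega] at hBW'
        obtain ⟨h, φ', hφ'⟩ := (hι k (by omega)).exists_attach φ hφ (by exact_mod_cast hW')
        refine ⟨_, φ', fun j hj => ?_, ?_, hB.cone_of_suspension n h hBW' hBT, hφ'⟩
        · exact subsingleton_cone h j (hW.subsingleton _ (by omega)) (hTs j hj)
        · exact projective_cone h hW.projective hTp
  obtain ⟨T, φ, hTs, hTp, hBT, hφ⟩ := key n le_rfl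
  obtain ⟨W, h, hW, hQ⟩ := (hη.of_isConeExactAt φ hφ hTs).exists_cone_isResolutionAt hTp hP
  exact ⟨_, hQ, hB.cone_of_subsingleton n h hW hBT⟩

end

noncomputable section

/-! ### Homology classes and projective resolutions -/

namespace ModComplex

variable {A : Type u} [Ring A]

/-- A cycle, as an element of the abstract object of cycles. -/
def cycleMk (X : ModComplex A) (j : ℤ) :
    LinearMap.ker (X.d j (j - 1)).hom →ₗ[A] X.cycles j :=
  (X.liftCycles (ModuleCat.ofHom (LinearMap.ker (X.d j (j - 1)).hom).subtype) (j - 1)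
    (ChainComplex.next ℤ j) (by ext x; exact x.2)).hom

theorem iCycles_cycleMk (X : ModComplex A) (j : ℤ) (z : LinearMap.ker (X.d j (j - 1)).hom) :
    (X.iCycles j).hom (cycleMk X j z) = z :=
  congrArg (fun g => g.hom z)
    (X.liftCycles_i (ModuleCat.ofHom (LinearMap.ker (X.d j (j - 1)).hom).subtype) (j - 1)
      (ChainComplex.next ℤ j) (by ext x; exact x.2))

theorem iCycles_injective (X : ModComplex A) (j : ℤ) : Function.Injective (X.iCycles j).hom :=
  (ModuleCat.mono_iff_injective (X.iCycles j)).1 inferInstance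

/-- The homology class of a cycle. -/
def homologyClass (X : ModComplex A) (j : ℤ) :
    LinearMap.ker (X.d j (j - 1)).hom →ₗ[A] X.homology j :=
  (X.homologyπ j).hom ∘ₗ cycleMk X j

theorem homologyClass_surjective (X : ModComplex A) (j : ℤ) :
    Function.Surjective (homologyClass X j) := by
  intro h
  obtain ⟨z, rfl⟩ := (ModuleCat.epi_iff_surjective (X.homologyπ j)).1 inferInstance h
  have hz : (X.d j (j - 1)).hom ((X.iCycles j).hom z) = 0 :=
    congrArg (fun g => g.hom z) (X.iCycles_d j (j - 1))
  exact ⟨⟨(X.iCycles j).hom z, hz⟩,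
    congrArg (X.homologyπ j).hom (iCycles_injective X j (iCycles_cycleMk X j _))⟩

theorem homologyClass_eq_zero_iff (X : ModComplex A) (i j : ℤ) (hij : i - 1 = j)
    (z : LinearMap.ker (X.d j (j - 1)).hom) :
    homologyClass X j z = 0 ↔ ∃ y : X.X i, (X.d i j).hom y = z := by
  have hprev : (ComplexShape.down ℤ).prev j = i := by
    rw [ChainComplex.prev]
    omega
  have hex := ShortComplex.exact_of_g_is_cokernel
    (ShortComplex.mk (X.toCycles i j) (X.homologyπ j) (by simp)) (X.homologyIsCokernel i j hprev)
  rw [ShortComplex.moduleCat_exact_iff] at hex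
  have hto : ∀ y, (X.iCycles j).hom ((X.toCycles i j).hom y) = (X.d i j).hom y := fun y =>
    congrArg (fun g => g.hom y) (X.toCycles_i i j)
  constructor
  · intro h
    obtain ⟨y, hy⟩ := hex _ h
    refine ⟨y, (hto y).symm.trans ?_⟩
    exact (congrArg (X.iCycles j).hom hy).trans (iCycles_cycleMk X j z)
  · rintro ⟨y, hy⟩
    have : (X.toCycles i j).hom y = cycleMk X j z :=
      iCycles_injective X j ((hto y).trans (hy.trans (iCycles_cycleMk X j z).symm))
    refine (congrArg (X.homologyπ j).hom this).symm.trans ?_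
    exact congrArg (fun g => g.hom y) (X.toCycles_comp_homologyπ i j)

theorem homologyMap_homologyClass {X Y : ModComplex A} (f : X ⟶ Y) (j : ℤ)
    (z : LinearMap.ker (X.d j (j - 1)).hom) (w : LinearMap.ker (Y.d j (j - 1)).hom)
    (hw : (f.f j).hom z = w) :
    (HomologicalComplex.homologyMap f j).hom (homologyClass X j z) = homologyClass Y j w := by
  refine Eq.trans (congrArg (fun g => g.hom (cycleMk X j z))
    (HomologicalComplex.homologyπ_naturality f j)) ?_
  refine congrArg (Y.homologyπ j).hom (iCycles_injective Y j ?_)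
  refine Eq.trans (congrArg (fun g => g.hom (cycleMk X j z))
    (HomologicalComplex.cyclesMap_i f j)) ?_
  refine Eq.trans (congrArg (f.f j).hom (iCycles_cycleMk X j z)) ?_
  rw [hw, iCycles_cycleMk]

theorem isExactAt_of_isZero_homology (X : ModComplex A) (j : ℤ) (h : IsZero (X.homology j)) :
    X.IsExactAt j := fun i hi x hx =>
  have := ModuleCat.subsingleton_of_isZero h
  (homologyClass_eq_zero_iff X i j hi ⟨x, hx⟩).1 (Subsingleton.elim _ _)

theorem quasiIso_iff_isConeExactAt {X Y : ModComplex A} (f : X ⟶ Y) :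
    QuasiIso f ↔ ∀ j, IsConeExactAt f j := by
  have hcyc : ∀ j (x : X.X j), (X.d j (j - 1)).hom x = 0 →
      (Y.d j (j - 1)).hom ((f.f j).hom x) = 0 := fun j x hx => by
    rw [← hom_d_apply, hx, map_zero]
  constructor
  · rintro hf j i rfl x y hx hxy
    have hbij : ∀ j, Function.Bijective (HomologicalComplex.homologyMap f j).hom := fun j =>
      ConcreteCategory.bijective_of_isIso (HomologicalComplex.homologyMap f j)
    obtain ⟨x₀, hx₀⟩ := (homologyClass_eq_zero_iff X (i - 1) (i - 1 - 1) rfl ⟨x, hx⟩).1 (by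
      apply (hbij _).1
      refine (homologyMap_homologyClass f _ _ ⟨_, hcyc _ x hx⟩ rfl).trans ?_
      refine Eq.trans ?_ (map_zero _).symm
      exact (homologyClass_eq_zero_iff Y (i - 1) (i - 1 - 1) rfl _).2 ⟨y, hxy.symm⟩)
    have hx₀ : (X.d (i - 1) (i - 1 - 1)).hom x₀ = x := hx₀
    have hcyc' : (Y.d (i - 1) (i - 1 - 1)).hom (y - (f.f _).hom x₀) = 0 := by
      rw [map_sub, ← hxy, ← hx₀, hom_d_apply, sub_self]
    obtain ⟨c, hc⟩ := (hbij (i - 1)).2 (homologyClass Y (i - 1) ⟨_, hcyc'⟩)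
    obtain ⟨x₁, rfl⟩ := homologyClass_surjective X _ c
    rw [homologyMap_homologyClass f _ _ ⟨_, hcyc _ x₁.1 x₁.2⟩ rfl, eq_comm, ← sub_eq_zero,
      ← map_sub] at hc
    obtain ⟨y', hy'⟩ := (homologyClass_eq_zero_iff Y i (i - 1) rfl _).1 hc
    have hy' : (Y.d i (i - 1)).hom y' = y - (f.f _).hom x₀ - (f.f _).hom x₁.1 := hy'
    refine ⟨x₀ + x₁, y', ?_, ?_⟩
    · rw [map_add, hx₀, LinearMap.mem_ker.1 x₁.2, add_zero]
    · rw [hy', map_add]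
      abel
  · intro h
    rw [quasiIso_iff]
    intro j
    rw [quasiIsoAt_iff_isIso_homologyMap, ConcreteCategory.isIso_iff_bijective]
    constructor
    · change Function.Injective (HomologicalComplex.homologyMap f j).hom
      rw [injective_iff_map_eq_zero]
      intro c hc
      obtain ⟨x, rfl⟩ := homologyClass_surjective X _ c
      obtain ⟨i, rfl⟩ : ∃ i, j = i - 1 := ⟨j + 1, by omega⟩
      rw [homologyMap_homologyClass f _ _ ⟨_, hcyc _ x.1 x.2⟩ rfl,
        homologyClass_eq_zero_iff Y i _ rfl] at hc
      obtain ⟨y, hy⟩ := hc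
      obtain ⟨x', -, hx', -⟩ := h i (i + 1) (by omega) x.1 y x.2 hy.symm
      exact (homologyClass_eq_zero_iff X i _ rfl x).2 ⟨x', hx'⟩
    · intro c
      obtain ⟨y, rfl⟩ := homologyClass_surjective Y _ c
      obtain ⟨x, y', hx, hy⟩ := h j (j + 1) (by omega) 0 y.1 (map_zero _)
        ((map_zero _).trans (LinearMap.mem_ker.1 y.2).symm)
      refine ⟨homologyClass X j ⟨x, hx⟩, ?_⟩
      refine (homologyMap_homologyClass f j _ ⟨_, hcyc _ x hx⟩ rfl).trans ?_
      rw [← sub_eq_zero, ← map_sub]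
      refine (homologyClass_eq_zero_iff Y (j + 1) _ (by omega) _).2 ⟨-y', ?_⟩
      change _ = (f.f j).hom x - y.1
      rw [hy, map_neg]
      abel

theorem IsResolutionAt.of_hasHomologyOnlyAt {k : ℤ} {Z C : ModComplex A} {M : Type u}
    [AddCommGroup M] [Module A M] (hC : HasHomologyOnlyAt C k M) (φ : Z ⟶ C)
    (hφ : ∀ j, IsConeExactAt φ j) (h0 : ∀ j < k, Subsingleton (Z.X j))
    (hproj : ∀ j, Module.Projective A (Z.X j)) : IsResolutionAt k Z M := by
  refine ⟨h0, hproj, ?_, ?_⟩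
  · rintro j hj i rfl x hx
    obtain ⟨y, hy⟩ := hC.exact _ hj.ne' i rfl ((φ.f _).hom x) (by
      rw [← hom_d_apply, hx, map_zero])
    obtain ⟨x', -, hx', -⟩ := hφ i (i + 1) (by omega) x y hx hy.symm
    exact ⟨x', hx'⟩
  · obtain ⟨p, hp, hpk⟩ := hC.cls
    have := h0 (k - 1) (by omega)
    refine ⟨p ∘ₗ LinearMap.codRestrict _ (φ.f k).hom fun x => by
      rw [LinearMap.mem_ker, ← hom_d_apply, Subsingleton.elim ((Z.d k (k - 1)).hom x) 0,
        map_zero], fun m => ?_, ?_⟩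
    · obtain ⟨y, rfl⟩ := hp m
      obtain ⟨x', y', -, hy⟩ := hφ k (k + 1) (by omega) 0 y (map_zero _)
        (by rw [map_zero, LinearMap.mem_ker.1 y.2])
      refine ⟨x', ?_⟩
      rw [LinearMap.comp_apply, ← sub_eq_zero, ← map_sub]
      refine (hpk (k + 1) (by omega) _).2 ⟨-y', ?_⟩
      change _ = (φ.f k).hom x' - y.1
      rw [hy, map_neg]
      abel
    · rintro i rfl x
      rw [LinearMap.comp_apply, hpk i rfl]
      constructor
      · rintro ⟨y, hy⟩
        obtain ⟨x', -, hx', -⟩ := hφ i (i + 1) (by omega) x y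
          (Subsingleton.elim _ _) hy.symm
        exact ⟨x', hx'⟩
      · rintro ⟨y, rfl⟩
        exact ⟨(φ.f i).hom y, (hom_d_apply φ _ _ _).symm⟩

theorem hasHomologyOnlyAt_single (M : ModuleCat.{u} A) :
    HasHomologyOnlyAt ((HomologicalComplex.single (ModuleCat.{u} A) (ComplexShape.down ℤ) 0).obj M)
      0 M := by
  have hzero : ∀ j : ℤ, j ≠ 0 → Subsingleton (((HomologicalComplex.single (ModuleCat.{u} A)
      (ComplexShape.down ℤ) 0).obj M).X j) := fun j hj =>
    ModuleCat.subsingleton_of_isZero (HomologicalComplex.isZero_single_obj_X _ _ _ _ hj)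
  refine ⟨fun j hj i _ x _ => ⟨0, ?_⟩, ?_⟩
  · have := hzero j hj
    exact Subsingleton.elim _ _
  · let e := (HomologicalComplex.singleObjXSelf (ComplexShape.down ℤ) (0 : ℤ) M).toLinearEquiv
    refine ⟨e.toLinearMap ∘ₗ Submodule.subtype _, fun m => ⟨⟨e.symm m, ?_⟩, ?_⟩, ?_⟩
    · have := hzero (0 - 1) (by simp)
      exact Subsingleton.elim _ _
    · exact e.apply_symm_apply m
    · intro i hi z
      have := hzero i (by omega)
      rw [LinearMap.comp_apply]
      refine (LinearEquiv.map_eq_zero_iff e).trans ⟨fun h => ⟨0, ?_⟩, ?_⟩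
      · rw [map_zero]
        exact h.symm
      · rintro ⟨y, hy⟩
        rw [Subsingleton.elim y 0, map_zero] at hy
        exact hy.symm

theorem isProjectiveResolution_iff (P : ModComplex A) (M : ModuleCat.{u} A) :
    P.IsProjectiveResolution M ↔ IsResolutionAt 0 P M := by
  constructor
  · rintro ⟨h0, hproj, ε, hε⟩
    exact IsResolutionAt.of_hasHomologyOnlyAt (hasHomologyOnlyAt_single M) ε
      ((quasiIso_iff_isConeExactAt ε).1 hε) (fun j hj => ModuleCat.subsingleton_of_isZero (h0 j hj))
      (fun j => (IsProjective.iff_projective _).2 (hproj j))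
  · intro h
    obtain ⟨g, hg⟩ := h.exists_hom (hasHomologyOnlyAt_single M)
    exact ⟨isNonneg_of_subsingleton h.subsingleton,
      fun j => (IsProjective.iff_projective _).1 (h.projective j), g, (quasiIso_iff_isConeExactAt g).2 hg⟩

/-- The inclusion of `ℕ` in `ℤ` as an embedding of shapes of chain complexes. -/
def natEmbedding : (ComplexShape.down ℕ).Embedding (ComplexShape.down ℤ) :=
  ComplexShape.Embedding.mk' _ _ (fun n : ℕ => (n : ℤ)) Nat.cast_injective (by
    intro i j
    simp only [ComplexShape.down_Rel]
    omega)

/-- Every module has a projective resolution. -/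
theorem exists_isResolutionAt (M : ModuleCat.{u} A) : ∃ P : ModComplex A, IsResolutionAt 0 P M := by
  let R := projectiveResolution M
  let P : ModComplex A := R.complex.extend natEmbedding
  have hP : ∀ n : ℕ, Nonempty (P.X n ≅ R.complex.X n) := fun n =>
    ⟨R.complex.extendXIso natEmbedding rfl⟩
  have hneg : ∀ j < 0, Subsingleton (P.X j) := fun j hj =>
    ModuleCat.subsingleton_of_isZero (R.complex.isZero_extend_X natEmbedding j fun n hn => by
      have : (n : ℤ) = j := hn
      omega)
  refine ⟨P, hneg, fun j => ?_, fun j hj => ?_, ?_⟩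
  · by_cases hj : j < 0
    · have := hneg j hj
      infer_instance
    · obtain ⟨n, rfl⟩ := Int.eq_ofNat_of_zero_le (not_lt.1 hj)
      rw [IsProjective.iff_projective]
      exact Projective.of_iso (hP n).some.symm (R.projective n)
  · obtain ⟨n, rfl⟩ := Int.eq_ofNat_of_zero_le hj.le
    apply isExactAt_of_isZero_homology
    obtain ⟨n, rfl⟩ : ∃ m, n = m + 1 := ⟨n - 1, by omega⟩
    exact ((R.complex.extend_exactAt_iff natEmbedding (j := n + 1) rfl).2
      (R.complex_exactAt_succ n)).isZero_homology
  · have e0 : R.complex.homology 0 ≅ M :=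
      (asIso (HomologicalComplex.homologyMap R.π 0)) ≪≫
        HomologicalComplex.singleObjHomologySelfIso _ _ _
    have e : P.homology 0 ≅ M :=
      R.complex.extendHomologyIso natEmbedding (j := 0) rfl ≪≫ e0
    have := hneg (0 - 1) (by simp)
    have hcyc : ∀ x, (P.d 0 (0 - 1)).hom (LinearMap.id (R := A) x) = 0 := fun x =>
      Subsingleton.elim _ _
    refine ⟨e.toLinearEquiv.toLinearMap ∘ₗ homologyClass P 0 ∘ₗ
      LinearMap.codRestrict _ LinearMap.id hcyc, ?_, ?_⟩
    · intro m
      obtain ⟨z, hz⟩ := homologyClass_surjective P 0 (e.toLinearEquiv.symm m)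
      refine ⟨z.1, ?_⟩
      exact (congrArg e.toLinearEquiv hz).trans (e.toLinearEquiv.apply_symm_apply m)
    · intro i hi x
      refine (LinearEquiv.map_eq_zero_iff e.toLinearEquiv).trans ?_
      exact homologyClass_eq_zero_iff P i 0 hi _

end ModComplex

end

noncomputable section

/-! ### Modules over group rings: permutation modules and induction -/

section GroupRing

variable {R : Type u} [Ring R] {Γ : Type u} [Group Γ]

/-- An additive map between `RΓ`-modules is linear if it is compatible with the monomials. -/
def AddMonoidHom.toGroupRingLinearMap {M N : Type*} [AddCommGroup M] [Module (MonoidAlgebra R Γ) M]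
    [AddCommGroup N] [Module (MonoidAlgebra R Γ) N] (φ : M →+ N)
    (h : ∀ g r m, φ (MonoidAlgebra.single g r • m) = (MonoidAlgebra.single g r : MonoidAlgebra R Γ) • φ m) :
    M →ₗ[MonoidAlgebra R Γ] N where
  toFun := φ
  map_add' := map_add φ
  map_smul' a m := by
    change φ (a • m) = a • φ m
    induction a using MonoidAlgebra.induction_linear with
    | zero => simp
    | add a b ha hb => rw [add_smul, add_smul, map_add, ha, hb]
    | single g r => exact h g r m

/-- The trivial module as the additive group of the ring. -/
def TrivialModule.toRing : TrivialModule R Γ ≃+ R := AddEquiv.refl _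

theorem TrivialModule.single_smul (g : Γ) (r : R) (x : TrivialModule R Γ) :
    TrivialModule.toRing ((MonoidAlgebra.single g r : MonoidAlgebra R Γ) • x) = r * toRing x := by
  change (MonoidAlgebra.liftNCRingHom (RingHom.id R) (1 : Γ →* R)
    (fun x _ => Commute.one_right x) (MonoidAlgebra.single g r) * toRing x : R) = _
  rw [MonoidAlgebra.liftNCRingHom_single]
  simp

namespace PermutationModule

variable {T : Type u} [MulAction Γ T]

/-- The permutation module as the module of finitely supported functions. -/
def toFinsupp : PermutationModule R T Γ ≃+ (T →₀ R) := AddEquiv.refl _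

theorem toFinsupp_single_smul (g : Γ) (r : R) (x : PermutationModule R T Γ) :
    toFinsupp ((MonoidAlgebra.single g r : MonoidAlgebra R Γ) • x) =
      r • Finsupp.mapDomain (g • ·) (toFinsupp x) := by
  change (MonoidAlgebra.liftNCRingHom (Module.toAddMonoidEnd R (T →₀ R))
    (permAction R Γ T) (permAction_commute R Γ T) (MonoidAlgebra.single g r) : AddMonoid.End _) _ = _
  rw [MonoidAlgebra.liftNCRingHom_single]
  rfl

theorem toFinsupp_single_smul_apply (g : Γ) (r : R) (x : PermutationModule R T Γ) (t : T) :
    toFinsupp ((MonoidAlgebra.single g r : MonoidAlgebra R Γ) • x) t =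
      r * toFinsupp x (g⁻¹ • t) := by
  rw [toFinsupp_single_smul, Finsupp.smul_apply, smul_eq_mul]
  congr 1
  conv_lhs => rw [← smul_inv_smul g t]
  exact Finsupp.mapDomain_apply (MulAction.injective g) _ _

/-- An additive map between permutation modules is linear if it is compatible with the scalars and
the group action. -/
def mkLinear {T' : Type u} [MulAction Γ T'] (φ : (T →₀ R) →ₗ[R] (T' →₀ R))
    (h : ∀ (g : Γ) t, φ (Finsupp.single (g • t) 1) =
      Finsupp.mapDomain (g • ·) (φ (Finsupp.single t 1))) :
    PermutationModule R T Γ →ₗ[MonoidAlgebra R Γ] PermutationModule R T' Γ :=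
  AddMonoidHom.toGroupRingLinearMap
    (toFinsupp.symm.toAddMonoidHom.comp (φ.toAddMonoidHom.comp toFinsupp.toAddMonoidHom))
    fun g r m => by
      apply toFinsupp.injective
      rw [toFinsupp_single_smul]
      change φ (toFinsupp (_ • m)) = r • Finsupp.mapDomain _ (φ (toFinsupp m))
      rw [toFinsupp_single_smul, map_smul]
      congr 1
      have : φ ∘ₗ Finsupp.lmapDomain R R (g • ·) = Finsupp.lmapDomain R R (g • ·) ∘ₗ φ :=
        Finsupp.lhom_ext' fun t => LinearMap.ext_ring (by simpa using h g t)
      exact LinearMap.congr_fun this _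

/-- Isomorphic `Γ`-sets have isomorphic permutation modules. -/
def congr {T' : Type u} [MulAction Γ T'] (e : T ≃ T') (he : ∀ (g : Γ) t, e (g • t) = g • e t) :
    PermutationModule R T Γ ≃ₗ[MonoidAlgebra R Γ] PermutationModule R T' Γ :=
  LinearEquiv.ofBijective (mkLinear (Finsupp.domLCongr e : (T →₀ R) ≃ₗ[R] (T' →₀ R)).toLinearMap fun g t => by simp [he])
    (Finsupp.domLCongr e : (T →₀ R) ≃ₗ[R] (T' →₀ R)).bijective

end PermutationModule

namespace Induction

section

variable {A S : Type u} [Ring A] [Ring S] (f : A →+* S) {M : Type u} [AddCommGroup M] [Module A M]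
  {L : Type u} [AddCommGroup L] [Module S L]

/-- The `S`-linear map `S ⊗_A M → L` extending a map `φ : M → L` that is linear along `f`. -/
def lift (φ : M →+ L) (hφ : ∀ a m, φ (a • m) = f a • φ m) : Obj f M →ₗ[S] L :=
  Submodule.liftQ _ (TensorProduct.AlgebraTensorModule.lift
    { toFun := fun s => (s • φ : M →+ L).toIntLinearMap
      map_add' := fun s t => by ext; simp [add_smul]
      map_smul' := fun s t => by ext; simp [mul_smul] }) <| by
    refine Submodule.span_le.2 ?_
    rintro _ ⟨s, a, m, rfl⟩
    simp [hφ, mul_smul]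

/-- The unit `m ↦ 1 ⊗ m`. -/
def unit (M : Type u) [AddCommGroup M] [Module A M] : M →+ Obj f M where
  toFun m := Submodule.Quotient.mk (1 ⊗ₜ[ℤ] m)
  map_zero' := by rw [TensorProduct.tmul_zero]; rfl
  map_add' m m' := by rw [TensorProduct.tmul_add]; rfl

theorem mk_eq_smul_unit (s : S) (m : M) :
    (Submodule.Quotient.mk (s ⊗ₜ[ℤ] m) : Obj f M) = s • unit f M m := by
  change _ = Submodule.Quotient.mk (s • (1 ⊗ₜ[ℤ] m))
  rw [TensorProduct.smul_tmul', smul_eq_mul, mul_one]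

theorem unit_smul (a : A) (m : M) : unit f M (a • m) = f a • unit f M m := by
  rw [← mk_eq_smul_unit]
  refine ((Submodule.Quotient.eq _).2 (Submodule.subset_span
    (show ∃ _ _ _, _ from ⟨1, a, m, by rw [one_mul]⟩))).symm

theorem lift_unit (φ : M →+ L) (hφ) (m : M) : lift f φ hφ (unit f M m) = φ m :=
  one_smul S (φ m)

theorem hom_ext_unit {φ ψ : Obj f M →ₗ[S] L} (h : ∀ m, φ (unit f M m) = ψ (unit f M m)) : φ = ψ :=
  hom_ext f fun s m => by rw [mk_eq_smul_unit, map_smul, map_smul, h]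

theorem map_unit {N : Type u} [AddCommGroup N] [Module A N] (φ : M →ₗ[A] N) (m : M) :
    map f φ (unit f M m) = unit f N (φ m) := rfl

instance projective [Module.Projective A M] : Module.Projective S (Obj f M) := by
  refine Module.Projective.of_lifting_property'' fun p hp => ?_
  let _ : Module A (Obj f M) := Module.compHom _ f
  let _ : Module A (Obj f M →₀ S) := Module.compHom _ f
  obtain ⟨u, hu⟩ := Module.projective_lifting_property (R := A)
    ({ p.toAddMonoidHom with map_smul' := fun a x => p.map_smul (f a) x } :
      (Obj f M →₀ S) →ₗ[A] Obj f M)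
    ({ unit f M with map_smul' := fun a x => unit_smul f a x } : M →ₗ[A] Obj f M) hp
  refine ⟨lift f u.toAddMonoidHom fun a m => u.map_smul a m, hom_ext_unit f fun m => ?_⟩
  exact (congrArg p (lift_unit f _ _ m)).trans (LinearMap.congr_fun hu m)

end

variable (Δ : Subgroup Γ) (M : Type u) [AddCommGroup M] [Module (MonoidAlgebra R Δ) M]

/-- The inclusion `RΔ → RΓ`. -/
abbrev incl (R : Type u) [Ring R] (Δ : Subgroup Γ) : MonoidAlgebra R Δ →+* MonoidAlgebra R Γ :=
  MonoidAlgebra.mapDomainRingHom R Δ.subtype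

/-- The sum of the translates of `M` in `RΓ ⊗_{RΔ} M` by the chosen coset representatives. -/
def cosetSum : (Γ ⧸ Δ →₀ M) →+ Obj (incl R Δ) M :=
  Finsupp.liftAddHom fun c => (DistribSMul.toAddMonoidHom _
    (MonoidAlgebra.single c.out 1 : MonoidAlgebra R Γ)).comp (unit (incl R Δ) M)

theorem cosetSum_single (c : Γ ⧸ Δ) (m : M) : cosetSum (R := R) Δ M (Finsupp.single c m) =
    (MonoidAlgebra.single c.out 1 : MonoidAlgebra R Γ) • unit (incl R Δ) M m := by
  simp [cosetSum]

theorem out_inv_mul_mem (g : Γ) : (g : Γ ⧸ Δ).out⁻¹ * g ∈ Δ :=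
  QuotientGroup.eq.1 (QuotientGroup.out_eq' _)

/-- The decomposition of `RΓ ⊗_ℤ M` along the cosets of `Δ`. -/
def cosetCoeffTensor : MonoidAlgebra R Γ ⊗[ℤ] M →+ (Γ ⧸ Δ →₀ M) :=
  TensorProduct.liftAddHom
    ((Finsupp.liftAddHom fun g : Γ => AddMonoidHom.mk' (fun r : R =>
      (Finsupp.singleAddHom (g : Γ ⧸ Δ)).comp (DistribSMul.toAddMonoidHom M
        (MonoidAlgebra.single ⟨_, out_inv_mul_mem Δ g⟩ r : MonoidAlgebra R Δ)))
      fun a b => by ext1 m; simp [add_smul]).comp MonoidAlgebra.coeffAddEquiv.toAddMonoidHom)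
    fun k s m => by rw [map_zsmul, map_zsmul]; rfl

theorem cosetCoeffTensor_single (g : Γ) (r : R) (m : M) :
    cosetCoeffTensor Δ M ((MonoidAlgebra.single g r : MonoidAlgebra R Γ) ⊗ₜ[ℤ] m) =
      Finsupp.single (g : Γ ⧸ Δ)
        ((MonoidAlgebra.single ⟨_, out_inv_mul_mem Δ g⟩ r : MonoidAlgebra R Δ) • m) := by
  refine (congrArg (fun φ : M →+ _ => φ m) (Finsupp.liftAddHom_apply_single _ g r)).trans ?_
  rfl

theorem cosetCoeffTensor_balanced (s : MonoidAlgebra R Γ) (a : MonoidAlgebra R Δ) (m : M) :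
    cosetCoeffTensor Δ M ((s * incl R Δ a) ⊗ₜ[ℤ] m) = cosetCoeffTensor Δ M (s ⊗ₜ[ℤ] (a • m)) := by
  induction s using MonoidAlgebra.induction_linear with
  | zero => simp
  | add s t hs ht => simp only [add_mul, TensorProduct.add_tmul, map_add, hs, ht]
  | single g r =>
    induction a using MonoidAlgebra.induction_linear with
    | zero => simp
    | add a b ha hb =>
      simp only [map_add, mul_add, TensorProduct.add_tmul, add_smul, TensorProduct.tmul_add, ha, hb]
    | single h q =>
      have hgh : ((g * h : Γ) : Γ ⧸ Δ) = g := by simp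
      have : incl R Δ (MonoidAlgebra.single h q) = MonoidAlgebra.single (h : Γ) q :=
        MonoidAlgebra.mapDomain_single
      rw [this, MonoidAlgebra.single_mul_single, cosetCoeffTensor_single, cosetCoeffTensor_single,
        ← mul_smul, MonoidAlgebra.single_mul_single,
        show (⟨_, out_inv_mul_mem Δ (g * h)⟩ : Δ) = ⟨_, out_inv_mul_mem Δ g⟩ * h from
          Subtype.ext (by simp [mul_assoc]), hgh]

/-- The decomposition of `RΓ ⊗_{RΔ} M` along the cosets of `Δ`. -/
def cosetCoeff : Obj (incl R Δ) M →+ (Γ ⧸ Δ →₀ M) :=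
  QuotientAddGroup.lift (relations (incl R Δ) M).toAddSubgroup (cosetCoeffTensor Δ M) <| by
    intro x hx
    have : ∀ s : MonoidAlgebra R Γ, cosetCoeffTensor Δ M (s • x) = 0 := by
      induction hx using Submodule.span_induction with
      | mem x hx =>
        obtain ⟨s, a, m, rfl⟩ := hx
        intro t
        rw [smul_sub, map_sub, TensorProduct.smul_tmul', TensorProduct.smul_tmul', smul_eq_mul,
          smul_eq_mul, ← mul_assoc, cosetCoeffTensor_balanced, sub_self]
      | zero => simp
      | add x y _ _ hx hy => intro s; rw [smul_add, map_add, hx, hy, add_zero]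
      | smul a x _ hx => intro s; rw [← mul_smul, hx]
    simpa using this 1

theorem cosetCoeff_unit (g : Γ) (r : R) (m : M) :
    cosetCoeff Δ M ((MonoidAlgebra.single g r : MonoidAlgebra R Γ) • unit (incl R Δ) M m) =
      Finsupp.single (g : Γ ⧸ Δ)
        ((MonoidAlgebra.single ⟨_, out_inv_mul_mem Δ g⟩ r : MonoidAlgebra R Δ) • m) := by
  rw [← mk_eq_smul_unit]
  exact cosetCoeffTensor_single Δ M g r m

theorem cosetCoeff_cosetSum (x : Γ ⧸ Δ →₀ M) : cosetCoeff Δ M (cosetSum (R := R) Δ M x) = x := by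
  refine DFunLike.congr_fun (f := (cosetCoeff Δ M).comp (cosetSum (R := R) Δ M))
    (g := AddMonoidHom.id _) (Finsupp.addHom_ext fun c m => ?_) x
  rw [AddMonoidHom.comp_apply, cosetSum_single, cosetCoeff_unit]
  have hc : ((c.out : Γ) : Γ ⧸ Δ) = c := QuotientGroup.out_eq' c
  have : (⟨_, out_inv_mul_mem Δ c.out⟩ : Δ) = 1 := by
    ext
    simp [hc]
  rw [this, hc, ← MonoidAlgebra.one_def, one_smul]
  rfl

theorem cosetSum_surjective : Function.Surjective (cosetSum (R := R) Δ M) := by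
  intro x
  obtain ⟨t, rfl⟩ := Submodule.Quotient.mk_surjective _ x
  induction t with
  | zero => exact ⟨0, map_zero _⟩
  | add a b ha hb =>
    obtain ⟨u, hu⟩ := ha
    obtain ⟨v, hv⟩ := hb
    exact ⟨u + v, by rw [map_add, hu, hv, Submodule.Quotient.mk_add]⟩
  | tmul s m =>
    rw [mk_eq_smul_unit]
    induction s using MonoidAlgebra.induction_linear with
    | zero => exact ⟨0, by simp⟩
    | add a b ha hb =>
      obtain ⟨u, hu⟩ := ha
      obtain ⟨v, hv⟩ := hb
      exact ⟨u + v, by rw [map_add, hu, hv, add_smul]⟩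
    | single g r =>
      refine ⟨Finsupp.single (g : Γ ⧸ Δ) ((MonoidAlgebra.single ⟨_, out_inv_mul_mem Δ g⟩ r :
        MonoidAlgebra R Δ) • m), ?_⟩
      have : incl R Δ (MonoidAlgebra.single ⟨_, out_inv_mul_mem Δ g⟩ r) =
          MonoidAlgebra.single ((g : Γ ⧸ Δ).out⁻¹ * g) r := MonoidAlgebra.mapDomain_single
      rw [cosetSum_single, unit_smul, this, ← mul_smul, MonoidAlgebra.single_mul_single,
        one_mul, mul_inv_cancel_left]

variable {M} in
theorem map_cosetSum {N : Type u} [AddCommGroup N] [Module (MonoidAlgebra R Δ) N]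
    (φ : M →ₗ[MonoidAlgebra R Δ] N) (x : Γ ⧸ Δ →₀ M) :
    map (incl R Δ) φ (cosetSum Δ M x) =
      cosetSum Δ N (Finsupp.mapRange.addMonoidHom φ.toAddMonoidHom x) := by
  refine DFunLike.congr_fun (f := (map (incl R Δ) φ).toAddMonoidHom.comp (cosetSum Δ M))
    (g := (cosetSum Δ N).comp (Finsupp.mapRange.addMonoidHom φ.toAddMonoidHom))
    (Finsupp.addHom_ext fun c m => ?_) x
  change map (incl R Δ) φ (cosetSum Δ M (Finsupp.single c m)) =
    cosetSum Δ N (Finsupp.mapRange φ (map_zero φ) (Finsupp.single c m))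
  rw [Finsupp.mapRange_single, cosetSum_single, cosetSum_single, map_smul, map_unit]

theorem subsingleton [Subsingleton M] : Subsingleton (Obj (incl R Δ) M) :=
  (cosetSum_surjective (R := R) Δ M).subsingleton

variable {M} in
theorem exists_map_eq_cosetSum {N : Type u} [AddCommGroup N] [Module (MonoidAlgebra R Δ) N]
    (φ : M →ₗ[MonoidAlgebra R Δ] N) (x : Γ ⧸ Δ →₀ N) (h : ∀ c, ∃ y, φ y = x c) :
    ∃ y, map (incl R Δ) φ y = cosetSum Δ N x := by
  classical
  choose u hu using h
  refine ⟨cosetSum Δ M (Finsupp.onFinset x.support (fun c => if x c = 0 then 0 else u c)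
    fun c hc => by simp_all), ?_⟩
  rw [map_cosetSum]
  refine congrArg _ (Finsupp.ext fun c => ?_)
  by_cases hc : x c = 0
  · simp [hc]
  · simpa [hc] using hu c

variable {M} in
/-- Induction from a subgroup is exact. -/
theorem map_exact {N K : Type u} [AddCommGroup N] [Module (MonoidAlgebra R Δ) N]
    [AddCommGroup K] [Module (MonoidAlgebra R Δ) K]
    (φ : M →ₗ[MonoidAlgebra R Δ] N) (ψ : N →ₗ[MonoidAlgebra R Δ] K)
    (h : ∀ x, ψ x = 0 → ∃ y, φ y = x) (x : Obj (incl R Δ) N) (hx : map (incl R Δ) ψ x = 0) :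
    ∃ y, map (incl R Δ) φ y = x := by
  obtain ⟨x, rfl⟩ := cosetSum_surjective Δ N x
  rw [map_cosetSum] at hx
  have hx := (cosetCoeff_cosetSum (R := R) Δ K _).symm.trans
    ((congrArg (cosetCoeff Δ K) hx).trans (map_zero _))
  exact exists_map_eq_cosetSum Δ φ x fun c => h _ (DFunLike.congr_fun hx c)

/-- The map `RΓ ⊗_{RΔ} M → R[Γ/Δ]` induced by a map from `M` to the trivial module. -/
def toPermutation (ε : M →ₗ[MonoidAlgebra R Δ] TrivialModule R Δ) :
    Obj (incl R Δ) M →ₗ[MonoidAlgebra R Γ] PermutationModule R (Γ ⧸ Δ) Γ :=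
  lift (incl R Δ) (PermutationModule.toFinsupp.symm.toAddMonoidHom.comp
    ((Finsupp.singleAddHom ((1 : Γ) : Γ ⧸ Δ)).comp
      (TrivialModule.toRing.toAddMonoidHom.comp ε.toAddMonoidHom))) fun a m => by
    induction a using MonoidAlgebra.induction_linear with
    | zero => simp
    | add a b ha hb => rw [add_smul, map_add, map_add, add_smul, ha, hb]
    | single h r =>
      apply PermutationModule.toFinsupp.injective
      have : incl R Δ (MonoidAlgebra.single h r) = MonoidAlgebra.single (h : Γ) r :=
        MonoidAlgebra.mapDomain_single
      rw [this, PermutationModule.toFinsupp_single_smul]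
      change Finsupp.single _ (TrivialModule.toRing (ε (_ • m))) =
        r • Finsupp.mapDomain _ (Finsupp.single _ (TrivialModule.toRing (ε m)))
      rw [map_smul, TrivialModule.single_smul, Finsupp.mapDomain_single, Finsupp.smul_single,
        smul_eq_mul]
      congr 1
      exact (QuotientGroup.eq.2 (by simp) : ((1 : Γ) : Γ ⧸ Δ) = ((h * 1 : Γ) : Γ ⧸ Δ))

variable {M} in
theorem toPermutation_cosetSum (ε : M →ₗ[MonoidAlgebra R Δ] TrivialModule R Δ)
    (x : Γ ⧸ Δ →₀ M) : PermutationModule.toFinsupp (toPermutation Δ M ε (cosetSum Δ M x)) =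
      Finsupp.mapRange.addMonoidHom (TrivialModule.toRing.toAddMonoidHom.comp ε.toAddMonoidHom)
        x := by
  refine DFunLike.congr_fun (f := PermutationModule.toFinsupp.toAddMonoidHom.comp
    ((toPermutation Δ M ε).toAddMonoidHom.comp (cosetSum Δ M))) (Finsupp.addHom_ext fun c m => ?_) x
  change PermutationModule.toFinsupp (toPermutation Δ M ε (cosetSum Δ M (Finsupp.single c m))) =
    Finsupp.mapRange (TrivialModule.toRing.toAddMonoidHom.comp ε.toAddMonoidHom) (map_zero _)
      (Finsupp.single c m)
  rw [Finsupp.mapRange_single, cosetSum_single, map_smul, PermutationModule.toFinsupp_single_smul,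
    toPermutation, lift_unit, one_smul]
  change Finsupp.mapDomain _ (Finsupp.single _ _) = _
  rw [Finsupp.mapDomain_single]
  congr 1
  refine Eq.trans ?_ (QuotientGroup.out_eq' c)
  exact congrArg _ (mul_one c.out)

open ModComplex in
/-- Induction turns resolutions of the trivial module into resolutions of permutation modules. -/
theorem isResolutionAt_indComplex {P : ModComplex (MonoidAlgebra R Δ)}
    (hP : IsResolutionAt 0 P (TrivialModule R Δ)) :
    IsResolutionAt 0 (indComplex R Δ P) (PermutationModule R (Γ ⧸ Δ) Γ) where
  subsingleton j hj := by
    have := hP.subsingleton j hj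
    exact subsingleton Δ (P.X j)
  projective j := by
    have := hP.projective j
    exact projective (incl R Δ) (M := P.X j)
  exact j hj i hi := map_exact Δ (P.d i j).hom (P.d j (j - 1)).hom (hP.exact j hj i hi)
  aug := by
    obtain ⟨ε, hε, hεk⟩ := hP.aug
    refine ⟨toPermutation Δ (P.X 0) ε, fun y => ?_, fun i hi x => ⟨fun hx => ?_, ?_⟩⟩
    · obtain ⟨x, hx⟩ := Finsupp.mapRange_surjective
        (TrivialModule.toRing.toAddMonoidHom.comp ε.toAddMonoidHom) (map_zero _)
        (TrivialModule.toRing.surjective.comp hε) (PermutationModule.toFinsupp y)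
      exact ⟨cosetSum Δ (P.X 0) x, PermutationModule.toFinsupp.injective
        ((toPermutation_cosetSum Δ ε x).trans hx)⟩
    · obtain ⟨x, rfl⟩ := cosetSum_surjective Δ (P.X 0) x
      have hx := (toPermutation_cosetSum Δ ε x).symm.trans
        ((congrArg PermutationModule.toFinsupp hx).trans (map_zero _))
      exact exists_map_eq_cosetSum Δ (P.d i 0).hom x fun c =>
        (hεk i hi _).1 (TrivialModule.toRing.injective (DFunLike.congr_fun hx c))
    · rintro ⟨y, rfl⟩
      have : toPermutation Δ (P.X 0) ε ∘ₗ map (incl R Δ) (P.d i 0).hom = 0 :=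
        hom_ext_unit _ fun m => ?_
      · exact LinearMap.congr_fun this y
      · rw [LinearMap.comp_apply, map_unit, toPermutation, lift_unit]
        change PermutationModule.toFinsupp.symm (Finsupp.single _ (TrivialModule.toRing
          (ε ((P.d i 0).hom m)))) = _
        rw [(hεk i hi _).2 ⟨m, rfl⟩]
        simp

end Induction

end GroupRing
end

noncomputable section

/-! ### The bootstrapping theorem for filtered complexes and the algebraic form -/

open ModComplex

theorem ModComplex.IsResolutionAt.of_linearEquiv {A : Type u} [Ring A] {k : ℤ} {P : ModComplex A}
    {M N : Type u} [AddCommGroup M] [Module A M] [AddCommGroup N] [Module A N]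
    (hP : IsResolutionAt k P M) (e : M ≃ₗ[A] N) : IsResolutionAt k P N where
  __ := hP
  aug := by
    obtain ⟨ε, hε, hεk⟩ := hP.aug
    refine ⟨e.toLinearMap ∘ₗ ε, e.surjective.comp hε, fun i hi x => ?_⟩
    rw [← hεk i hi]
    exact e.map_eq_zero_iff

theorem IsBootstrappable.exists_isResolutionAt_pi {A : Type u} [Ring A]
    {B : ℤ → ModComplex A → Prop} (hB : IsBootstrappable A B) (k : ℕ) {m : ℕ}
    (M : Fin (m + 1) → Type u) [∀ i, AddCommGroup (M i)] [∀ i, Module A (M i)]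
    (h : ∀ i, ∃ Q, IsResolutionAt 0 Q (M i) ∧ B k Q) :
    ∃ Q, IsResolutionAt 0 Q (∀ i, M i) ∧ B k Q := by
  induction m with
  | zero =>
    obtain ⟨Q, hQ, hBQ⟩ := h 0
    refine ⟨Q, hQ.of_linearEquiv ?_, hBQ⟩
    exact
      { toFun x := fun i => Fin.cases x (fun i => i.elim0) i
        invFun x := x 0
        map_add' x y := by ext i; refine Fin.cases ?_ (fun i => i.elim0) i; rfl
        map_smul' a x := by ext i; refine Fin.cases ?_ (fun i => i.elim0) i; rfl
        left_inv x := rfl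
        right_inv x := by ext i; refine Fin.cases ?_ (fun i => i.elim0) i; rfl }
  | succ m ih =>
    obtain ⟨Q, hQ, hBQ⟩ := hB.exists_isResolutionAt_prod k (h 0)
      (ih (fun i => M i.succ) fun i => h i.succ)
    refine ⟨Q, hQ.of_linearEquiv ?_, hBQ⟩
    exact
      { toFun x := fun i => Fin.cases x.1 x.2 i
        invFun x := (x 0, fun i => x i.succ)
        map_add' x y := by ext i; refine Fin.cases ?_ (fun i => ?_) i <;> rfl
        map_smul' a x := by ext i; refine Fin.cases ?_ (fun i => ?_) i <;> rfl
        left_inv x := rfl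
        right_inv x := by ext i; refine Fin.cases ?_ (fun i => ?_) i <;> rfl }

variable {R : Type u} [Ring R] {C : GroupClass.{u}} {B : EquivariantFamily R}

theorem exists_isResolutionAt_permutationModule (hB : IsEquivariantlyBootstrappable R C B)
    {Γ : Type u} [Group Γ] (hΓ : C Γ) {k : ℤ} {Δ : Subgroup Γ} (h : associatedClass R C B k Δ) :
    ∃ Q, IsResolutionAt 0 Q (PermutationModule R (Γ ⧸ Δ) Γ) ∧ B Γ k Q := by
  obtain ⟨-, P, hP, hBP⟩ := h
  exact ⟨_, Induction.isResolutionAt_indComplex Δ ((isProjectiveResolution_iff _ _).1 hP),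
    hB.induction k Γ Δ P hΓ hBP⟩

/-- If a complex of `RΓ`-modules is `n`-connected over `R` and admits a filtration whose graded
pieces have homology in one degree only, and this homology is a finite sum of permutation modules
with suitable stabilisers, then `Γ` has the given bootstrappable property. -/
theorem associatedClass_of_filtration (hB : IsEquivariantlyBootstrappable R C B)
    {Γ : Type u} [Group Γ] (hΓ : C Γ) (n : ℕ) (F : ℕ → ModComplex (MonoidAlgebra R Γ))
    (ι : ∀ k, F k ⟶ F (k + 1)) (M : ℕ → Type u) [∀ k, AddCommGroup (M k)]
    [∀ k, Module (MonoidAlgebra R Γ) (M k)] (hnt : Nontrivial (M 0))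
    (h0 : HasHomologyOnlyAt (F 0) 0 (M 0))
    (hι : ∀ k < n, HasRelHomologyOnlyAt (ι k) (k + 1 : ℕ) (M (k + 1)))
    (hM : ∀ k : ℕ, k ≤ n → ∃ (m : ℕ) (H : Fin m → Subgroup Γ),
      (∀ i, associatedClass R C B (n - k : ℤ) (H i)) ∧
      Nonempty (M k ≃ₗ[MonoidAlgebra R Γ] ∀ i, PermutationModule R (Γ ⧸ H i) Γ))
    {η : (F n).X 0 →ₗ[MonoidAlgebra R Γ] TrivialModule R Γ} (hη : IsAugmentation n (F n) η) :
    associatedClass R C B n Γ := by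
  have hbΓ := hB.bootstrappable Γ hΓ
  have key : ∀ k ≤ n, Subsingleton (M k) ∨
      ∃ Q, IsResolutionAt 0 Q (M k) ∧ B Γ (n - k : ℕ) Q := by
    intro k hk
    obtain ⟨m, H, hH, ⟨e⟩⟩ := hM k hk
    rcases m with - | m
    · exact Or.inl e.toEquiv.subsingleton
    · obtain ⟨Q, hQ, hBQ⟩ := hbΓ.exists_isResolutionAt_pi (n - k)
        (fun i => PermutationModule R (Γ ⧸ H i) Γ) fun i =>
          exists_isResolutionAt_permutationModule hB hΓ (by simpa [hk] using hH i)
      exact Or.inr ⟨Q, hQ.of_linearEquiv e.symm, hBQ⟩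
  obtain ⟨P, hP⟩ := exists_isResolutionAt
    (ModuleCat.of (MonoidAlgebra R Γ) (TrivialModule R Γ))
  obtain ⟨Q, hQ, hBQ⟩ := hbΓ.exists_isResolutionAt_of_filtration n F ι M h0 hι
    ((key 0 (Nat.zero_le n)).resolve_left (not_subsingleton_iff_nontrivial.2 hnt))
    (fun k hk => key (k + 1) hk) hP hη
  exact ⟨hΓ, Q, (isProjectiveResolution_iff _ _).2 hQ, hBQ⟩

namespace ModComplex

variable {A : Type u} [Ring A]

/-- The submodules defining the truncation of a complex to degrees `≤ k`. -/
def degreeLE (X : ModComplex A) (k : ℕ) (j : ℤ) : Submodule A (X.X j) := if j ≤ k then ⊤ else ⊥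

theorem degreeLE_of_le (X : ModComplex A) {k : ℕ} {j : ℤ} (h : j ≤ k) : X.degreeLE k j = ⊤ :=
  if_pos h

theorem degreeLE_of_lt (X : ModComplex A) {k : ℕ} {j : ℤ} (h : k < j) : X.degreeLE k j = ⊥ :=
  if_neg (not_le.2 h)

section

variable (X : ModComplex A) (S S' : ∀ j, Submodule A (X.X j))
    (hS : ∀ i j, ∀ x ∈ S i, (X.d i j).hom x ∈ S j)
    (hS' : ∀ i j, ∀ x ∈ S' i, (X.d i j).hom x ∈ S' j)

/-- The inclusion between nested subcomplexes. -/
def subInclusion (h : ∀ j, S j ≤ S' j) : subComplex X S hS ⟶ subComplex X S' hS' :=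
  homMk (fun j => (subEquiv X S' hS' j).symm.toLinearMap ∘ₗ Submodule.inclusion (h j) ∘ₗ
    (subEquiv X S hS j).toLinearMap) fun _ _ => rfl

theorem subInclusion_f (h : ∀ j, S j ≤ S' j) (j : ℤ) (x : (subComplex X S hS).X j) :
    (subEquiv X S' hS' j (((subInclusion X S S' hS hS' h).f j).hom x) : X.X j) =
      subEquiv X S hS j x := rfl

theorem hasHomologyOnlyAt_subComplex {k : ℤ} {M : Type u} [AddCommGroup M] [Module A M]
    (hexact : ∀ j, j ≠ k → ∀ i, i - 1 = j → ∀ x ∈ S j, (X.d j (j - 1)).hom x = 0 →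
      ∃ y ∈ S i, (X.d i j).hom y = x)
    (p : (S k ⊓ LinearMap.ker (X.d k (k - 1)).hom : Submodule A (X.X k)) →ₗ[A] M)
    (hp : Function.Surjective p)
    (hpk : ∀ i, i - 1 = k → ∀ z, p z = 0 ↔ ∃ y ∈ S i, (X.d i k).hom y = z) :
    HasHomologyOnlyAt (subComplex X S hS) k M where
  exact j hj i hi x hx := by
    obtain ⟨y, hy, h⟩ := hexact j hj i hi (subEquiv X S hS j x) (subEquiv X S hS j x).2
      (congrArg Subtype.val hx)
    exact ⟨(subEquiv X S hS i).symm ⟨y, hy⟩, Subtype.ext h⟩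
  cls := by
    refine ⟨p ∘ₗ LinearMap.codRestrict _ ((S k).subtype ∘ₗ (subEquiv X S hS k).toLinearMap ∘ₗ
      Submodule.subtype _) fun z => ⟨(subEquiv X S hS k z).2, congrArg Subtype.val z.2⟩,
      fun m => ?_, fun i hi z => (hpk i hi _).trans ⟨?_, ?_⟩⟩
    · obtain ⟨z, rfl⟩ := hp m
      exact ⟨⟨(subEquiv X S hS k).symm ⟨z, z.2.1⟩, Subtype.ext z.2.2⟩, rfl⟩
    · rintro ⟨y, hy, h⟩
      exact ⟨(subEquiv X S hS i).symm ⟨y, hy⟩, Subtype.ext h⟩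
    · rintro ⟨y, h⟩
      exact ⟨_, (subEquiv X S hS i y).2, congrArg Subtype.val h⟩

theorem hasRelHomologyOnlyAt_subInclusion (h : ∀ j, S j ≤ S' j) {k : ℤ} {M : Type u}
    [AddCommGroup M] [Module A M]
    (hexact : ∀ j, j ≠ k → ∀ i, i - 1 = j → ∀ y ∈ S' j, (X.d j (j - 1)).hom y ∈ S (j - 1) →
      ∃ x' ∈ S j, ∃ y' ∈ S' i, y = x' + (X.d i j).hom y')
    (p : (S' k ⊓ (S (k - 1)).comap (X.d k (k - 1)).hom : Submodule A (X.X k)) →ₗ[A] M)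
    (hp : Function.Surjective p)
    (hpk : ∀ i, i - 1 = k → ∀ y, p y = 0 ↔
      ∃ x' ∈ S k, ∃ y' ∈ S' i, (y : X.X k) = x' + (X.d i k).hom y') :
    HasRelHomologyOnlyAt (subInclusion X S S' hS hS' h) k M where
  inj j := Submodule.inclusion_injective (h j)
  exact j hj i hi y x hxy := by
    obtain ⟨x', hx', y', hy', e⟩ := hexact j hj i hi (subEquiv X S' hS' j y)
      (subEquiv X S' hS' j y).2
      (by rw [← subEquiv_d, ← hxy, subInclusion_f]; exact (subEquiv X S hS (j - 1) x).2)
    exact ⟨(subEquiv X S hS j).symm ⟨x', hx'⟩, (subEquiv X S' hS' i).symm ⟨y', hy'⟩,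
      Subtype.ext e⟩
  cls := by
    refine ⟨p ∘ₗ LinearMap.codRestrict _ ((S' k).subtype ∘ₗ (subEquiv X S' hS' k).toLinearMap ∘ₗ
      Submodule.subtype _) fun z => ⟨(subEquiv X S' hS' k z).2, ?_⟩,
      fun m => ?_, fun i hi z => (hpk i hi _).trans ⟨?_, ?_⟩⟩
    · obtain ⟨x, hx⟩ := z.2
      have e : (subEquiv X S hS (k - 1) x : X.X (k - 1)) = (X.d k (k - 1)).hom _ :=
        congrArg (fun y => (subEquiv X S' hS' (k - 1) y : X.X (k - 1))) hx
      change (X.d k (k - 1)).hom _ ∈ S (k - 1)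
      exact Set.mem_of_eq_of_mem e.symm (subEquiv X S hS (k - 1) x).2
    · obtain ⟨z, rfl⟩ := hp m
      exact ⟨⟨(subEquiv X S' hS' k).symm ⟨z, z.2.1⟩,
        (subEquiv X S hS (k - 1)).symm ⟨_, z.2.2⟩, Subtype.ext rfl⟩, rfl⟩
    · rintro ⟨x', hx', y', hy', e⟩
      exact ⟨(subEquiv X S hS k).symm ⟨x', hx'⟩, (subEquiv X S' hS' i).symm ⟨y', hy'⟩,
        Subtype.ext e⟩
    · rintro ⟨x', y', e⟩
      exact ⟨_, (subEquiv X S hS k x').2, _, (subEquiv X S' hS' i y').2, congrArg Subtype.val e⟩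

end

/-- A nonnegative complex whose homology below degree `n` is `L`, concentrated in degree `0`, is
an `n`-connected complex over `L` once the same is true of its truncation to degrees `≤ n`. -/
theorem exists_isAugmentation_of_homology (X : ModComplex A) (hX : X.IsNonneg) (n : ℕ) {L : Type u}
    [AddCommGroup L] [Module A L] (e : X.homology 0 ≅ ModuleCat.of A L)
    (h : ∀ j : ℤ, j ≤ n - 1 → j ≠ 0 → IsZero (X.homology j)) :
    ∃ η : X.X 0 →ₗ[A] L, IsAugmentation n X η := by
  have hs : ∀ j < 0, Subsingleton (X.X j) := fun j hj => ModuleCat.subsingleton_of_isZero (hX j hj)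
  have h0 : ∀ x : X.X 0, (X.d 0 (0 - 1)).hom x = 0 := fun x =>
    have := hs (0 - 1) (by simp)
    Subsingleton.elim _ _
  have he : ∀ x, e.toLinearEquiv (homologyClass X 0 ⟨x, h0 x⟩) = 0 ↔
      homologyClass X 0 ⟨x, h0 x⟩ = 0 := fun x => e.toLinearEquiv.map_eq_zero_iff
  refine ⟨e.toLinearEquiv.toLinearMap ∘ₗ homologyClass X 0 ∘ₗ LinearMap.codRestrict _
    LinearMap.id h0, hs, fun l => ?_, fun i hi x => ?_, fun _ i hi x hx => ?_, fun j hj hjn => ?_⟩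
  · obtain ⟨z, hz⟩ := homologyClass_surjective X 0 (e.toLinearEquiv.symm l)
    exact ⟨z, (congrArg e.toLinearEquiv hz).trans (e.toLinearEquiv.apply_symm_apply l)⟩
  · exact (he _).2 ((homologyClass_eq_zero_iff X i 0 hi _).2 ⟨x, rfl⟩)
  · exact (homologyClass_eq_zero_iff X i 0 hi _).1 ((he _).1 hx)
  · exact isExactAt_of_isZero_homology X j (h j (by omega) hj.ne')

theorem degreeLE_d (X : ModComplex A) (k : ℕ) (i j : ℤ) :
    ∀ x ∈ X.degreeLE k i, (X.d i j).hom x ∈ X.degreeLE k j := by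
  intro x hx
  by_cases hj : j ≤ k
  · rw [degreeLE_of_le X hj]; trivial
  · by_cases hij : i - 1 = j
    · rw [degreeLE_of_lt X (by omega), Submodule.mem_bot] at hx
      rw [hx, map_zero]
      exact zero_mem _
    · rw [X.shape i j (by simp; omega)]
      exact zero_mem _

theorem degreeLE_mono (X : ModComplex A) (k : ℕ) (j : ℤ) : X.degreeLE k j ≤ X.degreeLE (k + 1) j := by
  by_cases hj : j ≤ k
  · rw [degreeLE_of_le X (k := k + 1) (by push_cast; omega)]; exact le_top
  · rw [degreeLE_of_lt X (by omega)]; exact bot_le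

end ModComplex

/-- The algebraic form of the bootstrapping theorem. -/
theorem associatedClass_of_complex [Nontrivial R] (hB : IsEquivariantlyBootstrappable R C B)
    {Γ : Type u} [Group Γ] (hΓ : C Γ) (n : ℕ) (X : ModComplex (MonoidAlgebra R Γ))
    (hX : X.IsNonneg)
    (e : X.homology 0 ≅ ModuleCat.of (MonoidAlgebra R Γ) (TrivialModule R Γ))
    (h : ∀ j : ℤ, j ≤ n - 1 → j ≠ 0 → IsZero (X.homology j))
    (hM : ∀ j : ℤ, 0 ≤ j → j ≤ n → ∃ (m : ℕ) (H : Fin m → Subgroup Γ),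
      (∀ i, associatedClass R C B (n - j) (H i)) ∧
      Nonempty (X.X j ≃ₗ[MonoidAlgebra R Γ] ∀ i, PermutationModule R (Γ ⧸ H i) Γ)) :
    associatedClass R C B n Γ := by
  obtain ⟨η, hη⟩ := exists_isAugmentation_of_homology X hX n e h
  have hF := X.degreeLE_d
  refine associatedClass_of_filtration hB hΓ n (fun k => subComplex X (X.degreeLE k) (hF k))
    (fun k => subInclusion X _ _ (hF k) (hF (k + 1)) (X.degreeLE_mono k)) (fun k => X.X k)
    ?_ ?_ ?_ (fun k hk => hM k (by omega) (by omega))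
    (η := η ∘ₗ (X.degreeLE n 0).subtype ∘ₗ (subEquiv X _ (hF n) 0).toLinearMap) ?_
  · have : Nontrivial (TrivialModule R Γ) := inferInstanceAs (Nontrivial R)
    exact hη.surjective.nontrivial
  · refine hasHomologyOnlyAt_subComplex X _ (hF 0) (fun j hj i hi x hx hdx => ?_)
      (Submodule.subtype _) (fun x => ?_) fun i hi z => ?_
    · have : x = 0 := by
        rcases lt_or_gt_of_ne hj with hj | hj
        · have := hη.subsingleton j hj
          exact Subsingleton.elim _ _
        · rwa [degreeLE_of_lt X hj] at hx
      exact ⟨0, zero_mem _, by rw [map_zero, this]⟩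
    · refine ⟨⟨x, (X.degreeLE_of_le (k := 0) (j := 0) le_rfl).ge trivial, ?_⟩, rfl⟩
      have := hη.subsingleton (0 - 1) (by simp)
      exact Subsingleton.elim (α := X.X (0 - 1)) _ _
    · refine ⟨fun hz => ⟨0, zero_mem _, (map_zero _).trans hz.symm⟩, ?_⟩
      rintro ⟨y, hy, hyz⟩
      rw [degreeLE_of_lt X (by push_cast; omega), Submodule.mem_bot] at hy
      rw [hy, map_zero] at hyz
      exact hyz.symm
  · intro k hk
    refine hasRelHomologyOnlyAt_subInclusion X _ _ (hF k) (hF (k + 1)) _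
      (fun j hj i hi y hy hdy => ?_) (Submodule.subtype _) (fun x => ?_) fun i hi z => ?_
    · refine ⟨y, ?_, 0, zero_mem _, by rw [map_zero, add_zero]⟩
      rcases lt_or_gt_of_ne hj with hj | hj
      · rw [degreeLE_of_le X (by push_cast at hj; omega)]; trivial
      · rw [degreeLE_of_lt X hj, Submodule.mem_bot] at hy
        rw [hy]
        exact zero_mem _
    · refine ⟨⟨x, by rw [degreeLE_of_le X le_rfl]; trivial, ?_⟩, rfl⟩
      rw [degreeLE_of_le X (by push_cast; omega)]
      trivial
    · refine ⟨fun hz => ⟨0, zero_mem _, 0, zero_mem _, hz.trans (by simp)⟩, ?_⟩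
      rintro ⟨x', hx', y', hy', e⟩
      rw [degreeLE_of_lt X (by push_cast; omega), Submodule.mem_bot] at hx' hy'
      rw [hx', hy', map_zero, zero_add] at e
      exact e
  · have htop : ∀ (j : ℤ), j ≤ n → ∀ x : X.X j, x ∈ X.degreeLE n j := fun j hj x => by
      rw [degreeLE_of_le X hj]; trivial
    have lift : ∀ i j : ℤ, i ≤ n → ∀ x, (∃ y : X.X i, (X.d i j).hom y = subEquiv X _ (hF n) j x) →
        ∃ y, ((subComplex X _ (hF n)).d i j).hom y = x := by
      rintro i j hi x ⟨y, hy⟩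
      exact ⟨(subEquiv X _ (hF n) i).symm ⟨y, htop i hi y⟩, Subtype.ext hy⟩
    refine ⟨fun j hj => ?_, fun l => ?_, fun i hi x => ?_, fun hn i hi x hx => ?_,
      fun j hj hjn i hi x hx => ?_⟩
    · have := hη.subsingleton j hj
      exact (subEquiv X _ (hF n) j).toEquiv.subsingleton
    · obtain ⟨x, hx⟩ := hη.surjective l
      exact ⟨(subEquiv X _ (hF n) 0).symm ⟨x, htop 0 (by omega) x⟩, hx⟩
    · exact hη.comp_d i hi _
    · exact lift i 0 (by omega) x (hη.ker hn i hi _ hx)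
    · exact lift i j (by omega) x (hη.exact j hj hjn i hi _ (congrArg Subtype.val hx))

end

noncomputable section

/-! ### Augmented chains on semi-simplicial families, and chains of tuples -/

namespace Singular

/-- Face maps on a family of types, where `G n` is thought of as the simplices with `n` vertices.
There is usually one simplex with `0` vertices, so that chains are augmented. -/
class FaceMaps (G : ℕ → Type*) where
  /-- The `i`-th face of a simplex. -/
  face : ∀ {n : ℕ}, Fin (n + 1) → G (n + 1) → G n

/-- Chains, not necessarily homogeneous, with coefficients in `R`. -/
abbrev Chain (R : Type*) [Ring R] (G : ℕ → Type*) := (Σ n, G n) →₀ R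

variable (R : Type*) [Ring R]

/-- A simplex as a chain. -/
def gen {G : ℕ → Type*} {n : ℕ} (x : G n) : Chain R G := Finsupp.single ⟨n, x⟩ 1

variable {R} in
theorem chain_hom_ext {G : ℕ → Type*} {M : Type*} [AddCommGroup M] [Module R M]
    {f g : Chain R G →ₗ[R] M} (h : ∀ (n : ℕ) (x : G n), f (gen R x) = g (gen R x)) : f = g :=
  Finsupp.lhom_ext' fun x => LinearMap.ext_ring (h x.1 x.2)

/-- The linear map with given values on simplices. -/
def extend {G : ℕ → Type*} {M : Type*} [AddCommGroup M] [Module R M] (f : ∀ n, G n → M) :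
    Chain R G →ₗ[R] M :=
  Finsupp.linearCombination R fun x : Σ n, G n => f x.1 x.2

@[simp] theorem extend_gen {G : ℕ → Type*} {M : Type*} [AddCommGroup M] [Module R M]
    (f : ∀ n, G n → M) {n : ℕ} (x : G n) : extend R f (gen R x) = f n x := by
  simp [extend, gen]

/-- The map on chains induced by a map of simplices. -/
def chainMap {G G' : ℕ → Type*} (φ : ∀ n, G n → G' n) : Chain R G →ₗ[R] Chain R G' :=
  extend R fun n x => gen R (φ n x)

@[simp] theorem chainMap_gen {G G' : ℕ → Type*} (φ : ∀ n, G n → G' n) {n : ℕ} (x : G n) :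
    chainMap R φ (gen R x) = gen R (φ n x) := by simp [chainMap]

section

variable {G G' : ℕ → Type*} [FaceMaps G] [FaceMaps G']

/-- The alternating sum of the faces. -/
def bdryGen : ∀ n, G n → Chain R G
  | 0, _ => 0
  | n + 1, x => ∑ i : Fin (n + 1), (-1 : R) ^ (i : ℕ) • gen R (FaceMaps.face i x)

/-- The boundary. -/
def bdry : Chain R G →ₗ[R] Chain R G := extend R (bdryGen R)

@[simp] theorem bdry_gen_zero (x : G 0) : bdry R (gen R x) = 0 := by simp [bdry, bdryGen]

theorem bdry_gen_succ {n : ℕ} (x : G (n + 1)) :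
    bdry R (gen R x) = ∑ i : Fin (n + 1), (-1 : R) ^ (i : ℕ) • gen R (FaceMaps.face i x) := by
  simp [bdry, bdryGen]

theorem bdry_chainMap (φ : ∀ n, G n → G' n)
    (h : ∀ n (i : Fin (n + 1)) x, FaceMaps.face i (φ (n + 1) x) = φ n (FaceMaps.face i x))
    (c : Chain R G) : bdry R (chainMap R φ c) = chainMap R φ (bdry R c) := by
  refine LinearMap.congr_fun (f := bdry R ∘ₗ chainMap R φ) (g := chainMap R φ ∘ₗ bdry R)
    (chain_hom_ext fun n x => ?_) c
  cases n with
  | zero => simp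
  | succ n => simp [bdry_gen_succ, h]

end

/-- Tuples of points. -/
abbrev Tup (K : Type*) : ℕ → Type _ := fun n => Fin n → K

instance (K : Type*) : FaceMaps (Tup K) where
  face i v := v ∘ i.succAbove

section

variable {K K' L L' : Type*}

/-- The cone operator, which prepends a point to every tuple. -/
def coneOp (a : K) : Chain R (Tup K) →ₗ[R] Chain R (Tup K) :=
  extend R fun n v => gen R (G := Tup K) (n := n + 1) (Fin.cons a v)

theorem bdry_coneOp (a : K) (c : Chain R (Tup K)) :
    bdry R (coneOp R a c) = c - coneOp R a (bdry R c) := by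
  refine LinearMap.congr_fun (f := bdry R ∘ₗ coneOp R a)
    (g := LinearMap.id - coneOp R a ∘ₗ bdry R) (chain_hom_ext fun n v => ?_) c
  simp only [LinearMap.comp_apply, LinearMap.sub_apply, LinearMap.id_apply]
  rw [coneOp, extend_gen, bdry_gen_succ, Fin.sum_univ_succ]
  have h0 : FaceMaps.face (G := Tup K) 0 (Fin.cons a v) = v := by
    funext j
    simp [FaceMaps.face]
  rw [h0]
  cases n with
  | zero => simp
  | succ n =>
    have hs : ∀ i : Fin (n + 1), FaceMaps.face (G := Tup K) i.succ (Fin.cons a v) =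
        (Fin.cons a (FaceMaps.face (G := Tup K) i v) : Fin (n + 1) → K) := by
      intro i
      funext j
      refine Fin.cases ?_ (fun j => ?_) j <;> simp [FaceMaps.face]
    simp only [hs, bdry_gen_succ, map_sum, map_smul, extend_gen]
    simp [pow_succ, sub_eq_add_neg]

theorem gen_eq_coneOp {n : ℕ} (v : Tup K (n + 1)) :
    gen R v = coneOp R (v 0) (gen R (G := Tup K) (n := n) (Fin.tail v)) := by
  refine Eq.trans ?_ (extend_gen R _ _).symm
  exact congrArg (fun w : Tup K (n + 1) => gen R w) (Fin.cons_self_tail v).symm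

theorem bdry_bdry_tup (c : Chain R (Tup K)) : bdry R (bdry R c) = 0 := by
  suffices h : bdry R ∘ₗ bdry R = (0 : Chain R (Tup K) →ₗ[R] Chain R (Tup K)) from
    LinearMap.congr_fun h c
  refine chain_hom_ext fun n v => ?_
  change bdry R (bdry R (gen R v)) = 0
  induction n with
  | zero => simp
  | succ n ih =>
    rw [gen_eq_coneOp R v, bdry_coneOp, map_sub, bdry_coneOp, ih, map_zero, sub_zero, sub_self]

/-- The map on chains of tuples induced by a map of points. -/
def tupMap (φ : K → L) : Chain R (Tup K) →ₗ[R] Chain R (Tup L) :=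
  chainMap R fun _ v => φ ∘ v

@[simp] theorem tupMap_gen (φ : K → L) {n : ℕ} (v : Tup K n) :
    tupMap R φ (gen R v) = gen R (G := Tup L) (φ ∘ v) := by simp [tupMap]

theorem bdry_tupMap (φ : K → L) (c : Chain R (Tup K)) :
    bdry R (tupMap R φ c) = tupMap R φ (bdry R c) :=
  bdry_chainMap R _ (fun _ _ _ => rfl) c

theorem tupMap_coneOp (φ : K → L) (a : K) (c : Chain R (Tup K)) :
    tupMap R φ (coneOp R a c) = coneOp R (φ a) (tupMap R φ c) := by
  refine LinearMap.congr_fun (f := tupMap R φ ∘ₗ coneOp R a)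
    (g := coneOp R (φ a) ∘ₗ tupMap R φ) (chain_hom_ext fun n v => ?_) c
  simp [coneOp, Fin.comp_cons]

/-- The values on tuples of the homotopy between two chain maps that coincide on the empty tuple,
by induction on the number of points: fill a cycle by coning it off. -/
def homotopyGen (f g : Chain R (Tup K) →ₗ[R] Chain R (Tup L)) (α : K → L) :
    ∀ n, Tup K n → Chain R (Tup L)
  | 0, _ => 0
  | n + 1, v => coneOp R (α (v 0)) (g (gen R v) - f (gen R v) -
      ∑ i : Fin (n + 1), (-1 : R) ^ (i : ℕ) • homotopyGen f g α n (FaceMaps.face (G := Tup K) i v))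

/-- A homotopy between two chain maps that coincide on the empty tuple. -/
def homotopy (f g : Chain R (Tup K) →ₗ[R] Chain R (Tup L)) (α : K → L) :
    Chain R (Tup K) →ₗ[R] Chain R (Tup L) :=
  extend R (homotopyGen R f g α)

theorem homotopy_gen_zero (f g : Chain R (Tup K) →ₗ[R] Chain R (Tup L)) (α : K → L)
    (v : Tup K 0) : homotopy R f g α (gen R v) = 0 := by simp [homotopy, homotopyGen]

theorem homotopy_gen_succ (f g : Chain R (Tup K) →ₗ[R] Chain R (Tup L)) (α : K → L) {n : ℕ}
    (v : Tup K (n + 1)) : homotopy R f g α (gen R v) = coneOp R (α (v 0))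
      (g (gen R v) - f (gen R v) - homotopy R f g α (bdry R (gen R v))) := by
  simp [homotopy, homotopyGen, bdry_gen_succ]

theorem bdry_homotopy {f g : Chain R (Tup K) →ₗ[R] Chain R (Tup L)} (α : K → L)
    (hf : ∀ c, bdry R (f c) = f (bdry R c)) (hg : ∀ c, bdry R (g c) = g (bdry R c))
    (h0 : ∀ v : Tup K 0, f (gen R v) = g (gen R v)) (c : Chain R (Tup K)) :
    bdry R (homotopy R f g α c) = g c - f c - homotopy R f g α (bdry R c) := by
  suffices h : ∀ (N : ℕ), ∀ n ≤ N, ∀ v : Tup K n, bdry R (homotopy R f g α (gen R v)) =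
      g (gen R v) - f (gen R v) - homotopy R f g α (bdry R (gen R v)) from
    LinearMap.congr_fun (f := bdry R ∘ₗ homotopy R f g α)
      (g := g - f - homotopy R f g α ∘ₗ bdry R) (chain_hom_ext fun n v => h n n le_rfl v) c
  intro N
  induction N with
  | zero =>
    intro n hn v
    obtain rfl : n = 0 := by omega
    simp [homotopy_gen_zero, h0]
  | succ N ih =>
    intro n hn v
    rcases n with - | n
    · exact ih 0 (by omega) v
    · have key : bdry R (homotopy R f g α (bdry R (gen R v))) =
          g (bdry R (gen R v)) - f (bdry R (gen R v)) := by
        have : ∀ i : Fin (n + 1), bdry R (homotopy R f g α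
            (gen R (FaceMaps.face (G := Tup K) i v))) = _ := fun i => ih n (by omega) _
        have hh : homotopy R f g α (bdry R (bdry R (gen R v))) = 0 := by
          rw [bdry_bdry_tup, map_zero]
        rw [← sub_zero (g _ - f _), ← hh, bdry_gen_succ]
        simp only [map_sum, map_smul, this, smul_sub, Finset.sum_sub_distrib]
      have h0 : bdry R (g (gen R v) - f (gen R v) - homotopy R f g α (bdry R (gen R v))) = 0 := by
        rw [map_sub, map_sub, hf, hg, key, sub_self]
      rw [homotopy_gen_succ, bdry_coneOp, h0, map_zero, sub_zero]

theorem tupMap_homotopy {f g : Chain R (Tup K) →ₗ[R] Chain R (Tup L)} {α : K → L}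
    {f' g' : Chain R (Tup K') →ₗ[R] Chain R (Tup L')} {α' : K' → L'} (φ : K → K') (ψ : L → L')
    (hf : ∀ c, tupMap R ψ (f c) = f' (tupMap R φ c))
    (hg : ∀ c, tupMap R ψ (g c) = g' (tupMap R φ c)) (hα : ∀ x, ψ (α x) = α' (φ x))
    (c : Chain R (Tup K)) :
    tupMap R ψ (homotopy R f g α c) = homotopy R f' g' α' (tupMap R φ c) := by
  refine LinearMap.congr_fun (f := tupMap R ψ ∘ₗ homotopy R f g α)
    (g := homotopy R f' g' α' ∘ₗ tupMap R φ) (chain_hom_ext fun n v => ?_) c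
  change tupMap R ψ (homotopy R f g α (gen R v)) = homotopy R f' g' α' (tupMap R φ (gen R v))
  induction n with
  | zero => rw [tupMap_gen, homotopy_gen_zero, homotopy_gen_zero, map_zero]
  | succ n ih =>
    have : tupMap R ψ (homotopy R f g α (bdry R (gen R v))) =
        homotopy R f' g' α' (bdry R (tupMap R φ (gen R v))) := by
      rw [bdry_tupMap, bdry_gen_succ]
      simp only [map_sum, map_smul, ih]
    have h0 : tupMap R ψ (g (gen R v) - f (gen R v) - homotopy R f g α (bdry R (gen R v))) =
        g' (tupMap R φ (gen R v)) - f' (tupMap R φ (gen R v)) -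
          homotopy R f' g' α' (bdry R (tupMap R φ (gen R v))) := by
      rw [map_sub, map_sub, hf, hg, this]
    rw [homotopy_gen_succ, tupMap_coneOp, h0, hα, tupMap_gen, homotopy_gen_succ]
    rfl

/-- The values on tuples of the barycentric subdivision, where `b` chooses barycentres. -/
def subdivGen (b : ∀ n, Tup K (n + 1) → K) : ∀ n, Tup K n → Chain R (Tup K)
  | 0, v => gen R v
  | n + 1, v => coneOp R (b n v)
      (∑ i : Fin (n + 1), (-1 : R) ^ (i : ℕ) • subdivGen b n (FaceMaps.face (G := Tup K) i v))

/-- The barycentric subdivision, where `b` chooses barycentres. -/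
def subdiv (b : ∀ n, Tup K (n + 1) → K) : Chain R (Tup K) →ₗ[R] Chain R (Tup K) :=
  extend R (subdivGen R b)

theorem subdiv_gen_zero (b : ∀ n, Tup K (n + 1) → K) (v : Tup K 0) :
    subdiv R b (gen R v) = gen R v := by simp [subdiv, subdivGen]

theorem subdiv_gen_succ (b : ∀ n, Tup K (n + 1) → K) {n : ℕ} (v : Tup K (n + 1)) :
    subdiv R b (gen R v) = coneOp R (b n v) (subdiv R b (bdry R (gen R v))) := by
  simp [subdiv, subdivGen, bdry_gen_succ]

theorem bdry_subdiv (b : ∀ n, Tup K (n + 1) → K) (c : Chain R (Tup K)) :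
    bdry R (subdiv R b c) = subdiv R b (bdry R c) := by
  refine LinearMap.congr_fun (f := bdry R ∘ₗ subdiv R b)
    (g := subdiv R b ∘ₗ bdry R) (chain_hom_ext fun n v => ?_) c
  change bdry R (subdiv R b (gen R v)) = subdiv R b (bdry R (gen R v))
  induction n with
  | zero => simp [subdiv_gen_zero]
  | succ n ih =>
    have : bdry R (subdiv R b (bdry R (gen R v))) = 0 := by
      have h0 : subdiv R b (bdry R (bdry R (gen R v))) = 0 := by rw [bdry_bdry_tup, map_zero]
      rw [← h0, bdry_gen_succ]
      simp only [map_sum, map_smul, ih]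
    rw [subdiv_gen_succ, bdry_coneOp, this, map_zero, sub_zero]

theorem tupMap_subdiv {b : ∀ n, Tup K (n + 1) → K} {b' : ∀ n, Tup L (n + 1) → L} (φ : K → L)
    (hb : ∀ n v, φ (b n v) = b' n (φ ∘ v)) (c : Chain R (Tup K)) :
    tupMap R φ (subdiv R b c) = subdiv R b' (tupMap R φ c) := by
  refine LinearMap.congr_fun (f := tupMap R φ ∘ₗ subdiv R b)
    (g := subdiv R b' ∘ₗ tupMap R φ) (chain_hom_ext fun n v => ?_) c
  change tupMap R φ (subdiv R b (gen R v)) = subdiv R b' (tupMap R φ (gen R v))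
  induction n with
  | zero => rw [tupMap_gen, subdiv_gen_zero, subdiv_gen_zero, tupMap_gen]
  | succ n ih =>
    have : tupMap R φ (subdiv R b (bdry R (gen R v))) =
        subdiv R b' (bdry R (tupMap R φ (gen R v))) := by
      rw [bdry_tupMap, bdry_gen_succ]
      simp only [map_sum, map_smul, ih]
    rw [subdiv_gen_succ, tupMap_coneOp, this, hb, tupMap_gen, subdiv_gen_succ]

end

end Singular

end

noncomputable section

/-! ### Singular chains: subdivision and homotopies -/

namespace Singular

/-- The standard simplex with `n` vertices; it is empty for `n = 0`. -/
abbrev Splx (n : ℕ) : Type := stdSimplex ℝ (Fin n)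

/-- The affine map between standard simplices with given images of the vertices. -/
def aff {m n : ℕ} (v : Fin m → Splx n) : C(Splx m, Splx n) where
  toFun x := ⟨∑ i, x.1 i • (v i).1, (convex_stdSimplex ℝ _).sum_mem (fun i _ => x.2.1 i) x.2.2
    fun i _ => (v i).2⟩
  continuous_toFun := by
    refine Continuous.subtype_mk (continuous_finsetSum _ fun i _ => ?_) _
    exact ((continuous_apply i).comp continuous_subtype_val).smul continuous_const

theorem aff_val {m n : ℕ} (v : Fin m → Splx n) (x : Splx m) :
    (aff v x).1 = ∑ i, x.1 i • (v i).1 := rfl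

/-- The vertices of the standard simplex. -/
def vtx {n : ℕ} (i : Fin n) : Splx n := ⟨Pi.single i 1, single_mem_stdSimplex ℝ i⟩

@[simp] theorem aff_vtx {m n : ℕ} (v : Fin m → Splx n) (i : Fin m) : aff v (vtx i) = v i := by
  refine Subtype.ext ?_
  rw [aff_val, Finset.sum_eq_single i]
  · simp [vtx]
  · intro j _ hj
    simp [vtx, hj]
  · simp

@[simp] theorem aff_comp_vtx {m n : ℕ} (v : Fin m → Splx n) : aff v ∘ vtx = v :=
  funext fun i => aff_vtx v i

theorem aff_aff {l m n : ℕ} (v : Fin m → Splx n) (w : Fin l → Splx m) (x : Splx l) :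
    aff v (aff w x) = aff (aff v ∘ w) x := by
  refine Subtype.ext ?_
  simp only [aff_val, Function.comp_apply, Finset.smul_sum, Finset.sum_apply, Pi.smul_apply,
    smul_eq_mul, Finset.sum_smul, smul_smul]
  exact Finset.sum_comm

@[simp] theorem aff_vtx_self {n : ℕ} (x : Splx n) : aff vtx x = x := by
  refine Subtype.ext (funext fun j => ?_)
  simp [aff_val, vtx, Pi.single_apply]

/-- The barycentre of a tuple of points. -/
def bary (n k : ℕ) (v : Tup (Splx n) (k + 1)) : Splx n :=
  aff v ⟨fun _ => ((k + 1 : ℕ) : ℝ)⁻¹, fun _ => by positivity, by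
    rw [Finset.sum_const, Finset.card_univ, Fintype.card_fin, nsmul_eq_mul,
      mul_inv_cancel₀ (by positivity)]⟩

theorem aff_bary {m n k : ℕ} (v : Fin m → Splx n) (w : Tup (Splx m) (k + 1)) :
    aff v (bary m k w) = bary n k (aff v ∘ w) := aff_aff v w _

/-- Singular simplices of `X` with `n` vertices. -/
abbrev Sing (X : Type*) [TopologicalSpace X] : ℕ → Type _ := fun n => C(Splx n, X)

variable (R : Type*) [Ring R] {X Y : Type*} [TopologicalSpace X] [TopologicalSpace Y]

instance : FaceMaps (Sing X) where
  face i σ := σ.comp (aff (vtx ∘ i.succAbove))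

/-- The chain of affine singular simplices of the source of `σ`, transported to `X` by `σ`. -/
def push {n : ℕ} (σ : C(Splx n, X)) : Chain R (Tup (Splx n)) →ₗ[R] Chain R (Sing X) :=
  chainMap R (G' := Sing X) fun _ v => σ.comp (aff v)

theorem push_gen {n m : ℕ} (σ : C(Splx n, X)) (v : Tup (Splx n) m) :
    push R σ (gen R v) = gen R (G := Sing X) (σ.comp (aff v)) := chainMap_gen R _ v

theorem push_gen_vtx {n : ℕ} (σ : C(Splx n, X)) :
    push R σ (gen R (G := Tup (Splx n)) vtx) = gen R (G := Sing X) σ := by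
  rw [push_gen]
  congr 1
  ext x
  simp

theorem bdry_push {n : ℕ} (σ : C(Splx n, X)) (c : Chain R (Tup (Splx n))) :
    bdry R (push R σ c) = push R σ (bdry R c) :=
  bdry_chainMap R _ (fun m i v => by
    ext x
    change σ (aff v (aff _ x)) = σ (aff _ x)
    rw [aff_aff, ← Function.comp_assoc, aff_comp_vtx]
    rfl) c

theorem push_comp_aff {m n : ℕ} (σ : C(Splx n, X)) (v : Fin m → Splx n)
    (c : Chain R (Tup (Splx m))) :
    push R (σ.comp (aff v)) c = push R σ (tupMap R (aff v) c) := by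
  refine LinearMap.congr_fun (f := push R (σ.comp (aff v))) (g := push R σ ∘ₗ tupMap R (aff v))
    (chain_hom_ext fun k w => ?_) c
  rw [LinearMap.comp_apply, tupMap_gen, push_gen, push_gen]
  congr 1
  ext x
  exact congrArg σ (aff_aff v w x)

theorem bdry_gen_sing {n : ℕ} (σ : Sing X n) :
    bdry R (gen R σ) = push R σ (bdry R (gen R (G := Tup (Splx n)) vtx)) := by
  rw [← bdry_push, push_gen_vtx]

theorem bdry_bdry (c : Chain R (Sing X)) : bdry R (bdry R c) = 0 := by
  suffices h : bdry R ∘ₗ bdry R = (0 : Chain R (Sing X) →ₗ[R] Chain R (Sing X)) from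
    LinearMap.congr_fun h c
  refine chain_hom_ext fun n σ => ?_
  rw [LinearMap.comp_apply, bdry_gen_sing, bdry_push, bdry_bdry_tup, map_zero]
  rfl

section natural

/-- The operator on singular chains given by a natural operator on chains of tuples in standard
simplices. -/
def singOp (N : ∀ n, Chain R (Tup (Splx n)) →ₗ[R] Chain R (Tup (Splx n))) :
    Chain R (Sing X) →ₗ[R] Chain R (Sing X) :=
  extend R (G := Sing X) fun n σ => push R σ (N n (gen R (G := Tup (Splx n)) vtx))

theorem singOp_gen (N : ∀ n, Chain R (Tup (Splx n)) →ₗ[R] Chain R (Tup (Splx n))) {n : ℕ}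
    (σ : Sing X n) : singOp R N (gen R σ) = push R σ (N n (gen R (G := Tup (Splx n)) vtx)) :=
  extend_gen R _ σ

theorem singOp_push {N : ∀ n, Chain R (Tup (Splx n)) →ₗ[R] Chain R (Tup (Splx n))}
    (hN : ∀ m n (v : Fin m → Splx n) c, tupMap R (aff v) (N m c) = N n (tupMap R (aff v) c))
    {n : ℕ} (σ : C(Splx n, X)) (c : Chain R (Tup (Splx n))) :
    singOp R N (push R σ c) = push R σ (N n c) := by
  refine LinearMap.congr_fun (f := singOp R N ∘ₗ push R σ) (g := push R σ ∘ₗ N n)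
    (chain_hom_ext fun k w => ?_) c
  rw [LinearMap.comp_apply, push_gen, singOp_gen, push_comp_aff, hN, tupMap_gen, aff_comp_vtx]
  rfl

/-- The barycentric subdivision of singular chains. -/
def sd : Chain R (Sing X) →ₗ[R] Chain R (Sing X) := singOp R fun n => subdiv R (bary n)

/-- The homotopy between the barycentric subdivision and the identity. -/
def sdHomotopy : Chain R (Sing X) →ₗ[R] Chain R (Sing X) :=
  singOp R fun n => homotopy R (subdiv R (bary n)) LinearMap.id id

theorem sd_push {n : ℕ} (σ : C(Splx n, X)) (c : Chain R (Tup (Splx n))) :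
    sd R (push R σ c) = push R σ (subdiv R (bary n) c) :=
  singOp_push R (fun _ _ v c => tupMap_subdiv R (aff v) (fun _ w => aff_bary v w) c) σ c

theorem sdHomotopy_push {n : ℕ} (σ : C(Splx n, X)) (c : Chain R (Tup (Splx n))) :
    sdHomotopy R (push R σ c) =
      push R σ (homotopy R (subdiv R (bary n)) LinearMap.id id c) :=
  singOp_push R (fun _ _ v c => tupMap_homotopy R (aff v) (aff v)
    (fun c => tupMap_subdiv R (aff v) (fun _ w => aff_bary v w) c) (fun _ => rfl)
    (fun _ => rfl) c) σ c

theorem bdry_sd (c : Chain R (Sing X)) : bdry R (sd R c) = sd R (bdry R c) := by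
  refine LinearMap.congr_fun (f := bdry R ∘ₗ sd R) (g := sd R ∘ₗ bdry R)
    (chain_hom_ext fun n σ => ?_) c
  rw [LinearMap.comp_apply, LinearMap.comp_apply, bdry_gen_sing, sd_push, ← push_gen_vtx, sd_push,
    bdry_push, bdry_subdiv]

theorem bdry_sdHomotopy (c : Chain R (Sing X)) :
    bdry R (sdHomotopy R c) = c - sd R c - sdHomotopy R (bdry R c) := by
  refine LinearMap.congr_fun (f := bdry R ∘ₗ sdHomotopy R)
    (g := LinearMap.id - sd R - sdHomotopy R ∘ₗ bdry R) (chain_hom_ext fun n σ => ?_) c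
  simp only [LinearMap.comp_apply, LinearMap.sub_apply, LinearMap.id_apply]
  rw [bdry_gen_sing, ← push_gen_vtx, sdHomotopy_push, sdHomotopy_push, sd_push, bdry_push,
    bdry_homotopy R (f := subdiv R (bary n)) (g := LinearMap.id) id (fun c => bdry_subdiv R _ c)
      (fun _ => rfl) (fun v => subdiv_gen_zero R _ v)]
  simp

end natural

section prism

/-- The chain of singular simplices in a prism given by tuples of points, transported to `X`. -/
def prismPush {n : ℕ} (τ : C(Splx n × Splx 2, X)) :
    Chain R (Tup (Splx n × Splx 2)) →ₗ[R] Chain R (Sing X) :=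
  chainMap R (G' := Sing X) fun _ v =>
    τ.comp ((aff (Prod.fst ∘ v)).prodMk (aff (Prod.snd ∘ v)))

theorem prismPush_gen {n m : ℕ} (τ : C(Splx n × Splx 2, X)) (v : Tup (Splx n × Splx 2) m) :
    prismPush R τ (gen R v) = gen R (G := Sing X)
      (τ.comp ((aff (Prod.fst ∘ v)).prodMk (aff (Prod.snd ∘ v)))) := chainMap_gen R _ v

theorem bdry_prismPush {n : ℕ} (τ : C(Splx n × Splx 2, X))
    (c : Chain R (Tup (Splx n × Splx 2))) :
    bdry R (prismPush R τ c) = prismPush R τ (bdry R c) :=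
  bdry_chainMap R _ (fun m i v => by
    ext x
    change τ (aff _ (aff _ x), aff _ (aff _ x)) = τ (aff _ x, aff _ x)
    rw [aff_aff, aff_aff, ← Function.comp_assoc, ← Function.comp_assoc, aff_comp_vtx,
      aff_comp_vtx]
    rfl) c

/-- The homotopy between the bottom and the top of the prism over a standard simplex. -/
def prism (n : ℕ) : Chain R (Tup (Splx n)) →ₗ[R] Chain R (Tup (Splx n × Splx 2)) :=
  homotopy R (tupMap R fun x => (x, vtx 0)) (tupMap R fun x => (x, vtx 1)) fun x => (x, vtx 0)

theorem bdry_prism (n : ℕ) (c : Chain R (Tup (Splx n))) :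
    bdry R (prism R n c) = tupMap R (fun x => (x, vtx 1)) c - tupMap R (fun x => (x, vtx 0)) c -
      prism R n (bdry R c) :=
  bdry_homotopy R _ (bdry_tupMap R _) (bdry_tupMap R _)
    (fun v => by
      rw [tupMap_gen, tupMap_gen]
      exact congrArg (fun w : Tup (Splx n × Splx 2) 0 => gen R w) (Subsingleton.elim _ _)) c

theorem tupMap_prism {m n : ℕ} (v : Fin m → Splx n) (c : Chain R (Tup (Splx m))) :
    tupMap R (Prod.map (aff v) id) (prism R m c) = prism R n (tupMap R (aff v) c) := by
  have h : ∀ (t : Splx 2) (c : Chain R (Tup (Splx m))),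
      tupMap R (Prod.map (aff v) id) (tupMap R (fun x => (x, t)) c) =
        tupMap R (fun x => (x, t)) (tupMap R (aff v) c) := fun t c => by
    refine LinearMap.congr_fun (f := tupMap R _ ∘ₗ tupMap R _) (g := tupMap R _ ∘ₗ tupMap R _)
      (chain_hom_ext fun k w => ?_) c
    simp only [LinearMap.comp_apply, tupMap_gen]
    rfl
  exact tupMap_homotopy R (aff v) _ (h _) (h _) (fun _ => rfl) c

theorem prismPush_comp {m n : ℕ} (τ : C(Splx n × Splx 2, X)) (v : Fin m → Splx n)
    (c : Chain R (Tup (Splx m × Splx 2))) :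
    prismPush R (τ.comp ((aff v).prodMap (ContinuousMap.id _))) c =
      prismPush R τ (tupMap R (Prod.map (aff v) id) c) := by
  refine LinearMap.congr_fun (f := prismPush R _)
    (g := prismPush R τ ∘ₗ tupMap R (Prod.map (aff v) id)) (chain_hom_ext fun k w => ?_) c
  rw [LinearMap.comp_apply, tupMap_gen, prismPush_gen, prismPush_gen]
  congr 1
  ext x
  exact congrArg τ (Prod.ext (aff_aff v _ x) rfl)

open Classical in
/-- The map on chains induced by a function, where singular simplices on which the function is not
continuous are sent to zero. -/
def funMap (f : X → Y) : Chain R (Sing X) →ₗ[R] Chain R (Sing Y) :=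
  extend R (G := Sing X) fun n σ =>
    if h : Continuous fun x => f (σ x) then gen R (G := Sing Y) (n := n) ⟨_, h⟩ else 0

theorem funMap_gen {f : X → Y} {n : ℕ} (σ : Sing X n) (h : Continuous fun x => f (σ x)) :
    funMap R f (gen R σ) = gen R (G := Sing Y) (n := n) ⟨_, h⟩ := by
  rw [funMap, extend_gen, dif_pos h]

open Classical in
/-- The homotopy operator on chains given by a homotopy `h`, with parameter in `[0, 1]`, where
singular simplices on which the homotopy is not continuous are sent to zero. -/
def homotopyOp (h : X → ℝ → Y) : Chain R (Sing X) →ₗ[R] Chain R (Sing Y) :=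
  extend R (G := Sing X) fun n σ =>
    if hc : Continuous fun p : Splx n × Splx 2 => h (σ p.1) (p.2.1 1) then
      prismPush R ⟨_, hc⟩ (prism R n (gen R (G := Tup (Splx n)) vtx)) else 0

theorem homotopyOp_gen {h : X → ℝ → Y} {n : ℕ} (σ : Sing X n)
    (hc : Continuous fun p : Splx n × Splx 2 => h (σ p.1) (p.2.1 1)) :
    homotopyOp R h (gen R σ) =
      prismPush R ⟨_, hc⟩ (prism R n (gen R (G := Tup (Splx n)) vtx)) := by
  rw [homotopyOp, extend_gen, dif_pos hc]

theorem homotopyOp_push {h : X → ℝ → Y} {n : ℕ} (σ : Sing X n)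
    (hc : Continuous fun p : Splx n × Splx 2 => h (σ p.1) (p.2.1 1))
    (c : Chain R (Tup (Splx n))) :
    homotopyOp R h (push R σ c) = prismPush R ⟨_, hc⟩ (prism R n c) := by
  refine LinearMap.congr_fun (f := homotopyOp R h ∘ₗ push R σ)
    (g := prismPush R ⟨_, hc⟩ ∘ₗ prism R n) (chain_hom_ext fun k v => ?_) c
  have hc' : Continuous fun p : Splx k × Splx 2 => h (σ.comp (aff v) p.1) (p.2.1 1) :=
    hc.comp ((aff v).prodMap (ContinuousMap.id (Splx 2))).continuous
  rw [LinearMap.comp_apply, push_gen, homotopyOp_gen R _ hc', LinearMap.comp_apply]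
  refine (prismPush_comp R ⟨_, hc⟩ v _).trans ?_
  rw [tupMap_prism, tupMap_gen, aff_comp_vtx]

theorem bdry_homotopyOp_gen {h : X → ℝ → Y} {n : ℕ} (σ : Sing X n)
    (hc : Continuous fun p : Splx n × Splx 2 => h (σ p.1) (p.2.1 1)) :
    bdry R (homotopyOp R h (gen R σ)) = funMap R (h · 1) (gen R σ) - funMap R (h · 0) (gen R σ) -
      homotopyOp R h (bdry R (gen R σ)) := by
  have hend : ∀ (t : Splx 2) (s : ℝ), t.1 1 = s →
      prismPush R ⟨_, hc⟩ (tupMap R (fun x => (x, t)) (gen R (G := Tup (Splx n)) vtx)) =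
        funMap R (h · s) (gen R σ) := by
    rintro t _ rfl
    rw [tupMap_gen, prismPush_gen, funMap_gen R σ (hc.comp (Continuous.prodMk_left t))]
    congr 1
    ext x
    change h (σ (aff vtx x)) ((aff (fun _ => t) x).1 1) = h (σ x) (t.1 1)
    rw [aff_vtx_self]
    congr 1
    simp [aff_val, ← Finset.sum_mul, x.2.2]
  rw [homotopyOp_gen R σ hc, bdry_prismPush, bdry_prism, map_sub, map_sub, bdry_gen_sing,
    homotopyOp_push R σ hc, hend (vtx 1) 1 (by simp [vtx]), hend (vtx 0) 0 (by simp [vtx])]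

end prism

/-! ### Chains in a subset -/

/-- The chains formed by singular simplices with image in `A`. -/
def chainsIn (A : Set X) : Submodule R (Chain R (Sing X)) :=
  Finsupp.supported R R {x : Σ n, Sing X n | ∀ t, x.2 t ∈ A}

variable {A B : Set X}

theorem gen_mem_chainsIn {n : ℕ} {σ : Sing X n} (h : ∀ t, σ t ∈ A) : gen R σ ∈ chainsIn R A :=
  Finsupp.single_mem_supported R _ h

theorem chainsIn_eq_span : chainsIn R A =
    Submodule.span R {c | ∃ (n : ℕ) (σ : Sing X n), (∀ t, σ t ∈ A) ∧ c = gen R σ} := by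
  rw [chainsIn, Finsupp.supported_eq_span_single]
  congr 1
  ext c
  exact ⟨fun ⟨x, hx, h⟩ => ⟨x.1, x.2, hx, h.symm⟩, fun ⟨n, σ, hσ, h⟩ => ⟨⟨n, σ⟩, hσ, h.symm⟩⟩

variable {R} in
theorem map_mem_of_chainsIn {M : Type*} [AddCommGroup M] [Module R M] {N : Submodule R M}
    {f : Chain R (Sing X) →ₗ[R] M}
    (h : ∀ (n : ℕ) (σ : Sing X n), (∀ t, σ t ∈ A) → f (gen R σ) ∈ N)
    {c : Chain R (Sing X)} (hc : c ∈ chainsIn R A) : f c ∈ N := by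
  rw [chainsIn_eq_span] at hc
  have : Submodule.span R {c | ∃ (n : ℕ) (σ : Sing X n), (∀ t, σ t ∈ A) ∧ c = gen R σ} ≤
      N.comap f := Submodule.span_le.2 (by rintro _ ⟨n, σ, hσ, rfl⟩; exact h n σ hσ)
  exact this hc

variable {R} in
theorem map_eq_of_chainsIn {M : Type*} [AddCommGroup M] [Module R M]
    {f g : Chain R (Sing X) →ₗ[R] M}
    (h : ∀ (n : ℕ) (σ : Sing X n), (∀ t, σ t ∈ A) → f (gen R σ) = g (gen R σ))
    {c : Chain R (Sing X)} (hc : c ∈ chainsIn R A) : f c = g c := by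
  have := map_mem_of_chainsIn (N := ⊥) (f := f - g)
    (fun n σ hσ => by rw [LinearMap.sub_apply, h n σ hσ, sub_self]; exact zero_mem _) hc
  exact sub_eq_zero.1 this

theorem chainsIn_mono (h : A ⊆ B) : chainsIn R A ≤ chainsIn R B :=
  Finsupp.supported_mono fun _ hx t => h (hx t)

theorem chainsIn_inter : chainsIn R (A ∩ B) = chainsIn R A ⊓ chainsIn R B := by
  ext c
  simp only [chainsIn, Submodule.mem_inf, Finsupp.mem_supported, Set.subset_def,
    Set.mem_ofPred_eq, Set.mem_inter_iff]
  exact ⟨fun h => ⟨fun x hx t => (h x hx t).1, fun x hx t => (h x hx t).2⟩,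
    fun h x hx t => ⟨h.1 x hx t, h.2 x hx t⟩⟩

theorem chainsIn_univ : chainsIn R (Set.univ : Set X) = ⊤ := by
  ext c
  simp [chainsIn]

theorem push_mem {n : ℕ} {σ : Sing X n} (hσ : ∀ t, σ t ∈ A) (c : Chain R (Tup (Splx n))) :
    push R σ c ∈ chainsIn R A := by
  induction c using Finsupp.induction_linear with
  | zero => simp
  | add c d hc hd => rw [map_add]; exact add_mem hc hd
  | single x r =>
    have : (Finsupp.single x r : Chain R (Tup (Splx n))) = r • gen R (G := Tup (Splx n)) x.2 := by
      simp [gen]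
    rw [this, map_smul, push_gen]
    exact Submodule.smul_mem _ _ (gen_mem_chainsIn R fun t => hσ _)

theorem bdry_mem {c : Chain R (Sing X)} (hc : c ∈ chainsIn R A) : bdry R c ∈ chainsIn R A :=
  map_mem_of_chainsIn (fun n σ hσ => by rw [bdry_gen_sing]; exact push_mem R hσ _) hc

theorem singOp_mem (N : ∀ n, Chain R (Tup (Splx n)) →ₗ[R] Chain R (Tup (Splx n)))
    {c : Chain R (Sing X)} (hc : c ∈ chainsIn R A) : singOp R N c ∈ chainsIn R A :=
  map_mem_of_chainsIn (fun n σ hσ => by rw [singOp_gen]; exact push_mem R hσ _) hc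

theorem funMap_mem {f : X → Y} {B : Set Y} (hf : Set.MapsTo f A B) {c : Chain R (Sing X)}
    (hc : c ∈ chainsIn R A) : funMap R f c ∈ chainsIn R B := by
  refine map_mem_of_chainsIn (fun n σ hσ => ?_) hc
  by_cases h : Continuous fun x => f (σ x)
  · rw [funMap_gen R σ h]
    exact gen_mem_chainsIn R fun t => hf (hσ t)
  · rw [funMap, extend_gen, dif_neg h]
    exact zero_mem _

theorem homotopyOp_mem {h : X → ℝ → Y} {B : Set Y}
    (hh : ∀ x ∈ A, ∀ t ∈ Set.Icc (0 : ℝ) 1, h x t ∈ B) {c : Chain R (Sing X)}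
    (hc : c ∈ chainsIn R A) : homotopyOp R h c ∈ chainsIn R B := by
  refine map_mem_of_chainsIn (fun n σ hσ => ?_) hc
  by_cases hcont : Continuous fun p : Splx n × Splx 2 => h (σ p.1) (p.2.1 1)
  · rw [homotopyOp_gen R σ hcont]
    generalize prism R n _ = d
    induction d using Finsupp.induction_linear with
    | zero => simp
    | add c d hc hd => rw [map_add]; exact add_mem hc hd
    | single x r =>
      have : (Finsupp.single x r : Chain R (Tup (Splx n × Splx 2))) =
          r • gen R (G := Tup (Splx n × Splx 2)) x.2 := by simp [gen]
      rw [this, map_smul, prismPush_gen]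
      exact Submodule.smul_mem _ _ (gen_mem_chainsIn R fun t => hh _ (hσ _) _
        (mem_Icc_of_mem_stdSimplex (aff _ t).2 1))
  · rw [homotopyOp, extend_gen, dif_neg hcont]
    exact zero_mem _

theorem bdry_homotopyOp {h : X → ℝ → Y}
    (hh : ContinuousOn (fun p : X × ℝ => h p.1 p.2) (A ×ˢ Set.Icc 0 1)) {c : Chain R (Sing X)}
    (hc : c ∈ chainsIn R A) :
    bdry R (homotopyOp R h c) = funMap R (h · 1) c - funMap R (h · 0) c -
      homotopyOp R h (bdry R c) := by
  refine map_eq_of_chainsIn (f := bdry R ∘ₗ homotopyOp R h)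
    (g := funMap R (h · 1) - funMap R (h · 0) - homotopyOp R h ∘ₗ bdry R) (fun n σ hσ => ?_) hc
  refine bdry_homotopyOp_gen R σ ?_
  exact hh.comp_continuous (f := fun p : Splx n × Splx 2 => ((σ p.1, p.2.1 1) : X × ℝ))
    ((σ.continuous.comp continuous_fst).prodMk ((continuous_apply 1).comp
      (continuous_subtype_val.comp continuous_snd))) fun p => ⟨hσ _, mem_Icc_of_mem_stdSimplex p.2.2 1⟩

theorem funMap_eq_self {f : X → X} (hf : ∀ x ∈ A, f x = x) {c : Chain R (Sing X)}
    (hc : c ∈ chainsIn R A) : funMap R f c = c := by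
  refine map_eq_of_chainsIn (g := LinearMap.id) (fun n σ hσ => ?_) hc
  have : (fun x => f (σ x)) = σ := funext fun x => hf _ (hσ x)
  rw [funMap_gen R σ (by rw [this]; exact σ.continuous)]
  refine congrArg (fun τ : Sing X n => gen R τ) (ContinuousMap.ext fun x => hf _ (hσ x))

theorem bdry_funMap {f : X → Y} (hf : ContinuousOn f A) {c : Chain R (Sing X)}
    (hc : c ∈ chainsIn R A) : bdry R (funMap R f c) = funMap R f (bdry R c) := by
  refine map_eq_of_chainsIn (f := bdry R ∘ₗ funMap R f) (g := funMap R f ∘ₗ bdry R)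
    (fun n σ hσ => ?_) hc
  have hσc : Continuous fun x => f (σ x) := hf.comp_continuous σ.continuous hσ
  rw [LinearMap.comp_apply, LinearMap.comp_apply, funMap_gen R σ hσc]
  cases n with
  | zero => simp
  | succ n =>
    rw [bdry_gen_succ, bdry_gen_succ]
    simp only [map_sum, map_smul]
    refine Finset.sum_congr rfl fun i _ => ?_
    refine congrArg _ (funMap_gen R (FaceMaps.face (G := Sing X) i σ)
      (hf.comp_continuous (ContinuousMap.continuous _) fun t => hσ _)).symm

end Singular

end

noncomputable section

/-! ### Small singular chains -/

namespace Singular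

variable (R : Type*) [Ring R]

variable {R} in
theorem map_mem_of_supported {α M : Type*} [AddCommGroup M] [Module R M] {N : Submodule R M}
    {f : (α →₀ R) →ₗ[R] M} {P : Set α} (h : ∀ x ∈ P, f (Finsupp.single x 1) ∈ N) {c : α →₀ R}
    (hc : c ∈ Finsupp.supported R R P) : f c ∈ N := by
  rw [Finsupp.supported_eq_span_single] at hc
  have : Submodule.span R ((fun i => Finsupp.single i (1 : R)) '' P) ≤ N.comap f :=
    Submodule.span_le.2 (by rintro _ ⟨x, hx, rfl⟩; exact h x hx)
  exact this hc

theorem coneOp_mem_supported {K : Type*} {P Q : Set (Σ n, Tup K n)} {a : K}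
    (h : ∀ x ∈ P, (⟨x.1 + 1, Fin.cons a x.2⟩ : Σ n, Tup K n) ∈ Q) {c : Chain R (Tup K)}
    (hc : c ∈ Finsupp.supported R R P) : coneOp R a c ∈ Finsupp.supported R R Q := by
  refine map_mem_of_supported (fun x hx => ?_) hc
  change coneOp R a (gen R (G := Tup K) x.2) ∈ _
  rw [coneOp, extend_gen]
  exact Finsupp.single_mem_supported R _ (h x hx)

/-- The barycentre is closer to the vertices than the diameter, by a factor that depends only on the
number of vertices. -/
theorem dist_bary_le {n k N : ℕ} (hk : k + 1 ≤ N) {d : ℝ} (v : Tup (Splx n) (k + 1))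
    (hv : ∀ i j, dist (v i) (v j) ≤ d) (j : Fin (k + 1)) :
    dist (bary n k v) (v j) ≤ (1 - (N : ℝ)⁻¹) * d := by
  have hd : 0 ≤ d := dist_nonneg.trans (hv j j)
  have hk0 : (0 : ℝ) < (k + 1 : ℕ) := by positivity
  have h1 : (bary n k v).1 - (v j).1 = ∑ i, ((k + 1 : ℕ) : ℝ)⁻¹ • ((v i).1 - (v j).1) := by
    simp_rw [smul_sub]
    rw [Finset.sum_sub_distrib, ← Finset.sum_smul, Finset.sum_const, Finset.card_univ,
      Fintype.card_fin, nsmul_eq_mul, mul_inv_cancel₀ hk0.ne', one_smul]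
    rfl
  have h2 : ∀ i, ‖((k + 1 : ℕ) : ℝ)⁻¹ • ((v i).1 - (v j).1)‖ ≤
      ((k + 1 : ℕ) : ℝ)⁻¹ * (if i = j then 0 else d) := fun i => by
    rw [norm_smul, Real.norm_of_nonneg (by positivity)]
    refine mul_le_mul_of_nonneg_left ?_ (by positivity)
    split_ifs with h
    · simp [h]
    · rw [← dist_eq_norm]
      exact hv i j
  rw [Subtype.dist_eq, dist_eq_norm, h1]
  refine (norm_sum_le _ _).trans ((Finset.sum_le_sum fun i _ => h2 i).trans ?_)
  rw [← Finset.mul_sum, Finset.sum_ite, Finset.sum_const_zero, zero_add, Finset.sum_const,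
    Finset.filter_ne', Finset.card_erase_of_mem (Finset.mem_univ j), Finset.card_univ,
    Fintype.card_fin, nsmul_eq_mul, ← mul_assoc]
  refine mul_le_mul_of_nonneg_right ?_ hd
  have : (N : ℝ)⁻¹ ≤ ((k + 1 : ℕ) : ℝ)⁻¹ := inv_anti₀ hk0 (by exact_mod_cast hk)
  refine le_trans (le_of_eq ?_) (sub_le_sub_left this 1)
  push_cast
  field_simp
  ring

theorem dist_aff_le {m n : ℕ} {d : ℝ} (b : Splx n) (v : Tup (Splx n) m)
    (hv : ∀ i, dist (v i) b ≤ d) (t : Splx m) : dist (aff v t) b ≤ d :=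
  (convex_closedBall b.1 d).sum_mem (fun i _ => t.2.1 i) t.2.2 fun i _ => hv i

/-- The tuples of at most `N` points at mutual distance at most `d`, all of which lie in `A`. -/
def smallTuples {n : ℕ} (A : Set (Splx n)) (N : ℕ) (d : ℝ) : Set (Σ m, Tup (Splx n) m) :=
  {x | x.1 ≤ N ∧ (∀ i, x.2 i ∈ A) ∧ ∀ i j, dist (x.2 i) (x.2 j) ≤ d}

/-- Subdivision shrinks simplices, by the factor of `dist_bary_le`, and preserves sets that are closed
under the formation of barycentres. -/
theorem subdiv_gen_mem {n N : ℕ} {d : ℝ} (hd : 0 ≤ d) : ∀ (m : ℕ), m ≤ N →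
    ∀ (A : Set (Splx n)), (∀ k (w : Tup (Splx n) (k + 1)), (∀ i, w i ∈ A) → bary n k w ∈ A) →
    ∀ (v : Tup (Splx n) m), (∀ i, v i ∈ A) → (∀ i j, dist (v i) (v j) ≤ d) →
    subdiv R (bary n) (gen R v) ∈
      Finsupp.supported R R (smallTuples A m ((1 - (N : ℝ)⁻¹) * d)) := by
  intro m
  induction m with
  | zero =>
    intro _ A _ v _ _
    rw [subdiv_gen_zero]
    exact Finsupp.single_mem_supported R _ ⟨le_rfl, fun i => i.elim0, fun i => i.elim0⟩
  | succ m ih =>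
    intro hm A hA v hv hvd
    have he : 0 ≤ (1 - (N : ℝ)⁻¹) * d := mul_nonneg (sub_nonneg.2 (Nat.cast_inv_le_one N)) hd
    let A' : Set (Splx n) := A ∩ {p | dist p (bary n m v) ≤ (1 - (N : ℝ)⁻¹) * d}
    have hA' : ∀ k (w : Tup (Splx n) (k + 1)), (∀ i, w i ∈ A') → bary n k w ∈ A' :=
      fun k w hw => ⟨hA k w fun i => (hw i).1, dist_aff_le _ w (fun i => (hw i).2) _⟩
    have hvA' : ∀ i, v i ∈ A' := fun i => ⟨hv i, by
      change dist _ _ ≤ _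
      rw [dist_comm]
      exact dist_bary_le hm v hvd i⟩
    rw [subdiv_gen_succ, bdry_gen_succ]
    refine coneOp_mem_supported R (P := smallTuples A' m ((1 - (N : ℝ)⁻¹) * d)) ?_ ?_
    · rintro ⟨l, w⟩ ⟨hl, hw, hwd⟩
      refine ⟨Nat.succ_le_succ hl, fun i => ?_, fun i j => ?_⟩
      · refine Fin.cases ?_ (fun i => ?_) i
        · exact hA m v hv
        · exact (hw i).1
      · refine Fin.cases ?_ (fun i => ?_) i <;> refine Fin.cases ?_ (fun j => ?_) j
        · simpa using he
        · change dist (bary n m v) (w j) ≤ _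
          rw [dist_comm]
          exact (hw j).2
        · exact (hw i).2
        · exact hwd i j
    · rw [map_sum]
      refine Submodule.sum_mem _ fun i _ => ?_
      rw [map_smul]
      exact Submodule.smul_mem _ _ (ih (by omega) A' hA' _ (fun j => hvA' _) fun j k => hvd _ _)

theorem subdiv_iterate_mem {n : ℕ} (v : Tup (Splx n) n) {d : ℝ} (hd : ∀ x y : Splx n, dist x y ≤ d)
    (hd0 : 0 ≤ d) (M : ℕ) : (subdiv R (bary n))^[M] (gen R v) ∈
      Finsupp.supported R R (smallTuples Set.univ (n + 1) ((1 - ((n + 1 : ℕ) : ℝ)⁻¹) ^ M * d)) := by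
  induction M with
  | zero =>
    exact Finsupp.single_mem_supported R _
      ⟨Nat.le_succ n, fun _ => trivial, fun i j => by simpa using hd _ _⟩
  | succ M ih =>
    have h0 : 0 ≤ 1 - ((n + 1 : ℕ) : ℝ)⁻¹ := sub_nonneg.2 (Nat.cast_inv_le_one _)
    rw [Function.iterate_succ_apply']
    refine map_mem_of_supported ?_ ih
    rintro ⟨m, w⟩ ⟨hm, -, hw⟩
    have := subdiv_gen_mem R (N := n + 1) (mul_nonneg (pow_nonneg h0 M) hd0) m hm Set.univ
      (fun _ _ _ => trivial) w (fun _ => trivial) hw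
    refine Finsupp.supported_mono ?_ this
    rintro ⟨l, u⟩ ⟨hl, -, hu⟩
    exact ⟨hl.trans hm, fun _ => trivial, fun i j => (hu i j).trans_eq (by ring)⟩

variable {X : Type*} [TopologicalSpace X]

theorem sd_iterate_push {n : ℕ} (σ : Sing X n) (c : Chain R (Tup (Splx n))) (M : ℕ) :
    (sd R)^[M] (push R σ c) = push R σ ((subdiv R (bary n))^[M] c) := by
  induction M with
  | zero => rfl
  | succ M ih => rw [Function.iterate_succ_apply', ih, sd_push, Function.iterate_succ_apply']

variable {Y U V : Set X}

theorem exists_sd_gen_mem (hU : IsOpen U) (hV : IsOpen V) (hY : Y ⊆ U ∪ V) {n : ℕ} (σ : Sing X n)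
    (hσ : ∀ t, σ t ∈ Y) :
    ∃ M, (sd R)^[M] (gen R σ) ∈ chainsIn R (Y ∩ U) ⊔ chainsIn R (Y ∩ V) := by
  obtain ⟨δ, hδ, hδc⟩ := lebesgue_number_lemma_of_metric (isCompact_univ (X := Splx n))
    (c := fun b : Bool => if b then σ ⁻¹' U else σ ⁻¹' V)
    (by rintro (_ | _); exacts [hV.preimage σ.continuous, hU.preimage σ.continuous])
    (fun t _ => by
      rcases hY (hσ t) with h | h
      · exact Set.mem_iUnion.2 ⟨true, h⟩
      · exact Set.mem_iUnion.2 ⟨false, h⟩)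
  obtain ⟨M, hM⟩ : ∃ M : ℕ, (1 - ((n + 1 : ℕ) : ℝ)⁻¹) ^ M * Metric.diam (Set.univ : Set (Splx n)) < δ := by
    have := (tendsto_pow_atTop_nhds_zero_of_lt_one (r := 1 - ((n + 1 : ℕ) : ℝ)⁻¹)
      (sub_nonneg.2 (Nat.cast_inv_le_one _)) (sub_lt_self 1 (by positivity))).mul_const
      (Metric.diam (Set.univ : Set (Splx n)))
    rw [zero_mul] at this
    exact (this.eventually (gt_mem_nhds hδ)).exists
  refine ⟨M, ?_⟩
  have hmem := subdiv_iterate_mem R (n := n) vtx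
    (fun x y => Metric.dist_le_diam_of_mem isCompact_univ.isBounded (Set.mem_univ x)
      (Set.mem_univ y)) Metric.diam_nonneg M
  rw [← push_gen_vtx, sd_iterate_push]
  refine map_mem_of_supported ?_ hmem
  rintro ⟨m, w⟩ ⟨-, -, hw⟩
  change push R σ (gen R w) ∈ _
  rw [push_gen]
  rcases m with - | m
  · refine Submodule.mem_sup_left (gen_mem_chainsIn R fun t => ?_)
    have := t.2.2
    simp at this
  · have hb : ∀ t, aff w t ∈ Metric.ball (w 0) δ := fun t =>
      (dist_aff_le (w 0) w (fun i => hw i 0) t).trans_lt hM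
    obtain ⟨b, hbδ⟩ := hδc (w 0) (Set.mem_univ _)
    cases b with
    | true => exact Submodule.mem_sup_left (gen_mem_chainsIn R fun t => ⟨hσ _, hbδ (hb t)⟩)
    | false => exact Submodule.mem_sup_right (gen_mem_chainsIn R fun t => ⟨hσ _, hbδ (hb t)⟩)

theorem singOp_mem_sup (N : ∀ n, Chain R (Tup (Splx n)) →ₗ[R] Chain R (Tup (Splx n)))
    {c : Chain R (Sing X)} {A B : Set X} (hc : c ∈ chainsIn R A ⊔ chainsIn R B) :
    singOp R N c ∈ chainsIn R A ⊔ chainsIn R B := by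
  obtain ⟨a, ha, b, hb, rfl⟩ := Submodule.mem_sup.1 hc
  rw [map_add]
  exact Submodule.add_mem_sup (singOp_mem R N ha) (singOp_mem R N hb)

theorem exists_sd_mem (hU : IsOpen U) (hV : IsOpen V) (hY : Y ⊆ U ∪ V) {c : Chain R (Sing X)}
    (hc : c ∈ chainsIn R Y) :
    ∃ M, ∀ M' ≥ M, ((sd R : Chain R (Sing X) →ₗ[R] _) ^ M') c ∈
      chainsIn R (Y ∩ U) ⊔ chainsIn R (Y ∩ V) := by
  rw [chainsIn_eq_span] at hc
  induction hc using Submodule.span_induction with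
  | zero => exact ⟨0, fun M _ => by rw [map_zero]; exact zero_mem _⟩
  | add c d _ _ hc hd =>
    obtain ⟨M, hM⟩ := hc
    obtain ⟨M', hM'⟩ := hd
    refine ⟨max M M', fun K hK => ?_⟩
    rw [map_add]
    exact add_mem (hM K (le_of_max_le_left hK)) (hM' K (le_of_max_le_right hK))
  | smul r c _ hc =>
    obtain ⟨M, hM⟩ := hc
    exact ⟨M, fun K hK => by rw [map_smul]; exact Submodule.smul_mem _ _ (hM K hK)⟩
  | mem c hc =>
    obtain ⟨n, σ, hσ, rfl⟩ := hc
    obtain ⟨M, hM⟩ := exists_sd_gen_mem R hU hV hY σ hσ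
    refine ⟨M, fun K hK => ?_⟩
    induction K, hK using Nat.le_induction with
    | base => rwa [Module.End.pow_apply]
    | succ K _ ih => rw [pow_succ', Module.End.mul_apply]; exact singOp_mem_sup R _ ih

/-- Small simplices: a chain in a space covered by two relatively open sets, whose boundary is a
sum of chains in the two sets, is homologous to a sum of chains in the two sets. -/
theorem exists_small (hU : IsOpen U) (hV : IsOpen V) (hY : Y ⊆ U ∪ V) {c : Chain R (Sing X)}
    (hc : c ∈ chainsIn R Y) (hdc : bdry R c ∈ chainsIn R (Y ∩ U) ⊔ chainsIn R (Y ∩ V)) :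
    ∃ y ∈ chainsIn R Y, c - bdry R y ∈ chainsIn R (Y ∩ U) ⊔ chainsIn R (Y ∩ V) := by
  have hpow : ∀ M (c : Chain R (Sing X)), bdry R (((sd R : Chain R (Sing X) →ₗ[R] _) ^ M) c) =
      ((sd R : Chain R (Sing X) →ₗ[R] _) ^ M) (bdry R c) := by
    intro M c
    induction M with
    | zero => rfl
    | succ M ih => rw [pow_succ', Module.End.mul_apply, bdry_sd, ih]; rfl
  have hpow_mem : ∀ M, ((sd R : Chain R (Sing X) →ₗ[R] _) ^ M) c ∈ chainsIn R Y ∧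
      ((sd R : Chain R (Sing X) →ₗ[R] _) ^ M) (bdry R c) ∈
        chainsIn R (Y ∩ U) ⊔ chainsIn R (Y ∩ V) := by
    intro M
    induction M with
    | zero => exact ⟨hc, hdc⟩
    | succ M ih =>
      rw [pow_succ', Module.End.mul_apply, Module.End.mul_apply]
      exact ⟨singOp_mem R _ ih.1, singOp_mem_sup R _ ih.2⟩
  have key : ∀ M, ∃ y ∈ chainsIn R Y, c - ((sd R : Chain R (Sing X) →ₗ[R] _) ^ M) c - bdry R y ∈
      chainsIn R (Y ∩ U) ⊔ chainsIn R (Y ∩ V) := by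
    intro M
    induction M with
    | zero => exact ⟨0, zero_mem _, by simp⟩
    | succ M ih =>
      obtain ⟨y, hy, h⟩ := ih
      refine ⟨y + sdHomotopy R (((sd R : Chain R (Sing X) →ₗ[R] _) ^ M) c),
        add_mem hy (singOp_mem R _ (hpow_mem M).1), ?_⟩
      have := add_mem h (singOp_mem_sup R (fun n => homotopy R (subdiv R (bary n)) LinearMap.id id)
        (hpow_mem M).2)
      convert this using 1
      change _ = _ + sdHomotopy R _
      rw [map_add, bdry_sdHomotopy, hpow, pow_succ', Module.End.mul_apply]
      abel
  obtain ⟨M, hM⟩ := exists_sd_mem R hU hV hY hc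
  obtain ⟨y, hy, h⟩ := key M
  refine ⟨y, hy, ?_⟩
  have := add_mem h (hM M le_rfl)
  convert this using 1
  abel

end Singular

end

noncomputable section

/-! ### Bases of relative homology -/

namespace Singular

variable (R : Type*) [Ring R] {X : Type*} [TopologicalSpace X]

/-- The homogeneous part of a chain formed by the simplices with `d` vertices. -/
def homogPart {G : ℕ → Type*} (d : ℕ) : Chain R G →ₗ[R] Chain R G :=
  extend R fun n x => if n = d then gen R x else 0

variable {R} in
/-- The chain is homogeneous, formed by simplices with `d` vertices. -/
def IsHomog {G : ℕ → Type*} (d : ℕ) (c : Chain R G) : Prop := homogPart R d c = c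

theorem homogPart_gen {G : ℕ → Type*} (d : ℕ) {n : ℕ} (x : G n) :
    homogPart R d (gen R x) = if n = d then gen R x else 0 := extend_gen R _ x

theorem homogPart_homogPart {G : ℕ → Type*} (d e : ℕ) (c : Chain R G) :
    homogPart R d (homogPart R e c) = if e = d then homogPart R d c else 0 := by
  split_ifs with h
  · subst h
    refine LinearMap.congr_fun (f := homogPart R e ∘ₗ homogPart R e) (g := homogPart R e)
      (chain_hom_ext fun n x => ?_) c
    rw [LinearMap.comp_apply, homogPart_gen]
    split_ifs with h
    · rw [homogPart_gen, if_pos h]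
    · rw [map_zero]
  · suffices hh : homogPart R d ∘ₗ homogPart R e = (0 : Chain R G →ₗ[R] Chain R G) from
      LinearMap.congr_fun hh c
    refine chain_hom_ext fun n x => ?_
    rw [LinearMap.comp_apply, homogPart_gen]
    split_ifs with h'
    · rw [homogPart_gen, if_neg (by omega)]
      rfl
    · rw [map_zero]
      rfl

theorem isHomog_homogPart {G : ℕ → Type*} (d : ℕ) (c : Chain R G) :
    IsHomog d (homogPart R d c) := by
  rw [IsHomog, homogPart_homogPart, if_pos rfl]

theorem homogPart_bdry {G : ℕ → Type*} [FaceMaps G] (d : ℕ) (c : Chain R G) :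
    homogPart R d (bdry R c) = bdry R (homogPart R (d + 1) c) := by
  suffices h : homogPart R d ∘ₗ bdry R =
      (bdry R ∘ₗ homogPart R (d + 1) : Chain R G →ₗ[R] Chain R G) from LinearMap.congr_fun h c
  refine chain_hom_ext fun n x => ?_
  rw [LinearMap.comp_apply, LinearMap.comp_apply, homogPart_gen]
  cases n with
  | zero => simp
  | succ n =>
    split_ifs with h
    · simp only [bdry_gen_succ, map_sum, map_smul, homogPart_gen, if_pos (Nat.succ.inj h)]
    · simp [bdry_gen_succ, map_sum, map_smul, homogPart_gen, show n ≠ d by omega]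

variable {R}

theorem IsHomog.bdry {G : ℕ → Type*} [FaceMaps G] {d : ℕ} {c : Chain R G} (h : IsHomog (d + 1) c) :
    IsHomog d (bdry R c) := by
  rw [IsHomog, homogPart_bdry, h]

theorem homogPart_mem {A : Set X} {c : Chain R (Sing X)} (hc : c ∈ chainsIn R A) (d : ℕ) :
    homogPart R d c ∈ chainsIn R A :=
  map_mem_of_chainsIn (fun n σ hσ => by
    rw [homogPart_gen]
    split_ifs
    · exact gen_mem_chainsIn R hσ
    · exact zero_mem _) hc

variable (R) in
/-- A graded subcomplex of the complex of singular chains. -/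
structure IsSubcomplex (P : Submodule R (Chain R (Sing X))) : Prop where
  bdry_mem : ∀ c ∈ P, bdry R c ∈ P
  homogPart_mem : ∀ c ∈ P, ∀ d, homogPart R d c ∈ P

theorem isSubcomplex_chainsIn (A : Set X) : IsSubcomplex R (chainsIn R A) :=
  ⟨fun _ hc => Singular.bdry_mem R hc, fun _ hc d => Singular.homogPart_mem hc d⟩

theorem isSubcomplex_bot : IsSubcomplex R (⊥ : Submodule R (Chain R (Sing X))) :=
  ⟨fun c hc => by rw [(Submodule.mem_bot R).1 hc, map_zero]; exact zero_mem _,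
    fun c hc d => by rw [(Submodule.mem_bot R).1 hc, map_zero]; exact zero_mem _⟩

/-- The classes of the chains `b i`, which are formed by simplices with `d` vertices, are a basis
of the relative homology of `P` modulo `N`. In particular, it is concentrated in one degree. -/
structure IsRelBasis (P N : Submodule R (Chain R (Sing X))) (d : ℕ) {ι : Type*}
    (b : ι → Chain R (Sing X)) : Prop where
  homog : ∀ i, IsHomog d (b i)
  mem : ∀ i, b i ∈ P
  bdry_mem : ∀ i, bdry R (b i) ∈ N
  span : ∀ z ∈ P, bdry R z ∈ N →
    ∃ r : ι →₀ R, ∃ y ∈ P, z - bdry R y - Finsupp.linearCombination R b r ∈ N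
  indep : ∀ r : ι →₀ R, ∀ y ∈ P, Finsupp.linearCombination R b r - bdry R y ∈ N → r = 0

variable (R) in
/-- Every cycle in `P` bounds. -/
def IsAcyclic (P : Submodule R (Chain R (Sing X))) : Prop :=
  ∀ z ∈ P, bdry R z = 0 → ∃ y ∈ P, bdry R y = z

variable {P N U V : Submodule R (Chain R (Sing X))} {d : ℕ} {ι : Type*}

theorem linearCombination_mem {b : ι → Chain R (Sing X)} (h : ∀ i, b i ∈ P) (r : ι →₀ R) :
    Finsupp.linearCombination R b r ∈ P := by
  rw [Finsupp.linearCombination_apply]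
  exact Submodule.sum_mem _ fun i _ => P.smul_mem _ (h i)

/-- The connecting homomorphism of an acyclic complex. -/
theorem IsRelBasis.exists_of_isAcyclic {c : ι → Chain R (Sing X)} (hc : IsRelBasis N ⊥ d c)
    (hP : IsSubcomplex R P) (hac : IsAcyclic R P) (hNP : N ≤ P) :
    ∃ b : ι → Chain R (Sing X), IsRelBasis P N (d + 1) b := by
  have : ∀ i, ∃ y ∈ P, IsHomog (d + 1) y ∧ bdry R y = c i := fun i => by
    obtain ⟨y, hy, hyc⟩ := hac (c i) (hNP (hc.mem i)) ((Submodule.mem_bot R).1 (hc.bdry_mem i))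
    exact ⟨homogPart R (d + 1) y, hP.homogPart_mem y hy _, isHomog_homogPart R _ y, by
      rw [← homogPart_bdry, hyc]; exact hc.homog i⟩
  choose b hb hbd hbc using this
  have hlin : ∀ r, bdry R (Finsupp.linearCombination R b r) = Finsupp.linearCombination R c r :=
    fun r => by
      rw [Finsupp.apply_linearCombination]
      congr 2
      exact funext hbc
  refine ⟨b, hbd, hb, fun i => by rw [hbc]; exact hc.mem i, fun z hz hdz => ?_, fun r y hy h => ?_⟩
  · obtain ⟨r, y, hy, h⟩ := hc.span (bdry R z) hdz (by rw [bdry_bdry]; exact zero_mem _)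
    obtain ⟨y', hy', h'⟩ := hac (z - y - Finsupp.linearCombination R b r)
      (sub_mem (sub_mem hz (hNP hy)) (linearCombination_mem hb r))
      (by rw [map_sub, map_sub, hlin]; exact h)
    refine ⟨r, y', hy', ?_⟩
    rw [h']
    convert hy using 1
    abel
  · refine hc.indep r _ h ?_
    rw [map_sub, hlin, bdry_bdry, sub_zero, sub_self]
    exact zero_mem _

/-- Excision. -/
theorem IsRelBasis.of_small {b : ι → Chain R (Sing X)} (hb : IsRelBasis V (U ⊓ V) d b)
    (hU : IsSubcomplex R U) (hV : IsSubcomplex R V) (hVP : V ≤ P)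
    (hsmall : ∀ w ∈ P, bdry R w ∈ U ⊔ V → ∃ y ∈ P, w - bdry R y ∈ U ⊔ V) :
    IsRelBasis P U d b := by
  refine ⟨hb.homog, fun i => hVP (hb.mem i), fun i => (hb.bdry_mem i).1, fun z hz hdz => ?_,
    fun r y hy h => ?_⟩
  · obtain ⟨y, hy, h⟩ := hsmall z hz (Submodule.mem_sup_left hdz)
    obtain ⟨u, hu, v, hv, huv⟩ := Submodule.mem_sup.1 h
    have hdv : bdry R v ∈ U := by
      have : bdry R v = bdry R z - bdry R u := by
        rw [← map_sub, ← sub_eq_iff_eq_add'.2 huv.symm, map_sub, map_sub, map_sub, bdry_bdry]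
        abel
      rw [this]
      exact sub_mem hdz (hU.bdry_mem u hu)
    obtain ⟨r, y', hy', h'⟩ := hb.span v hv ⟨hdv, hV.bdry_mem v hv⟩
    refine ⟨r, y + y', add_mem hy (hVP hy'), ?_⟩
    have := add_mem hu h'.1
    convert this using 1
    rw [map_add, ← sub_sub, ← huv]
    abel
  · have hs : bdry R y ∈ U ⊔ V := by
      have := sub_mem (Submodule.mem_sup_right (linearCombination_mem hb.mem r))
        (Submodule.mem_sup_left h : _ ∈ U ⊔ V)
      rwa [sub_sub_cancel] at this
    obtain ⟨q, hq, hs⟩ := hsmall y hy hs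
    obtain ⟨u, hu, v, hv, huv⟩ := Submodule.mem_sup.1 hs
    have hy' : bdry R y = bdry R u + bdry R v := by
      rw [← map_add, huv, map_sub, bdry_bdry, sub_zero]
    refine hb.indep r v hv (Submodule.mem_inf.2
      ⟨?_, sub_mem (linearCombination_mem hb.mem r) (hV.bdry_mem v hv)⟩)
    have := add_mem h (hU.bdry_mem u hu)
    rw [hy'] at this
    convert this using 1
    abel

/-- `N` is a deformation retract of `U`, in so far as homology is concerned. -/
def IsRetract (U N : Submodule R (Chain R (Sing X))) : Prop :=
  ∀ u ∈ U, bdry R u ∈ N → ∃ a ∈ N, ∃ y ∈ U, u = a + bdry R y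

theorem IsRelBasis.exists_of_isRetract {b : ι → Chain R (Sing X)} (hb : IsRelBasis P U (d + 1) b)
    (hN : IsSubcomplex R N) (hU : IsSubcomplex R U) (hNU : N ≤ U) (hUP : U ≤ P)
    (hret : IsRetract U N) :
    ∃ b' : ι → Chain R (Sing X), (∀ i, b' i - b i ∈ U) ∧ IsRelBasis P N (d + 1) b' := by
  have : ∀ i, ∃ y ∈ U, IsHomog (d + 1) y ∧ bdry R (b i - y) ∈ N := fun i => by
    obtain ⟨a, ha, y, hy, h⟩ := hret _ (hb.bdry_mem i) (by rw [bdry_bdry]; exact zero_mem _)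
    refine ⟨homogPart R (d + 1) y, hU.homogPart_mem y hy _, isHomog_homogPart R _ y, ?_⟩
    rw [map_sub, ← homogPart_bdry, ← (hb.homog i).bdry, ← map_sub, h, add_sub_cancel_right]
    exact hN.homogPart_mem a ha d
  choose y hy hyd hyN using this
  have hlin : ∀ r : ι →₀ R, Finsupp.linearCombination R (fun i => b i - y i) r =
      Finsupp.linearCombination R b r - Finsupp.linearCombination R y r := fun r => by
    simp only [Finsupp.linearCombination_apply, Finsupp.sum, smul_sub, Finset.sum_sub_distrib]
  refine ⟨fun i => b i - y i, fun i => by simpa using hy i, fun i => ?_,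
    fun i => sub_mem (hb.mem i) (hUP (hy i)), hyN, fun z hz hdz => ?_, fun r w hw h => ?_⟩
  · rw [IsHomog, map_sub, hb.homog i, hyd i]
  · obtain ⟨r, w, hw, h⟩ := hb.span z hz (hNU hdz)
    have h' : z - bdry R w - Finsupp.linearCombination R (fun i => b i - y i) r ∈ U := by
      rw [hlin, ← sub_add]
      exact add_mem h (linearCombination_mem hy r)
    obtain ⟨a, ha, q, hq, e⟩ := hret _ h' (by
      rw [map_sub, map_sub, bdry_bdry, sub_zero, Finsupp.apply_linearCombination]
      exact sub_mem hdz (linearCombination_mem hyN r))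
    refine ⟨r, w + q, add_mem hw (hUP hq), ?_⟩
    convert ha using 1
    rw [map_add, ← sub_eq_iff_eq_add.2 e]
    abel
  · refine hb.indep r w hw ?_
    have := add_mem (hNU h) (linearCombination_mem hy r)
    rw [hlin] at this
    convert this using 1
    abel

theorem IsRelBasis.of_isRetract {c : ι → Chain R (Sing X)} (hc : IsRelBasis N ⊥ d c)
    (hNU : N ≤ U) (hret : IsRetract U N) : IsRelBasis U ⊥ d c := by
  refine ⟨hc.homog, fun i => hNU (hc.mem i), hc.bdry_mem, fun z hz hdz => ?_, fun r y hy h => ?_⟩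
  · rw [Submodule.mem_bot] at hdz
    obtain ⟨a, ha, y, hy, rfl⟩ := hret z hz (by rw [hdz]; exact zero_mem _)
    rw [map_add, bdry_bdry, add_zero] at hdz
    obtain ⟨r, y', hy', h⟩ := hc.span a ha (by rw [hdz]; exact zero_mem _)
    refine ⟨r, y + y', add_mem hy (hNU hy'), ?_⟩
    convert h using 1
    rw [map_add]
    abel
  · rw [Submodule.mem_bot, sub_eq_zero] at h
    obtain ⟨a, ha, y', hy', rfl⟩ := hret y hy (by
      rw [← h]; exact linearCombination_mem hc.mem r)
    refine hc.indep r a ha ?_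
    rw [h, map_add, bdry_bdry, add_zero, sub_self]
    exact zero_mem _

/-- The Mayer-Vietoris argument: if `U` and `V` are acyclic, then the homology of their union is
the shifted homology of the intersection. -/
theorem IsRelBasis.exists_of_isAcyclic_of_isAcyclic {c : ι → Chain R (Sing X)}
    (hc : IsRelBasis (U ⊓ V) ⊥ d c) (hU : IsSubcomplex R U) (hV : IsSubcomplex R V)
    (hUac : IsAcyclic R U) (hVac : IsAcyclic R V) (hUP : U ≤ P) (hVP : V ≤ P)
    (hsmall : ∀ w ∈ P, bdry R w ∈ U ⊔ V → ∃ y ∈ P, w - bdry R y ∈ U ⊔ V) :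
    ∃ b : ι → Chain R (Sing X), IsRelBasis P ⊥ (d + 1) b := by
  obtain ⟨b, hb⟩ := hc.exists_of_isAcyclic hV hVac inf_le_right
  obtain ⟨b', -, hb'⟩ := (hb.of_small hU hV hVP hsmall).exists_of_isRetract isSubcomplex_bot hU
    bot_le hUP (fun u hu hdu => by
      obtain ⟨y, hy, h⟩ := hUac u hu ((Submodule.mem_bot R).1 hdu)
      exact ⟨0, zero_mem _, y, hy, by rw [h, zero_add]⟩)
  exact ⟨b', hb'⟩

/-! ### Deformations -/

/-- A deformation of `A` into `B`, relative to `B`. -/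
theorem isRetract_of_homotopy {A B : Set X} (h : X → ℝ → X)
    (hcont : ContinuousOn (fun p : X × ℝ => h p.1 p.2) (A ×ˢ Set.Icc 0 1))
    (hA : ∀ x ∈ A, ∀ t ∈ Set.Icc (0 : ℝ) 1, h x t ∈ A)
    (hB : ∀ x ∈ B, ∀ t ∈ Set.Icc (0 : ℝ) 1, h x t ∈ B) (h0 : ∀ x ∈ A, h x 0 = x)
    (h1 : ∀ x ∈ A, h x 1 ∈ B) : IsRetract (chainsIn R A) (chainsIn R B) := by
  intro u hu hdu
  have key := bdry_homotopyOp R hcont hu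
  rw [funMap_eq_self R h0 hu] at key
  refine ⟨funMap R (h · 1) u - homotopyOp R h (bdry R u),
    sub_mem (funMap_mem R h1 hu) (homotopyOp_mem R hB hdu), -homotopyOp R h u,
    neg_mem (homotopyOp_mem R hA hu), ?_⟩
  rw [map_neg, key]
  abel

/-- The cone on a point, as an operator on constant singular simplices. -/
def constCone (a : X) : Chain R (Sing X) →ₗ[R] Chain R (Sing X) :=
  extend R (G := Sing X) fun n _ => gen R (G := Sing X) (n := n + 1) (ContinuousMap.const _ a)

theorem bdry_constCone (a : X) (c : Chain R (Sing X)) :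
    bdry R (constCone a c) = funMap R (fun _ => a) c - constCone a (bdry R c) := by
  refine LinearMap.congr_fun (f := bdry R ∘ₗ constCone a)
    (g := funMap R (fun _ => a) - constCone a ∘ₗ bdry R) (chain_hom_ext fun n σ => ?_) c
  simp only [LinearMap.comp_apply, LinearMap.sub_apply]
  have hface : ∀ (n : ℕ) (i : Fin (n + 1)),
      FaceMaps.face (G := Sing X) i (ContinuousMap.const (Splx (n + 1)) a) =
        ContinuousMap.const (Splx n) a := fun _ _ => rfl
  rw [constCone, extend_gen, bdry_gen_succ, funMap_gen R σ continuous_const, Fin.sum_univ_succ]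
  simp only [hface]
  cases n with
  | zero =>
    simp
    rfl
  | succ n =>
    simp only [bdry_gen_succ, map_sum, map_smul, extend_gen]
    simp [pow_succ, sub_eq_add_neg]
    rfl

/-- A subset that can be contracted within itself is acyclic. -/
theorem isAcyclic_of_homotopy {A : Set X} (h : X → ℝ → X) (a : X) (ha : a ∈ A)
    (hcont : ContinuousOn (fun p : X × ℝ => h p.1 p.2) (A ×ˢ Set.Icc 0 1))
    (hA : ∀ x ∈ A, ∀ t ∈ Set.Icc (0 : ℝ) 1, h x t ∈ A) (h0 : ∀ x ∈ A, h x 0 = x)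
    (h1 : ∀ x, h x 1 = a) : IsAcyclic R (chainsIn R A) := by
  intro z hz hdz
  refine ⟨constCone a z - homotopyOp R h z, sub_mem ?_ (homotopyOp_mem R hA hz), ?_⟩
  · refine map_mem_of_chainsIn (fun n σ hσ => ?_) hz
    rw [constCone, extend_gen]
    exact gen_mem_chainsIn R fun _ => ha
  · have : (h · 1) = fun _ => a := funext h1
    rw [map_sub, bdry_constCone, bdry_homotopyOp R hcont hz, funMap_eq_self R h0 hz, hdz, map_zero,
      map_zero, this]
    abel

theorem isAcyclic_of_starConvex {E : Type*} [AddCommGroup E] [Module ℝ E] [TopologicalSpace E]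
    [ContinuousAdd E] [ContinuousSMul ℝ E] {A : Set E} {a : E} (ha : a ∈ A)
    (hA : StarConvex ℝ a A) : IsAcyclic R (chainsIn R A) :=
  isAcyclic_of_homotopy (fun x t => t • a + (1 - t) • x) a ha (by fun_prop)
    (fun x hx t ht => hA hx ht.1 (sub_nonneg.2 ht.2) (by abel)) (by simp) (by simp)

theorem mem_chainsIn_empty_iff {c : Chain R (Sing X)} :
    c ∈ chainsIn R (∅ : Set X) ↔ IsHomog 0 c := by
  constructor
  · intro hc
    refine map_eq_of_chainsIn (g := LinearMap.id) (fun n σ hσ => ?_) hc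
    cases n with
    | zero => rw [homogPart_gen, if_pos rfl]; rfl
    | succ n => exact (hσ (vtx 0)).elim
  · intro hc
    rw [← hc]
    have : c ∈ chainsIn R (Set.univ : Set X) := by rw [chainsIn_univ]; trivial
    refine map_mem_of_chainsIn (fun n σ _ => ?_) this
    rw [homogPart_gen]
    split_ifs with h
    · subst h
      exact gen_mem_chainsIn R fun t => by simpa using t.2.2
    · exact zero_mem _

instance : Subsingleton (Sing X 0) :=
  ⟨fun _ _ => ContinuousMap.ext fun t => by simpa using t.2.2⟩

/-- The singular simplex without vertices. -/
def emptySimplex : Sing X 0 where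
  toFun t := (by simpa using t.2.2 : False).elim
  continuous_toFun :=
    have : IsEmpty (Splx 0) := ⟨fun t => by simpa using t.2.2⟩
    continuous_of_const fun t => isEmptyElim t

theorem isRelBasis_empty :
    IsRelBasis (chainsIn R (∅ : Set X)) ⊥ 0 fun _ : Unit => gen R (emptySimplex (X := X)) := by
  refine ⟨fun _ => ?_, fun _ => ?_, fun _ => ?_, fun z hz _ => ?_, fun r y hy h => ?_⟩
  · rw [IsHomog, homogPart_gen, if_pos rfl]
  · rw [mem_chainsIn_empty_iff, IsHomog, homogPart_gen, if_pos rfl]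
  · rw [bdry_gen_zero]
    exact zero_mem _
  · have : z ∈ Submodule.span R {gen R (emptySimplex (X := X))} := by
      refine map_mem_of_chainsIn (f := LinearMap.id) (fun n σ hσ => ?_) hz
      cases n with
      | zero =>
        rw [Subsingleton.elim σ emptySimplex]
        exact Submodule.mem_span_singleton_self _
      | succ n => exact (hσ (vtx 0)).elim
    obtain ⟨r, rfl⟩ := Submodule.mem_span_singleton.1 this
    exact ⟨Finsupp.single () r, 0, zero_mem _, by simp⟩
  · have hdy : bdry R y = 0 := map_eq_of_chainsIn (g := 0) (fun n σ hσ => by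
      cases n with
      | zero => exact bdry_gen_zero R σ
      | succ n => exact (hσ (vtx 0)).elim) hy
    rw [hdy, sub_zero, Submodule.mem_bot, Finsupp.linearCombination_unique] at h
    ext
    simpa [gen] using h

end Singular

end

noncomputable section

/-! ### The relative homology of a ball modulo its punctured version -/

namespace Singular

variable {R : Type*} [Ring R]

section sphere

variable {K : ℕ}

/-- The punctured unit ball in the subspace of `ℝ^K` spanned by the first `k` basis vectors. -/
def puncturedBall (K k : ℕ) : Set (Fin K → ℝ) :=
  {x | x ∈ Metric.ball 0 1 ∧ (∀ i : Fin K, k ≤ i → x i = 0) ∧ ∃ i : Fin K, (i : ℕ) < k ∧ x i ≠ 0}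

/-- An open half of the punctured ball, slightly enlarged. It contains the points whose last
coordinate has sign `s`. -/
def halfSpace (K k : ℕ) (κ : Fin K) (s : ℝ) : Set (Fin K → ℝ) :=
  {x | 0 < s * x κ ∨ ∃ i : Fin K, (i : ℕ) < k ∧ x i ≠ 0}

theorem isOpen_halfSpace (k : ℕ) (κ : Fin K) (s : ℝ) : IsOpen (halfSpace K k κ s) := by
  have : halfSpace K k κ s =
      {x | 0 < s * x κ} ∪ ⋃ (i : Fin K) (_ : (i : ℕ) < k), {x | x i ≠ 0} := by
    ext x
    simp [halfSpace]
  rw [this]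
  exact (isOpen_lt continuous_const (continuous_const.mul (continuous_apply κ))).union
    (isOpen_iUnion fun i => isOpen_iUnion fun _ =>
      isOpen_ne_fun (continuous_apply i) continuous_const)

theorem isAcyclic_half {k : ℕ} (hk : k < K) {s : ℝ} (hs : s * s = 1) :
    IsAcyclic R (chainsIn R (puncturedBall K (k + 1) ∩ halfSpace K k ⟨k, hk⟩ s)) := by
  have hs1 : |s| = 1 := by
    rw [← sq_eq_sq₀ (abs_nonneg s) zero_le_one, sq_abs, pow_two, hs, one_pow]
  have hnorm : (Pi.single ⟨k, hk⟩ (s / 2) : Fin K → ℝ) ∈ Metric.ball (0 : Fin K → ℝ) 1 := by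
    rw [mem_ball_zero_iff, Pi.norm_single, norm_div, Real.norm_eq_abs, hs1]
    norm_num
  have hpos : 0 < s * (s / 2) := by rw [← mul_div_assoc, hs]; norm_num
  have hne : s / 2 ≠ 0 := by
    intro h
    rw [h, mul_zero] at hpos
    exact hpos.false
  refine isAcyclic_of_starConvex (a := Pi.single ⟨k, hk⟩ (s / 2)) ⟨⟨hnorm, fun i hi => ?_, ?_⟩, ?_⟩ ?_
  · exact Pi.single_eq_of_ne (by rintro rfl; simp at hi) _
  · exact ⟨⟨k, hk⟩, Nat.lt_succ_self k, by simpa using hne⟩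
  · exact Or.inl (by simpa using hpos)
  · rintro x ⟨⟨hxb, hx0, -⟩, hx⟩ u v hu hv huv
    have hhalf : u • Pi.single ⟨k, hk⟩ (s / 2) + v • x ∈ halfSpace K k ⟨k, hk⟩ s := by
      rcases hx with hx | ⟨i, hik, hi⟩
      · left
        simp only [Pi.add_apply, Pi.smul_apply, Pi.single_eq_same, smul_eq_mul]
        rcases hv.eq_or_lt with rfl | hv
        · obtain rfl : u = 1 := by linarith
          simpa using hpos
        · have := mul_pos hv hx
          have := mul_nonneg hu hpos.le
          nlinarith
      · rcases hv.eq_or_lt with rfl | hv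
        · obtain rfl : u = 1 := by linarith
          left
          simpa using hpos
        · right
          refine ⟨i, hik, ?_⟩
          have : i ≠ ⟨k, hk⟩ := by rintro rfl; simp at hik
          simp [Pi.single_eq_of_ne this, hv.ne', hi]
    refine ⟨⟨convex_ball _ _ hnorm hxb hu hv huv, fun i hi => ?_, ?_⟩, hhalf⟩
    · have : i ≠ ⟨k, hk⟩ := by rintro rfl; simp at hi
      simp [Pi.single_eq_of_ne this, hx0 i hi]
    · rcases hhalf with h | ⟨i, hik, hi⟩
      · refine ⟨⟨k, hk⟩, Nat.lt_succ_self k, fun h0 => ?_⟩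
        rw [h0, mul_zero] at h
        exact h.false
      · exact ⟨i, hik.trans (Nat.lt_succ_self k), hi⟩

/-- The two halves of a punctured ball intersect in a thickened equator, which retracts to the
punctured ball of dimension one less by setting the last coordinate to zero. -/
theorem isRetract_equator {k : ℕ} (hk : k < K) :
    IsRetract (chainsIn R ((puncturedBall K (k + 1) ∩ halfSpace K k ⟨k, hk⟩ 1) ∩
      (puncturedBall K (k + 1) ∩ halfSpace K k ⟨k, hk⟩ (-1)))) (chainsIn R (puncturedBall K k)) := by
  have hmem : ∀ x ∈ (puncturedBall K (k + 1) ∩ halfSpace K k ⟨k, hk⟩ 1) ∩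
      (puncturedBall K (k + 1) ∩ halfSpace K k ⟨k, hk⟩ (-1)),
      ∃ i : Fin K, (i : ℕ) < k ∧ x i ≠ 0 := by
    rintro x ⟨⟨-, hx⟩, -, hx'⟩
    rcases hx with hx | hx
    · rcases hx' with hx' | hx'
      · exact absurd hx' (by linarith)
      · exact hx'
    · exact hx
  have hball : ∀ (x : Fin K → ℝ), x ∈ Metric.ball 0 1 → ∀ t ∈ Set.Icc (0 : ℝ) 1,
      Function.update x ⟨k, hk⟩ ((1 - t) * x ⟨k, hk⟩) ∈ Metric.ball (0 : Fin K → ℝ) 1 := by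
    intro x hx t ht
    rw [mem_ball_zero_iff] at hx ⊢
    refine (pi_norm_lt_iff one_pos).2 fun i => ?_
    have := (norm_le_pi_norm x i).trans_lt hx
    rcases eq_or_ne i ⟨k, hk⟩ with rfl | hi
    · rw [Function.update_self, norm_mul]
      refine (mul_le_of_le_one_left (norm_nonneg _) ?_).trans_lt this
      rw [Real.norm_of_nonneg (sub_nonneg.2 ht.2)]
      linarith [ht.1]
    · rwa [Function.update_of_ne hi]
  refine isRetract_of_homotopy (fun x t => Function.update x ⟨k, hk⟩ ((1 - t) * x ⟨k, hk⟩))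
    (Continuous.continuousOn ?_) (fun x hx t ht => ?_) (fun x hx t ht => ?_) (fun x _ => by simp)
    (fun x hx => ?_)
  · exact continuous_fst.update _ ((continuous_const.sub continuous_snd).mul
      ((continuous_apply _).comp continuous_fst))
  · obtain ⟨i, hik, hi⟩ := hmem x hx
    have hne : i ≠ ⟨k, hk⟩ := by rintro rfl; simp at hik
    have hi' : Function.update x ⟨k, hk⟩ ((1 - t) * x ⟨k, hk⟩) i ≠ 0 := by
      rwa [Function.update_of_ne hne]
    have : Function.update x ⟨k, hk⟩ ((1 - t) * x ⟨k, hk⟩) ∈ puncturedBall K (k + 1) := by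
      refine ⟨hball x hx.1.1.1 t ht, fun j hj => ?_, i, hik.trans (Nat.lt_succ_self k), hi'⟩
      rw [Function.update_of_ne (by rintro rfl; simp at hj)]
      exact hx.1.1.2.1 j hj
    exact ⟨⟨this, Or.inr ⟨i, hik, hi'⟩⟩, this, Or.inr ⟨i, hik, hi'⟩⟩
  · have : Function.update x ⟨k, hk⟩ ((1 - t) * x ⟨k, hk⟩) = x := by
      rw [hx.2.1 ⟨k, hk⟩ le_rfl, mul_zero, ← hx.2.1 ⟨k, hk⟩ le_rfl, Function.update_eq_self]
    rwa [this]
  · obtain ⟨i, hik, hi⟩ := hmem x hx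
    have hne : i ≠ ⟨k, hk⟩ := by rintro rfl; simp at hik
    refine ⟨hball x hx.1.1.1 1 ⟨zero_le_one, le_rfl⟩, fun j hj => ?_, i, hik, ?_⟩
    · rcases eq_or_ne j ⟨k, hk⟩ with rfl | hj'
      · simp
      · rw [Function.update_of_ne hj']
        refine hx.1.1.2.1 j (Nat.succ_le_of_lt (lt_of_le_of_ne hj fun h => hj' (Fin.ext h.symm)))
    · rwa [Function.update_of_ne hne]

variable (R) in
/-- A punctured ball has the reduced homology of a sphere. The proof is by induction on the dimension,
by Mayer–Vietoris for two contractible half balls. -/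
theorem exists_isRelBasis_puncturedBall (K k : ℕ) (hk : k ≤ K) :
    ∃ c : Unit → Chain R (Sing (Fin K → ℝ)), IsRelBasis (chainsIn R (puncturedBall K k)) ⊥ k c := by
  induction k with
  | zero =>
    have : puncturedBall K 0 = ∅ := Set.eq_empty_of_forall_notMem fun x ⟨_, _, i, hi, _⟩ => by
      simp at hi
    rw [this]
    exact ⟨_, isRelBasis_empty⟩
  | succ k ih =>
    have hk' : k < K := hk
    obtain ⟨c, hc⟩ := ih hk'.le
    have hsub : puncturedBall K k ⊆ (puncturedBall K (k + 1) ∩ halfSpace K k ⟨k, hk⟩ 1) ∩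
        (puncturedBall K (k + 1) ∩ halfSpace K k ⟨k, hk⟩ (-1)) := by
      rintro x ⟨hx, hx0, i, hik, hi⟩
      have : x ∈ puncturedBall K (k + 1) :=
        ⟨hx, fun j hj => hx0 j (by omega), i, by omega, hi⟩
      exact ⟨⟨this, Or.inr ⟨i, hik, hi⟩⟩, this, Or.inr ⟨i, hik, hi⟩⟩
    have hc' := hc.of_isRetract (chainsIn_mono R hsub) (isRetract_equator hk')
    rw [chainsIn_inter] at hc'
    refine hc'.exists_of_isAcyclic_of_isAcyclic (isSubcomplex_chainsIn _) (isSubcomplex_chainsIn _)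
      (isAcyclic_half hk' (one_mul 1)) (isAcyclic_half hk' (by norm_num))
      (chainsIn_mono R Set.inter_subset_left) (chainsIn_mono R Set.inter_subset_left)
      fun w hw hdw => exists_small R (isOpen_halfSpace k _ 1) (isOpen_halfSpace k _ (-1))
        ?_ hw hdw
    rintro x ⟨-, -, i, hik, hi⟩
    rcases Nat.lt_succ_iff_lt_or_eq.1 hik with hik | hik
    · exact Or.inl (Or.inr ⟨i, hik, hi⟩)
    · obtain rfl : i = ⟨k, hk⟩ := Fin.ext hik
      rcases lt_or_gt_of_ne hi with hi | hi
      · exact Or.inr (Or.inl (by linarith))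
      · exact Or.inl (Or.inl (by linarith))

variable (R) in
/-- The homology of the unit ball modulo the punctured ball is free on one class. -/
theorem exists_isRelBasis_ball (K : ℕ) :
    ∃ c : Unit → Chain R (Sing (Fin K → ℝ)), IsRelBasis (chainsIn R (Metric.ball 0 1))
      (chainsIn R (Metric.ball 0 1 \ {0})) (K + 1) c := by
  have : puncturedBall K K = Metric.ball 0 1 \ {0} := by
    ext x
    simp only [puncturedBall, Set.mem_ofPred_eq, Set.mem_sdiff, Set.mem_singleton_iff]
    refine and_congr_right fun _ => ⟨?_, fun h => ?_⟩
    · rintro ⟨-, i, -, hi⟩ rfl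
      exact hi rfl
    · obtain ⟨i, hi⟩ := Function.ne_iff.1 h
      exact ⟨fun j hj => absurd j.2 (not_lt.2 hj), i, i.2, hi⟩
  obtain ⟨c, hc⟩ := exists_isRelBasis_puncturedBall R K K le_rfl
  rw [this] at hc
  have h0 : (0 : Fin K → ℝ) ∈ Metric.ball (0 : Fin K → ℝ) 1 := Metric.mem_ball_self one_pos
  exact hc.exists_of_isAcyclic (isSubcomplex_chainsIn _)
    (isAcyclic_of_starConvex h0 ((convex_ball _ _).starConvex h0))
    (chainsIn_mono R Set.sdiff_subset)

end sphere

/-! ### Transport of bases, and disjoint unions -/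

section transport

variable {X Y : Type*} [TopologicalSpace X] [TopologicalSpace Y]

theorem homogPart_funMap (f : X → Y) (d : ℕ) (c : Chain R (Sing X)) :
    homogPart R d (funMap R f c) = funMap R f (homogPart R d c) := by
  refine LinearMap.congr_fun (f := homogPart R d ∘ₗ funMap R f) (g := funMap R f ∘ₗ homogPart R d)
    (chain_hom_ext fun n σ => ?_) c
  rw [LinearMap.comp_apply, LinearMap.comp_apply, homogPart_gen]
  by_cases h : Continuous fun x => f (σ x)
  · rw [funMap_gen R σ h, homogPart_gen]
    split_ifs
    · rw [funMap_gen R σ h]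
    · rw [map_zero]
  · have h0 : funMap R f (gen R σ) = 0 := by rw [funMap, extend_gen, dif_neg h]
    rw [h0, map_zero]
    split_ifs
    · rw [h0]
    · rw [map_zero]

theorem funMap_funMap_eq_self {f : X → Y} {g : Y → X} {S : Set X} (hf : ContinuousOn f S)
    (h : ∀ x ∈ S, g (f x) = x) {c : Chain R (Sing X)} (hc : c ∈ chainsIn R S) :
    funMap R g (funMap R f c) = c := by
  refine map_eq_of_chainsIn (f := funMap R g ∘ₗ funMap R f) (g := LinearMap.id)
    (fun n σ hσ => ?_) hc
  have he : ∀ x, g (f (σ x)) = σ x := fun x => h _ (hσ x)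
  rw [LinearMap.comp_apply, funMap_gen R σ (hf.comp_continuous σ.continuous hσ)]
  refine (funMap_gen R _ ?_).trans ?_
  · change Continuous fun x => g (f (σ x))
    simp only [he]
    exact σ.continuous
  · exact congrArg (fun τ : Sing X n => gen R τ) (ContinuousMap.ext he)

/-- Homeomorphic pairs have the same homology. -/
theorem IsRelBasis.funMap {f : X → Y} {g : Y → X} {S T : Set X} {S' T' : Set Y} {d : ℕ}
    {ι : Type*} {b : ι → Chain R (Sing X)} (hb : IsRelBasis (chainsIn R S) (chainsIn R T) d b)
    (hf : ContinuousOn f S) (hg : ContinuousOn g S') (hS : Set.MapsTo f S S')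
    (hT : Set.MapsTo f T T') (hS' : Set.MapsTo g S' S) (hT' : Set.MapsTo g T' T)
    (hgf : ∀ x ∈ S, g (f x) = x) (hfg : ∀ y ∈ S', f (g y) = y) :
    IsRelBasis (chainsIn R S') (chainsIn R T') d fun i => funMap R f (b i) := by
  have hlin : ∀ r : ι →₀ R, Finsupp.linearCombination R (fun i => Singular.funMap R f (b i)) r =
      Singular.funMap R f (Finsupp.linearCombination R b r) := fun r =>
    (Finsupp.apply_linearCombination R (Singular.funMap R f) b r).symm
  refine ⟨fun i => ?_, fun i => funMap_mem R hS (hb.mem i), fun i => ?_, fun z hz hdz => ?_,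
    fun r y hy h => ?_⟩
  · rw [IsHomog, homogPart_funMap, hb.homog i]
  · rw [bdry_funMap R hf (hb.mem i)]
    exact funMap_mem R hT (hb.bdry_mem i)
  · obtain ⟨r, y, hy, h⟩ := hb.span (Singular.funMap R g z) (funMap_mem R hS' hz) (by
      rw [bdry_funMap R hg hz]
      exact funMap_mem R hT' hdz)
    refine ⟨r, Singular.funMap R f y, funMap_mem R hS hy, ?_⟩
    have := funMap_mem R hT h
    rwa [map_sub, map_sub, funMap_funMap_eq_self hg hfg hz, ← bdry_funMap R hf hy, ← hlin] at this
  · refine hb.indep r (Singular.funMap R g y) (funMap_mem R hS' hy) ?_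
    have := funMap_mem R hT' h
    rwa [map_sub, hlin, funMap_funMap_eq_self hf hgf (linearCombination_mem hb.mem r),
      ← bdry_funMap R hg hy] at this

end transport

section disjoint

variable {X : Type*} [TopologicalSpace X]

open Classical in
variable (R) in
/-- The part of a chain formed by the nonempty singular simplices in `A`. -/
def partIn (A : Set X) : Chain R (Sing X) →ₗ[R] Chain R (Sing X) :=
  extend R (G := Sing X) fun n σ => if n ≠ 0 ∧ ∀ t, σ t ∈ A then gen R σ else 0

theorem partIn_mem {A B : Set X} {c : Chain R (Sing X)} (hc : c ∈ chainsIn R B) :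
    partIn R A c ∈ chainsIn R (A ∩ B) := by
  refine map_mem_of_chainsIn (fun n σ hσ => ?_) hc
  rw [partIn, extend_gen]
  split_ifs with h
  · exact gen_mem_chainsIn R fun t => ⟨h.2 t, hσ t⟩
  · exact zero_mem _

theorem partIn_eq_zero {A B : Set X} (h : Disjoint A B) {c : Chain R (Sing X)}
    (hc : c ∈ chainsIn R B) : partIn R A c = 0 := by
  refine map_eq_of_chainsIn (g := 0) (fun n σ hσ => ?_) hc
  rw [partIn, extend_gen, if_neg]
  · rfl
  · rintro ⟨hn, hA⟩
    obtain ⟨n, rfl⟩ := Nat.exists_eq_succ_of_ne_zero hn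
    exact Set.disjoint_left.1 h (hA (vtx 0)) (hσ (vtx 0))

theorem sub_partIn_mem {A : Set X} {c : Chain R (Sing X)} (hc : c ∈ chainsIn R A) :
    c - partIn R A c ∈ chainsIn R (∅ : Set X) := by
  refine map_mem_of_chainsIn (f := LinearMap.id - partIn R A) (fun n σ hσ => ?_) hc
  rw [LinearMap.sub_apply, LinearMap.id_apply, partIn, extend_gen]
  split_ifs with h
  · rw [sub_self]
    exact zero_mem _
  · obtain rfl : n = 0 := by
      by_contra hn
      exact h ⟨hn, hσ⟩
    rw [sub_zero]
    exact gen_mem_chainsIn R fun t => by simpa using t.2.2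

/-- A chain in a disjoint union of relatively open subsets is a sum of chains in the subsets, up to
a multiple of the simplex without vertices. -/
theorem exists_eq_sum_of_disjoint {ι : Type*} {O V : ι → Set X} (hO : ∀ i, IsOpen (O i))
    (hVO : ∀ i, V i = (⋃ j, V j) ∩ O i) (hdisj : Pairwise (Function.onFun Disjoint V))
    {z : Chain R (Sing X)} (hz : z ∈ chainsIn R (⋃ i, V i)) :
    ∃ f : ι →₀ Chain R (Sing X), (∀ i, f i ∈ chainsIn R (V i)) ∧
      z - f.sum (fun _ c => c) ∈ chainsIn R (∅ : Set X) := by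
  have : z ∈ (⨆ i, chainsIn R (V i)) ⊔ chainsIn R (∅ : Set X) := by
    refine map_mem_of_chainsIn (f := LinearMap.id) (fun n σ hσ => ?_) hz
    rcases n with - | n
    · exact Submodule.mem_sup_right (gen_mem_chainsIn R fun t => by simpa using t.2.2)
    · refine Submodule.mem_sup_left ?_
      obtain ⟨i, hi⟩ := Set.mem_iUnion.1 (hσ (vtx 0))
      refine Submodule.mem_iSup_of_mem i (gen_mem_chainsIn R fun t => ?_)
      have hopen : ∀ j, IsOpen (σ ⁻¹' V j) := fun j => by
        rw [hVO j, Set.preimage_inter]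
        convert (hO j).preimage σ.continuous using 1
        exact Set.inter_eq_right.2 fun t _ => hσ t
      have hconn : _root_.IsPreconnected (Set.univ : Set (Splx (n + 1))) :=
        (Subtype.preconnectedSpace
          (convex_stdSimplex ℝ (Fin (n + 1))).isPreconnected).isPreconnected_univ
      have hsub := hconn.subset_left_of_subset_union (u := σ ⁻¹' V i)
        (v := ⋃ j, ⋃ (_ : j ≠ i), σ ⁻¹' V j) (hopen i)
        (isOpen_iUnion fun j => isOpen_iUnion fun (_ : j ≠ i) => hopen j) ?_ ?_
        ⟨vtx 0, Set.mem_univ _, hi⟩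
      · exact hsub (Set.mem_univ t)
      · refine Set.disjoint_left.2 fun s hs hs' => ?_
        obtain ⟨j, hj, hsj⟩ := Set.mem_iUnion₂.1 hs'
        exact Set.disjoint_left.1 (hdisj hj) hsj hs
      · intro s _
        obtain ⟨j, hj⟩ := Set.mem_iUnion.1 (hσ s)
        rcases eq_or_ne j i with rfl | hji
        · exact Or.inl hj
        · exact Or.inr (Set.mem_iUnion₂.2 ⟨j, hji, hj⟩)
  obtain ⟨a, ha, e, he, rfl⟩ := Submodule.mem_sup.1 this
  obtain ⟨f, hf, rfl⟩ := (Submodule.mem_iSup_iff_exists_finsupp _ _).1 ha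
  exact ⟨f, hf, by simpa using he⟩

/-- Up to the simplex without vertices, `partIn R (V i)` projects onto the chains in `V i`. -/
theorem sub_partIn_sum_mem {ι : Type*} {V : ι → Set X}
    (hdisj : Pairwise (Function.onFun Disjoint V)) {f : ι →₀ Chain R (Sing X)}
    (hf : ∀ i, f i ∈ chainsIn R (V i)) (i : ι) :
    f i - partIn R (V i) (f.sum fun _ c => c) ∈ chainsIn R (∅ : Set X) := by
  have : partIn R (V i) (f.sum fun _ c => c) = partIn R (V i) (f i) := by
    rw [Finsupp.sum, map_sum, Finset.sum_eq_single i]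
    · intro j _ hj
      exact partIn_eq_zero (hdisj hj.symm) (hf j)
    · intro hi
      rw [Finsupp.notMem_support_iff.1 hi, map_zero]
  rw [this]
  exact sub_partIn_mem (hf i)

theorem bdry_partIn_sub_mem {ι : Type*} {O V : ι → Set X} (hO : ∀ i, IsOpen (O i))
    (hVO : ∀ i, V i = (⋃ j, V j) ∩ O i) (hdisj : Pairwise (Function.onFun Disjoint V))
    {z : Chain R (Sing X)} (hz : z ∈ chainsIn R (⋃ i, V i)) (i : ι) :
    bdry R (partIn R (V i) z) - partIn R (V i) (bdry R z) ∈ chainsIn R (∅ : Set X) := by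
  obtain ⟨f, hf, he⟩ := exists_eq_sum_of_disjoint hO hVO hdisj hz
  have h1 := sub_partIn_sum_mem hdisj (f := f.mapRange (bdry R) (map_zero _))
    (fun j => bdry_mem R (hf j)) i
  have h2 := bdry_mem R (sub_partIn_sum_mem hdisj hf i)
  have h3 := partIn_mem (A := V i) (bdry_mem R he)
  have h4 := bdry_mem R (partIn_mem (A := V i) he)
  rw [Set.inter_empty] at h3 h4
  have hs : (f.mapRange (bdry R) (map_zero _)).sum (fun _ c => c) =
      bdry R (f.sum fun _ c => c) := by
    rw [Finsupp.sum_mapRange_index (fun _ => rfl), Finsupp.sum, Finsupp.sum, map_sum]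
  rw [hs, Finsupp.mapRange_apply] at h1
  have := add_mem (sub_mem h4 h3) (sub_mem h1 h2)
  simp only [map_sub] at this
  convert this using 1
  abel

/-- Relative homology of a disjoint union of relatively open pieces is the direct sum of the relative
homologies of the pieces. -/
theorem IsRelBasis.of_disjoint {ι : Type*} {O V : ι → Set X} {U : Set X} {d : ℕ}
    {b : ι → Chain R (Sing X)} (hO : ∀ i, IsOpen (O i)) (hVO : ∀ i, V i = (⋃ j, V j) ∩ O i)
    (hdisj : Pairwise (Function.onFun Disjoint V))
    (hb : ∀ i, IsRelBasis (chainsIn R (V i)) (chainsIn R (V i ∩ U)) d fun _ : Unit => b i) :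
    IsRelBasis (chainsIn R (⋃ i, V i)) (chainsIn R ((⋃ i, V i) ∩ U)) d b := by
  classical
  have hemp : ∀ A : Set X, chainsIn R (∅ : Set X) ≤ chainsIn R A := fun A =>
    chainsIn_mono R (Set.empty_subset A)
  have hle : ∀ i, chainsIn R (V i) ≤ chainsIn R (⋃ j, V j) := fun i =>
    chainsIn_mono R (Set.subset_iUnion V i)
  have hle' : ∀ i, chainsIn R (V i ∩ U) ≤ chainsIn R ((⋃ j, V j) ∩ U) := fun i =>
    chainsIn_mono R (Set.inter_subset_inter_left U (Set.subset_iUnion V i))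
  refine ⟨fun i => (hb i).homog (), fun i => hle i ((hb i).mem ()),
    fun i => hle' i ((hb i).bdry_mem ()), fun z hz hdz => ?_, fun r y hy h => ?_⟩
  · have hloc : ∀ i, ∃ r : R, ∃ y ∈ chainsIn R (V i),
        partIn R (V i) z - bdry R y - r • b i ∈ chainsIn R (V i ∩ U) := by
      intro i
      have hzi : partIn R (V i) z ∈ chainsIn R (V i) :=
        chainsIn_mono R Set.inter_subset_left (partIn_mem hz)
      obtain ⟨r, y, hy, h⟩ := (hb i).span _ hzi (by
        have h1 := hemp (V i ∩ U) (bdry_partIn_sub_mem hO hVO hdisj hz i)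
        have h2 : partIn R (V i) (bdry R z) ∈ chainsIn R (V i ∩ U) :=
          chainsIn_mono R (Set.inter_subset_inter_right _ Set.inter_subset_right) (partIn_mem hdz)
        have := add_mem h1 h2
        rwa [sub_add_cancel] at this)
      exact ⟨r (), y, hy, by rwa [Finsupp.linearCombination_unique] at h⟩
    choose r y hy h using hloc
    obtain ⟨f, hf, he⟩ := exists_eq_sum_of_disjoint hO hVO hdisj hz
    refine ⟨∑ i ∈ f.support, Finsupp.single i (r i), ∑ i ∈ f.support, y i,
      Submodule.sum_mem _ fun i _ => hle i (hy i), ?_⟩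
    have h1 : ∀ i ∈ f.support, f i - bdry R (y i) - r i • b i ∈ chainsIn R ((⋃ j, V j) ∩ U) := by
      intro i _
      have h2 := sub_partIn_sum_mem hdisj hf i
      have h3 : partIn R (V i) (z - f.sum fun _ c => c) ∈ chainsIn R (∅ : Set X) := by
        have := partIn_mem (A := V i) he
        rwa [Set.inter_empty] at this
      rw [map_sub] at h3
      have := add_mem (hle' i (h i)) (hemp _ (sub_mem h2 h3))
      convert this using 1
      abel
    have := add_mem (Submodule.sum_mem _ h1) (hemp _ he)
    convert this using 1
    simp only [map_sum, Finsupp.linearCombination_single, Finset.sum_sub_distrib, Finsupp.sum]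
    abel
  · ext i
    have hyi : partIn R (V i) y ∈ chainsIn R (V i) :=
      chainsIn_mono R Set.inter_subset_left (partIn_mem hy)
    have hri := (hb i).indep (Finsupp.single () (r i)) _ hyi (by
      rw [Finsupp.linearCombination_single]
      have h1 : partIn R (V i) (Finsupp.linearCombination R b r) = r i • partIn R (V i) (b i) := by
        rw [Finsupp.linearCombination_apply, Finsupp.sum, map_sum, Finset.sum_eq_single i]
        · rw [map_smul]
        · intro j _ hj
          rw [map_smul, partIn_eq_zero (hdisj hj.symm) ((hb j).mem ()), smul_zero]
        · intro hi
          rw [Finsupp.notMem_support_iff.1 hi, zero_smul, map_zero]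
      have h2 : partIn R (V i) (Finsupp.linearCombination R b r - bdry R y) ∈
          chainsIn R (V i ∩ U) :=
        chainsIn_mono R (Set.inter_subset_inter_right _ Set.inter_subset_right) (partIn_mem h)
      rw [map_sub, h1] at h2
      have h3 := Submodule.smul_mem _ (r i) (sub_partIn_mem ((hb i).mem ()))
      have h4 := bdry_partIn_sub_mem hO hVO hdisj hy i
      have := add_mem h2 (hemp (V i ∩ U) (sub_mem h3 h4))
      convert this using 1
      rw [smul_sub]
      abel)
    simpa using hri

end disjoint

end Singular

end

noncomputable section

/-! ### Attaching cells -/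

namespace Singular

section attachment

theorem image_closedBall {K : ℕ} {ι Z : Type*} (Φ : ι → (Fin K → ℝ) → Z) (i : ι) :
    Φ i '' Metric.closedBall 0 1 = Φ i '' Metric.ball 0 1 ∪ Φ i '' Metric.sphere 0 1 := by
  rw [← Set.image_union, Metric.ball_union_sphere]

variable {X : Type*} [TopologicalSpace X]

/-- `Y` is obtained from its closed subspace `A` by attaching `K`-dimensional cells with
characteristic maps `Φ i`, defined on the closed unit ball. -/
structure IsCellAttachment (A Y : Set X) {K : ℕ} {ι : Type*} (Φ : ι → (Fin K → ℝ) → X) :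
    Prop where
  continuousOn : ∀ i, ContinuousOn (Φ i) (Metric.closedBall 0 1)
  exists_inverse : ∀ i, ∃ Ψ : X → (Fin K → ℝ), ContinuousOn Ψ (Φ i '' Metric.ball 0 1) ∧
    ∀ x ∈ Metric.ball 0 1, Ψ (Φ i x) = x
  mapsTo_sphere : ∀ i, ∀ x ∈ Metric.sphere 0 1, Φ i x ∈ A
  disjoint : Pairwise (Function.onFun Disjoint fun i => Φ i '' Metric.ball 0 1)
  disjoint_base : ∀ i, Disjoint (Φ i '' Metric.ball 0 1) A
  eq_union : Y = A ∪ ⋃ i, Φ i '' Metric.ball 0 1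
  isClosed_base : IsClosed A
  isClosed_of : ∀ S ⊆ Y, IsClosed (S ∩ A) →
    (∀ i, IsClosed (S ∩ Φ i '' Metric.closedBall 0 1)) → IsClosed S

/-- A function on a product with a locally compact space is continuous if it is continuous on the
pieces of a cover of the other factor that determines the topology. -/
theorem continuous_prod_of_cover {U I Z Q₀ D ι : Type*} [TopologicalSpace U] [TopologicalSpace I]
    [LocallyCompactSpace I] [TopologicalSpace Z] [TopologicalSpace Q₀] [TopologicalSpace D]
    (q₀ : Q₀ → U) (q : ι → D → U) (hsurj : ∀ u, (∃ x, q₀ x = u) ∨ ∃ i x, q i x = u)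
    (hcl : ∀ S : Set U, IsClosed (q₀ ⁻¹' S) → (∀ i, IsClosed (q i ⁻¹' S)) → IsClosed S)
    (g : U × I → Z) (h₀ : Continuous fun p : Q₀ × I => g (q₀ p.1, p.2))
    (h : ∀ i, Continuous fun p : D × I => g (q i p.1, p.2)) : Continuous g := by
  have hu : ∀ u, Continuous fun t => g (u, t) := fun u => by
    rcases hsurj u with ⟨x, rfl⟩ | ⟨i, x, rfl⟩
    · exact h₀.comp (Continuous.prodMk_right x)
    · exact (h i).comp (Continuous.prodMk_right x)
  let G : U → C(I, Z) := fun u => ⟨_, hu u⟩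
  have hG : Continuous G := continuous_iff_isClosed.2 fun S hS => hcl _
    (hS.preimage (ContinuousMap.curry ⟨_, h₀⟩).continuous)
    fun i => hS.preimage (ContinuousMap.curry ⟨_, h i⟩).continuous
  exact ContinuousMap.continuous_uncurry_of_continuous ⟨G, hG⟩

namespace IsCellAttachment

variable {A Y : Set X} {K : ℕ} {ι : Type*} {Φ : ι → (Fin K → ℝ) → X}

theorem injective (h : IsCellAttachment A Y Φ) {i j : ι} {x y : Fin K → ℝ}
    (hx : x ∈ Metric.ball 0 1) (hy : y ∈ Metric.ball 0 1) (e : Φ i x = Φ j y) : i = j ∧ x = y := by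
  obtain rfl : i = j := by
    by_contra hij
    exact Set.disjoint_left.1 (h.disjoint hij) ⟨x, hx, rfl⟩ ⟨y, hy, e.symm⟩
  obtain ⟨Ψ, -, hΨ⟩ := h.exists_inverse i
  exact ⟨rfl, by rw [← hΨ x hx, e, hΨ y hy]⟩

theorem base_subset (h : IsCellAttachment A Y Φ) : A ⊆ Y := by
  rw [h.eq_union]
  exact Set.subset_union_left

theorem image_ball_subset (h : IsCellAttachment A Y Φ) (i : ι) : Φ i '' Metric.ball 0 1 ⊆ Y := by
  rw [h.eq_union]
  exact (Set.subset_iUnion (fun i => Φ i '' Metric.ball 0 1) i).trans Set.subset_union_right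

theorem notMem_base (h : IsCellAttachment A Y Φ) {i : ι} {x : Fin K → ℝ}
    (hx : x ∈ Metric.ball 0 1) : Φ i x ∉ A :=
  Set.disjoint_left.1 (h.disjoint_base i) ⟨x, hx, rfl⟩

theorem mem_ball_of_notMem_base (h : IsCellAttachment A Y Φ) {i : ι} {x : Fin K → ℝ}
    (hx : x ∈ Metric.closedBall 0 1) (hA : Φ i x ∉ A) : x ∈ Metric.ball 0 1 := by
  rw [← Metric.ball_union_sphere] at hx
  exact hx.resolve_right fun hs => hA (h.mapsTo_sphere i x hs)

variable (Φ) in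
/-- The set of the centres of the cells. -/
def centers : Set X := Set.range fun i => Φ i 0

theorem zero_mem_ball : (0 : Fin K → ℝ) ∈ Metric.ball (0 : Fin K → ℝ) 1 :=
  Metric.mem_ball_self one_pos

theorem map_mem_centers_iff (h : IsCellAttachment A Y Φ) {i : ι} {x : Fin K → ℝ}
    (hx : x ∈ Metric.closedBall 0 1) : Φ i x ∈ centers Φ ↔ x = 0 := by
  constructor
  · rintro ⟨j, hj⟩
    have hA : Φ i x ∉ A := by
      rw [← show Φ j 0 = Φ i x from hj]
      exact h.notMem_base zero_mem_ball
    exact (h.injective zero_mem_ball (h.mem_ball_of_notMem_base hx hA) hj).2.symm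
  · rintro rfl
    exact ⟨i, rfl⟩

theorem disjoint_centers (h : IsCellAttachment A Y Φ) : Disjoint (centers Φ) A := by
  rw [Set.disjoint_left]
  rintro _ ⟨i, rfl⟩
  exact h.notMem_base zero_mem_ball

theorem base_subset_compl (h : IsCellAttachment A Y Φ) : A ⊆ Y ∩ (centers Φ)ᶜ := fun _ hx =>
  ⟨h.base_subset hx, fun hc => Set.disjoint_left.1 h.disjoint_centers hc hx⟩

theorem centers_subset (h : IsCellAttachment A Y Φ) : centers Φ ⊆ Y := by
  rintro _ ⟨i, rfl⟩
  exact h.image_ball_subset i ⟨0, zero_mem_ball, rfl⟩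

/-- The radial deformation of the punctured ball onto the sphere. -/
def radial (x : Fin K → ℝ) (t : ℝ) : Fin K → ℝ := (1 - t + t * ‖x‖⁻¹) • x

theorem norm_radial {x : Fin K → ℝ} (hx : x ≠ 0) {t : ℝ} (ht : t ∈ Set.Icc (0 : ℝ) 1) :
    ‖radial x t‖ = (1 - t) * ‖x‖ + t := by
  have : ‖x‖ ≠ 0 := norm_ne_zero_iff.2 hx
  rw [radial, norm_smul, Real.norm_of_nonneg, add_mul, mul_assoc, inv_mul_cancel₀ this, mul_one]
  have := sub_nonneg.2 ht.2
  have := ht.1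
  positivity

theorem radial_mem {x : Fin K → ℝ} (hx : x ≠ 0) (hx' : x ∈ Metric.closedBall 0 1) {t : ℝ}
    (ht : t ∈ Set.Icc (0 : ℝ) 1) : radial x t ∈ Metric.closedBall 0 1 ∧ radial x t ≠ 0 := by
  rw [mem_closedBall_zero_iff] at hx' ⊢
  have h0 := norm_pos_iff.2 hx
  rw [← norm_pos_iff, norm_radial hx ht]
  constructor
  · nlinarith [ht.1, ht.2]
  · rcases ht.1.eq_or_lt with rfl | h
    · simpa using h0
    · have := mul_nonneg (sub_nonneg.2 ht.2) h0.le
      linarith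

open Classical in
variable (Φ) in
/-- The deformation of the complement of the centres that pushes the cells radially to their
boundary. -/
def deform (y : X) (t : ℝ) : X :=
  if h : ∃ p : ι × (Fin K → ℝ), p.2 ∈ Metric.ball 0 1 ∧ Φ p.1 p.2 = y then
    Φ h.choose.1 (radial h.choose.2 t) else y

theorem deform_of_mem (h : IsCellAttachment A Y Φ) {y : X} (hy : y ∈ A) (t : ℝ) :
    deform Φ y t = y := by
  rw [deform, dif_neg]
  rintro ⟨p, hp, rfl⟩
  exact h.notMem_base hp hy

theorem deform_map (h : IsCellAttachment A Y Φ) (i : ι) {x : Fin K → ℝ}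
    (hx : x ∈ Metric.closedBall 0 1) (t : ℝ) : deform Φ (Φ i x) t = Φ i (radial x t) := by
  rw [← Metric.ball_union_sphere] at hx
  rcases hx with hx | hx
  · have hex : ∃ p : ι × (Fin K → ℝ), p.2 ∈ Metric.ball 0 1 ∧ Φ p.1 p.2 = Φ i x :=
      ⟨(i, x), hx, rfl⟩
    obtain ⟨h1, h2⟩ := h.injective hex.choose_spec.1 hx hex.choose_spec.2
    rw [deform, dif_pos hex, h1, h2]
  · rw [h.deform_of_mem (h.mapsTo_sphere i x hx)]
    congr 1
    rw [mem_sphere_zero_iff_norm] at hx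
    simp [radial, hx]

theorem exists_of_mem (h : IsCellAttachment A Y Φ) {y : X} (hy : y ∈ Y ∩ (centers Φ)ᶜ) :
    y ∈ A ∨ ∃ i, ∃ x ∈ Metric.closedBall 0 1, x ≠ 0 ∧ Φ i x = y := by
  obtain ⟨hy, hc⟩ := hy
  rw [h.eq_union] at hy
  rcases hy with hy | hy
  · exact Or.inl hy
  · obtain ⟨i, x, hx, rfl⟩ := Set.mem_iUnion.1 hy
    refine Or.inr ⟨i, x, Metric.ball_subset_closedBall hx, ?_, rfl⟩
    rintro rfl
    exact hc ⟨i, rfl⟩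

variable [T2Space X]

theorem isClosed_union_centers (h : IsCellAttachment A Y Φ) {S : Set X} (hSY : S ⊆ Y)
    (hSA : IsClosed (S ∩ A))
    (hS : ∀ i, ∃ T : Set (Fin K → ℝ), IsClosed T ∧ ∀ x ∈ Metric.closedBall 0 1, x ≠ 0 →
      (Φ i x ∈ S ↔ x ∈ T)) : IsClosed (S ∪ centers Φ) := by
  refine h.isClosed_of _ (Set.union_subset hSY h.centers_subset) ?_ fun i => ?_
  · rwa [Set.union_inter_distrib_right, h.disjoint_centers.inter_eq, Set.union_empty]
  · obtain ⟨T, hT, hTS⟩ := hS i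
    have : (S ∪ centers Φ) ∩ Φ i '' Metric.closedBall 0 1 =
        Φ i '' (Metric.closedBall 0 1 ∩ (T ∪ {0})) := by
      ext y
      constructor
      · rintro ⟨hy, x, hx, rfl⟩
        refine ⟨x, ⟨hx, ?_⟩, rfl⟩
        rcases eq_or_ne x 0 with h0 | h0
        · exact Or.inr h0
        · refine Or.inl ((hTS x hx h0).1 (hy.resolve_right fun hc => h0 ?_))
          exact (h.map_mem_centers_iff hx).1 hc
      · rintro ⟨x, ⟨hx, hxT⟩, rfl⟩
        refine ⟨?_, x, hx, rfl⟩
        rcases eq_or_ne x 0 with h0 | h0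
        · exact Or.inr ((h.map_mem_centers_iff hx).2 h0)
        · exact Or.inl ((hTS x hx h0).2 (hxT.resolve_right h0))
    rw [this]
    refine IsCompact.isClosed (IsCompact.image_of_continuousOn ?_
      ((h.continuousOn i).mono Set.inter_subset_left))
    exact (isCompact_closedBall 0 1).inter_right (hT.union isClosed_singleton)

theorem isClosed_of_subset_centers (h : IsCellAttachment A Y Φ) {S : Set X}
    (hS : S ⊆ centers Φ) : IsClosed S := by
  refine h.isClosed_of _ (hS.trans h.centers_subset) ?_ fun i => ?_
  · rw [(h.disjoint_centers.mono_left hS).inter_eq]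
    exact isClosed_empty
  · refine ((Set.finite_singleton (Φ i 0)).subset ?_).isClosed
    rintro _ ⟨hy, x, hx, rfl⟩
    rw [(h.map_mem_centers_iff hx).1 (hS hy)]
    rfl

theorem isClosed_sdiff (h : IsCellAttachment A Y Φ) (i : ι) :
    IsClosed (Y \ Φ i '' Metric.ball 0 1) := by
  refine h.isClosed_of _ Set.sdiff_subset ?_ fun j => ?_
  · convert h.isClosed_base using 1
    refine Set.inter_eq_right.2 fun x hx => ⟨h.base_subset hx, fun hx' => ?_⟩
    exact Set.disjoint_left.1 (h.disjoint_base i) hx' hx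
  · have hcc : ∀ j, Φ j '' Metric.closedBall 0 1 ⊆ Y := fun j => by
      rw [image_closedBall]
      rintro y (hy | ⟨x, hx, rfl⟩)
      · exact h.image_ball_subset j hy
      · exact h.base_subset (h.mapsTo_sphere j x hx)
    rcases eq_or_ne j i with rfl | hij
    · have : (Y \ Φ j '' Metric.ball 0 1) ∩ Φ j '' Metric.closedBall 0 1 =
          Φ j '' Metric.sphere 0 1 := by
        rw [image_closedBall]
        ext y
        constructor
        · rintro ⟨⟨-, hy⟩, hy'⟩
          exact hy'.resolve_left hy
        · rintro ⟨x, hx, rfl⟩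
          have hA := h.mapsTo_sphere j x hx
          exact ⟨⟨h.base_subset hA, fun hb => Set.disjoint_left.1 (h.disjoint_base j) hb hA⟩,
            Or.inr ⟨x, hx, rfl⟩⟩
      rw [this]
      exact ((isCompact_sphere 0 1).image_of_continuousOn
        ((h.continuousOn j).mono Metric.sphere_subset_closedBall)).isClosed
    · have : (Y \ Φ i '' Metric.ball 0 1) ∩ Φ j '' Metric.closedBall 0 1 =
          Φ j '' Metric.closedBall 0 1 := by
        refine Set.inter_eq_right.2 fun y hy => ⟨hcc j hy, fun hyi => ?_⟩
        rw [image_closedBall] at hy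
        rcases hy with hy | ⟨x, hx, rfl⟩
        · exact Set.disjoint_left.1 (h.disjoint hij) hy hyi
        · exact Set.disjoint_left.1 (h.disjoint_base i) hyi (h.mapsTo_sphere j x hx)
      rw [this]
      exact ((isCompact_closedBall 0 1).image_of_continuousOn (h.continuousOn j)).isClosed

theorem continuousOn_deform (h : IsCellAttachment A Y Φ) :
    ContinuousOn (fun p : X × ℝ => deform Φ p.1 p.2)
      ((Y ∩ (centers Φ)ᶜ) ×ˢ Set.Icc (0 : ℝ) 1) := by
  have hmap : ∀ i, ∀ x ∈ Metric.closedBall 0 1, x ≠ 0 → Φ i x ∈ Y ∩ (centers Φ)ᶜ := by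
    intro i x hx h0
    refine ⟨?_, fun hc => h0 ((h.map_mem_centers_iff hx).1 hc)⟩
    by_cases hA : Φ i x ∈ A
    · exact h.base_subset hA
    · exact h.image_ball_subset i ⟨x, h.mem_ball_of_notMem_base hx hA, rfl⟩
  have key : Continuous fun p : ↥(Y ∩ (centers Φ)ᶜ) × ↥(Set.Icc (0 : ℝ) 1) =>
      deform Φ p.1 p.2 := by
    refine continuous_prod_of_cover (Q₀ := A)
      (D := ↥(Metric.closedBall (0 : Fin K → ℝ) 1 \ {0}))
      (fun a => (⟨a, h.base_subset_compl a.2⟩ : ↥(Y ∩ (centers Φ)ᶜ)))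
      (fun i x => ⟨Φ i x, hmap i x x.2.1 x.2.2⟩) (fun u => ?_) (fun S hSA hS => ?_) _ ?_ fun i => ?_
    · rcases h.exists_of_mem u.2 with hA | ⟨i, x, hx, h0, e⟩
      · exact Or.inl ⟨⟨u, hA⟩, rfl⟩
      · exact Or.inr ⟨i, ⟨x, hx, h0⟩, Subtype.ext e⟩
    · have hcl : IsClosed ((Subtype.val '' S) ∪ centers Φ) := by
        refine h.isClosed_union_centers (fun y hy => ?_) ?_ fun i => ?_
        · obtain ⟨s, -, rfl⟩ := hy
          exact s.2.1
        · convert h.isClosed_base.isClosedEmbedding_subtypeVal.isClosedMap _ hSA using 1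
          ext y
          constructor
          · rintro ⟨⟨s, hs, rfl⟩, hA⟩
            exact ⟨⟨s, hA⟩, hs, rfl⟩
          · rintro ⟨a, ha, rfl⟩
            exact ⟨⟨_, ha, rfl⟩, a.2⟩
        · obtain ⟨T, hT, e⟩ := isClosed_induced_iff.1 (hS i)
          refine ⟨T, hT, fun x hx h0 => ?_⟩
          have := Set.ext_iff.1 e ⟨x, hx, h0⟩
          rw [Set.mem_preimage, Set.mem_preimage] at this
          rw [this]
          constructor
          · rintro ⟨s, hs, e'⟩
            rwa [show s = ⟨Φ i x, hmap i x hx h0⟩ from Subtype.ext e'] at hs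
          · intro hs
            exact ⟨_, hs, rfl⟩
      refine isClosed_induced_iff.2 ⟨_, hcl, ?_⟩
      ext y
      constructor
      · rintro (⟨s, hs, e⟩ | hc)
        · rwa [← Subtype.ext e]
        · exact absurd hc y.2.2
      · exact fun hy => Or.inl ⟨y, hy, rfl⟩
    · refine Continuous.congr (f := fun p : A × ↥(Set.Icc (0 : ℝ) 1) => (p.1 : X))
        (by fun_prop) fun p => ?_
      exact (h.deform_of_mem p.1.2 _).symm
    · refine Continuous.congr (f := fun p : ↥(Metric.closedBall (0 : Fin K → ℝ) 1 \ {0}) ×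
        ↥(Set.Icc (0 : ℝ) 1) => Φ i (radial p.1 p.2)) ?_ fun p => (h.deform_map i p.1.2.1 _).symm
      refine (h.continuousOn i).comp_continuous ?_ fun p => (radial_mem p.1.2.2 p.1.2.1 p.2.2).1
      have hx : Continuous fun p : ↥(Metric.closedBall (0 : Fin K → ℝ) 1 \ {0}) ×
        ↥(Set.Icc (0 : ℝ) 1) => (p.1 : Fin K → ℝ) := by fun_prop
      have ht : Continuous fun p : ↥(Metric.closedBall (0 : Fin K → ℝ) 1 \ {0}) ×
        ↥(Set.Icc (0 : ℝ) 1) => (p.2 : ℝ) := by fun_prop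
      exact ((continuous_const.sub ht).add
        (ht.mul (hx.norm.inv₀ fun p => norm_ne_zero_iff.2 p.1.2.2))).smul hx
  rw [continuousOn_iff_continuous_domRestrict]
  let e : ↥((Y ∩ (centers Φ)ᶜ) ×ˢ Set.Icc (0 : ℝ) 1) →
      ↥(Y ∩ (centers Φ)ᶜ) × ↥(Set.Icc (0 : ℝ) 1) := fun p => (⟨p.1.1, p.2.1⟩, ⟨p.1.2, p.2.2⟩)
  have he : Continuous e := by fun_prop
  exact key.comp he

variable {R : Type*} [Ring R]

theorem isRetract (h : IsCellAttachment A Y Φ) :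
    IsRetract (chainsIn R (Y ∩ (centers Φ)ᶜ)) (chainsIn R A) := by
  refine isRetract_of_homotopy (deform Φ) h.continuousOn_deform (fun y hy t ht => ?_)
    (fun y hy t _ => by rwa [h.deform_of_mem hy]) (fun y hy => ?_) (fun y hy => ?_)
  · rcases h.exists_of_mem hy with hA | ⟨i, x, hx, h0, rfl⟩
    · rwa [h.deform_of_mem hA]
    · obtain ⟨h1, h2⟩ := radial_mem h0 hx ht
      rw [h.deform_map i hx]
      refine ⟨?_, fun hc => h2 ((h.map_mem_centers_iff h1).1 hc)⟩
      by_cases hA : Φ i (radial x t) ∈ A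
      · exact h.base_subset hA
      · exact h.image_ball_subset i ⟨_, h.mem_ball_of_notMem_base h1 hA, rfl⟩
  · rcases h.exists_of_mem hy with hA | ⟨i, x, hx, h0, rfl⟩
    · rw [h.deform_of_mem hA]
    · rw [h.deform_map i hx]
      simp [radial]
  · rcases h.exists_of_mem hy with hA | ⟨i, x, hx, h0, rfl⟩
    · rwa [h.deform_of_mem hA]
    · rw [h.deform_map i hx]
      refine h.mapsTo_sphere i _ ?_
      rw [mem_sphere_zero_iff_norm, norm_radial h0 ⟨zero_le_one, le_rfl⟩]
      simp

variable (K R) in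
/-- A chain that represents a generator of the homology of the unit ball modulo the punctured
ball. -/
def ballChain : Chain R (Sing (Fin K → ℝ)) := (exists_isRelBasis_ball R K).choose ()

variable (K R) in
theorem isRelBasis_ballChain : IsRelBasis (chainsIn R (Metric.ball 0 1))
    (chainsIn R (Metric.ball 0 1 \ {0})) (K + 1) fun _ : Unit => ballChain K R :=
  (exists_isRelBasis_ball R K).choose_spec

/-- The homology of `Y` modulo the complement of the centres is free on the cells. -/
theorem isRelBasis_compl_centers (h : IsCellAttachment A Y Φ) :
    IsRelBasis (chainsIn R Y) (chainsIn R (Y ∩ (centers Φ)ᶜ)) (K + 1)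
      fun i => funMap R (Φ i) (ballChain K R) := by
  set e : ι → Set X := fun i => Φ i '' Metric.ball 0 1 with he
  set O : ι → Set X := fun i => (Y \ e i)ᶜ with hO
  have hOopen : ∀ i, IsOpen (O i) := fun i => (h.isClosed_sdiff i).isOpen_compl
  have heY : (⋃ i, e i) ⊆ Y := Set.iUnion_subset h.image_ball_subset
  have hYO : Y ∩ (⋃ i, O i) = ⋃ i, e i := by
    ext y
    constructor
    · rintro ⟨hy, hy'⟩
      obtain ⟨i, hi⟩ := Set.mem_iUnion.1 hy'
      exact Set.mem_iUnion.2 ⟨i, by_contra fun hn => hi ⟨hy, hn⟩⟩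
    · intro hy
      refine ⟨heY hy, ?_⟩
      obtain ⟨i, hi⟩ := Set.mem_iUnion.1 hy
      exact Set.mem_iUnion.2 ⟨i, fun hn => hn.2 hi⟩
  have heO : ∀ i, e i = (⋃ j, e j) ∩ O i := fun i => by
    ext y
    constructor
    · exact fun hy => ⟨Set.mem_iUnion.2 ⟨i, hy⟩, fun hn => hn.2 hy⟩
    · exact fun hy => by_contra fun hn => hy.2 ⟨heY hy.1, hn⟩
  have hcell : ∀ i, IsRelBasis (chainsIn R (e i)) (chainsIn R (e i ∩ (centers Φ)ᶜ)) (K + 1)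
      fun _ : Unit => funMap R (Φ i) (ballChain K R) := fun i => by
    obtain ⟨Ψ, hΨ, hΨΦ⟩ := h.exists_inverse i
    refine (isRelBasis_ballChain K R).funMap
      ((h.continuousOn i).mono Metric.ball_subset_closedBall) hΨ (Set.mapsTo_image _ _) ?_ ?_ ?_
      hΨΦ ?_
    · rintro x ⟨hx, h0⟩
      refine ⟨⟨x, hx, rfl⟩, fun hc => h0 ?_⟩
      exact (h.map_mem_centers_iff (Metric.ball_subset_closedBall hx)).1 hc
    · rintro _ ⟨x, hx, rfl⟩
      rwa [hΨΦ x hx]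
    · rintro _ ⟨⟨x, hx, rfl⟩, hc⟩
      rw [hΨΦ x hx]
      refine ⟨hx, fun h0 => hc ?_⟩
      exact (h.map_mem_centers_iff (Metric.ball_subset_closedBall hx)).2 h0
    · rintro _ ⟨x, hx, rfl⟩
      rw [hΨΦ x hx]
  have hV := IsRelBasis.of_disjoint hOopen heO h.disjoint hcell
  have hUV : (⋃ i, e i) ∩ (centers Φ)ᶜ = (Y ∩ (centers Φ)ᶜ) ∩ ⋃ i, e i := by
    ext y
    exact ⟨fun hy => ⟨⟨heY hy.1, hy.2⟩, hy.1⟩, fun hy => ⟨hy.2, hy.1.2⟩⟩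
  rw [hUV, chainsIn_inter] at hV
  refine hV.of_small (isSubcomplex_chainsIn _) (isSubcomplex_chainsIn _) (chainsIn_mono R heY)
    fun w hw hdw => ?_
  rw [← hYO] at hdw ⊢
  refine exists_small R (h.isClosed_of_subset_centers subset_rfl).isOpen_compl (isOpen_iUnion hOopen) (fun y hy => ?_)
    hw hdw
  by_cases hc : y ∈ centers Φ
  · obtain ⟨i, rfl⟩ := hc
    exact Or.inr (Set.mem_iUnion.2 ⟨i, fun hn => hn.2 ⟨0, zero_mem_ball, rfl⟩⟩)
  · exact Or.inl hc

/-- The homology of `Y` modulo `A` is free on the cells. -/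
theorem exists_isRelBasis (h : IsCellAttachment A Y Φ) :
    ∃ b : ι → Chain R (Sing X),
      (∀ i, b i - funMap R (Φ i) (ballChain K R) ∈ chainsIn R (Y ∩ (centers Φ)ᶜ)) ∧
      IsRelBasis (chainsIn R Y) (chainsIn R A) (K + 1) b :=
  h.isRelBasis_compl_centers.exists_of_isRetract (isSubcomplex_chainsIn _)
    (isSubcomplex_chainsIn _) (chainsIn_mono R h.base_subset_compl)
    (chainsIn_mono R Set.inter_subset_left) h.isRetract

end IsCellAttachment

end attachment

end Singular

end

noncomputable section

/-! ### Equivariant characteristic maps -/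

namespace GammaCW

open Singular Topology

variable {Γ Ω : Type u} [Group Γ] [TopologicalSpace Ω] [MulAction Γ Ω]
  [Topology.CWComplex (Set.univ : Set Ω)]

/-- The cells of dimension `k`. -/
abbrev Cell (Ω : Type u) [TopologicalSpace Ω] [Topology.CWComplex (Set.univ : Set Ω)] (k : ℕ) :
    Type u := Topology.CWComplex.cell (Set.univ : Set Ω) k

/-- The union of the cells of dimension less than `k`. -/
abbrev skel (Ω : Type u) [TopologicalSpace Ω] [T2Space Ω] [Topology.CWComplex (Set.univ : Set Ω)]
    (k : ℕ) : Set Ω := Topology.CWComplex.skeletonLT (Set.univ : Set Ω) k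

/-- The open cell of `σ`. -/
abbrev openCell {k : ℕ} (σ : Cell Ω k) : Set Ω :=
  Topology.CWComplex.openCell (C := (Set.univ : Set Ω)) k σ

theorem disjoint_openCell {k : ℕ} {σ τ : Cell Ω k} (h : σ ≠ τ) :
    Disjoint (openCell σ) (openCell τ) :=
  RelCWComplex.disjoint_openCell_of_ne (C := (Set.univ : Set Ω)) fun e => h (by simpa using e)

theorem openCell_injective (k : ℕ) : Function.Injective (openCell : Cell Ω k → Set Ω) := by
  intro σ τ h
  by_contra hne
  obtain ⟨x, hx⟩ := RelCWComplex.openCell_nonempty (C := (Set.univ : Set Ω)) k σ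
  exact Set.disjoint_left.1 (disjoint_openCell hne) hx (h ▸ hx)

section action

variable [hΩ : Fact (IsGammaCWComplex Γ Ω)] {k : ℕ}

instance : ContinuousConstSMul Γ Ω := ⟨hΩ.out.continuous_smul⟩

instance : SMul Γ (Cell Ω k) := ⟨fun g σ => (hΩ.out.exists_smul_openCell g k σ).choose⟩

theorem openCell_smul (g : Γ) (σ : Cell Ω k) : openCell (g • σ) = g • openCell σ :=
  (hΩ.out.exists_smul_openCell g k σ).choose_spec.symm

/-- The action on the set of cells induced by the action on the open cells. -/
instance : MulAction Γ (Cell Ω k) where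
  one_smul σ := openCell_injective k (by rw [openCell_smul, one_smul])
  mul_smul g g' σ := openCell_injective k (by simp only [openCell_smul, mul_smul])

theorem stabilizer_eq (σ : Cell Ω k) :
    MulAction.stabilizer Γ σ = cellStabilizer Γ σ := by
  ext g
  rw [MulAction.mem_stabilizer_iff, ← (openCell_injective k).eq_iff, openCell_smul]
  exact Iff.rfl

variable (Γ) in
/-- The chosen representative of the orbit of a cell. -/
def rep (σ : Cell Ω k) : Cell Ω k :=
  Quotient.out (Quotient.mk (MulAction.orbitRel Γ (Cell Ω k)) σ)

theorem rep_smul (g : Γ) (σ : Cell Ω k) : rep Γ (g • σ) = rep Γ σ :=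
  congrArg Quotient.out (Quotient.sound ⟨g, rfl⟩)

variable (Γ) in
theorem exists_smul_rep (σ : Cell Ω k) : ∃ g : Γ, g • rep Γ σ = σ := by
  obtain ⟨g, hg⟩ := Quotient.mk_out (s := MulAction.orbitRel Γ (Cell Ω k)) σ
  exact ⟨g⁻¹, inv_smul_eq_iff.2 hg.symm⟩

variable (Γ) in
/-- A group element that maps the representative of the orbit of a cell to the cell. -/
def transporter (σ : Cell Ω k) : Γ := (exists_smul_rep Γ σ).choose

variable (Γ) in
theorem transporter_smul (σ : Cell Ω k) : transporter Γ σ • rep Γ σ = σ :=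
  (exists_smul_rep Γ σ).choose_spec

variable (Γ) in
/-- The translates of the characteristic maps of the representatives of the orbits of cells. -/
def charMap (σ : Cell Ω k) (x : Fin k → ℝ) : Ω :=
  transporter Γ σ • RelCWComplex.map (C := (Set.univ : Set Ω)) k (rep Γ σ) x

theorem charMap_image_ball (σ : Cell Ω k) : charMap Γ σ '' Metric.ball 0 1 = openCell σ := by
  conv_rhs => rw [← transporter_smul Γ σ, openCell_smul]
  exact Set.image_comp (transporter Γ σ • ·)
    (RelCWComplex.map (C := (Set.univ : Set Ω)) k (rep Γ σ)) _

variable [T2Space Ω]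

theorem smul_eq_self {g : Γ} {σ : Cell Ω k} (h : g • σ = σ) {x : Ω}
    (hx : x ∈ RelCWComplex.closedCell (C := (Set.univ : Set Ω)) k σ) : g • x = x := by
  rw [← RelCWComplex.closure_openCell_eq_closedCell] at hx
  refine Set.EqOn.closure (f := fun x => g • x) (g := id) (fun x hx => ?_)
    (continuous_const_smul g) continuous_id hx
  exact hΩ.out.fixes_of_smul_openCell_eq g k σ (by rw [← openCell_smul, h]) x hx

theorem mem_skel_iff {m : ℕ} {x : Ω} :
    x ∈ skel Ω m ↔ ∃ j < m, ∃ σ : Cell Ω j, x ∈ openCell σ := by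
  refine Topology.CWComplex.mem_skeletonLT_iff.trans ⟨?_, ?_⟩
  · rintro ⟨j, hj, σ, hx⟩
    exact ⟨j, by exact_mod_cast hj, σ, hx⟩
  · rintro ⟨j, hj, σ, hx⟩
    exact ⟨j, by exact_mod_cast hj, σ, hx⟩

theorem smul_mem_skel {m : ℕ} (g : Γ) {x : Ω} (hx : x ∈ skel Ω m) : g • x ∈ skel Ω m := by
  obtain ⟨j, hj, σ, hσ⟩ := mem_skel_iff.1 hx
  exact mem_skel_iff.2 ⟨j, hj, g • σ, by rw [openCell_smul]; exact Set.smul_mem_smul_set hσ⟩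

theorem isClosed_skel (m : ℕ) : IsClosed (skel Ω m) := RelCWComplex.Subcomplex.closed _

theorem charMap_smul (g : Γ) (σ : Cell Ω k) {x : Fin k → ℝ} (hx : x ∈ Metric.closedBall 0 1) :
    charMap Γ (g • σ) x = g • charMap Γ σ x := by
  have key : ((g * transporter Γ σ)⁻¹ * transporter Γ (g • σ)) • rep Γ σ = rep Γ σ := by
    rw [mul_smul, inv_smul_eq_iff, mul_smul, transporter_smul, ← rep_smul g σ, transporter_smul]
  have := smul_eq_self key ⟨x, hx, rfl⟩
  rw [mul_smul, inv_smul_eq_iff, mul_smul] at this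
  rw [charMap, rep_smul]
  exact this

theorem charMap_image_closedBall (σ : Cell Ω k) : charMap Γ σ '' Metric.closedBall 0 1 =
    RelCWComplex.closedCell (C := (Set.univ : Set Ω)) k σ := by
  have h : openCell σ = transporter Γ σ • openCell (rep Γ σ) := by
    rw [← openCell_smul, transporter_smul]
  have h' := congrArg closure h
  rw [closure_smul, openCell, openCell, RelCWComplex.closure_openCell_eq_closedCell,
    RelCWComplex.closure_openCell_eq_closedCell] at h'
  rw [h']
  exact Set.image_comp (transporter Γ σ • ·)
    (RelCWComplex.map (C := (Set.univ : Set Ω)) k (rep Γ σ)) _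

theorem isCellAttachment_charMap (k : ℕ) :
    IsCellAttachment (skel Ω k) (skel Ω (k + 1)) (charMap Γ (Ω := Ω) (k := k)) where
  continuousOn σ := (RelCWComplex.continuousOn (C := (Set.univ : Set Ω)) k (rep Γ σ)).const_smul
    (transporter Γ σ)
  exists_inverse σ := by
    have hsrc := RelCWComplex.source_eq (C := (Set.univ : Set Ω)) k (rep Γ σ)
    refine ⟨fun y => (RelCWComplex.map (C := (Set.univ : Set Ω)) k (rep Γ σ)).symm
      ((transporter Γ σ)⁻¹ • y), ?_, fun x hx => ?_⟩
    · refine (RelCWComplex.continuousOn_symm (C := (Set.univ : Set Ω)) k (rep Γ σ)).comp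
        (continuous_const_smul _).continuousOn ?_
      rintro _ ⟨x, hx, rfl⟩
      rw [charMap, inv_smul_smul]
      exact PartialEquiv.map_source _ (by rwa [hsrc])
    · change (RelCWComplex.map (C := (Set.univ : Set Ω)) k (rep Γ σ)).symm
        ((transporter Γ σ)⁻¹ • transporter Γ σ • _) = x
      rw [inv_smul_smul]
      exact PartialEquiv.left_inv _ (by rwa [hsrc])
  mapsTo_sphere σ x hx := smul_mem_skel _
    (RelCWComplex.cellFrontier_subset_skeletonLT (C := (Set.univ : Set Ω)) k (rep Γ σ)
      ⟨x, hx, rfl⟩)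
  disjoint σ τ h := by
    simp only [Function.onFun, charMap_image_ball]
    exact disjoint_openCell h
  disjoint_base σ := by
    rw [charMap_image_ball]
    exact (RelCWComplex.disjoint_skeletonLT_openCell le_rfl).symm
  eq_union := by
    ext x
    simp only [charMap_image_ball, Set.mem_union, Set.mem_iUnion]
    rw [mem_skel_iff, mem_skel_iff]
    constructor
    · rintro ⟨j, hj, σ, hx⟩
      rcases Nat.lt_succ_iff_lt_or_eq.1 hj with hj | rfl
      · exact Or.inl ⟨j, hj, σ, hx⟩
      · exact Or.inr ⟨σ, hx⟩
    · rintro (⟨j, hj, σ, hx⟩ | ⟨σ, hx⟩)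
      · exact ⟨j, hj.trans (Nat.lt_succ_self k), σ, hx⟩
      · exact ⟨k, Nat.lt_succ_self k, σ, hx⟩
  isClosed_base := isClosed_skel k
  isClosed_of S hS hSA hSΦ := by
    refine CWComplex.isClosed_of_isClosed_inter_openCell_or_isClosed_inter_closedCell
      (C := (Set.univ : Set Ω)) (Set.subset_univ S) fun j _ τ => ?_
    rcases lt_trichotomy j k with hj | rfl | hj
    · right
      have : S ∩ RelCWComplex.closedCell j τ = (S ∩ skel Ω k) ∩ RelCWComplex.closedCell j τ := by
        rw [Set.inter_assoc]
        refine congrArg (S ∩ ·) (Set.inter_eq_right.2 ?_).symm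
        refine (RelCWComplex.closedCell_subset_skeletonLT j τ).trans
          (RelCWComplex.skeletonLT_mono ?_)
        exact_mod_cast hj
      rw [this]
      exact hSA.inter RelCWComplex.isClosed_closedCell
    · right
      rw [← charMap_image_closedBall (Γ := Γ)]
      exact hSΦ τ
    · left
      rw [Set.disjoint_iff_inter_eq_empty.1]
      · exact isClosed_empty
      · refine Set.disjoint_of_subset_left hS (RelCWComplex.disjoint_skeletonLT_openCell ?_)
        exact_mod_cast hj

end action

end GammaCW

end

noncomputable section

/-! ### The singular complex of a space with a group action, and its skeletal filtration -/

/-- The complex with the same module in every degree and the same endomorphism as every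
differential. -/
def constComplex {A : Type u} [Ring A] {M : Type u} [AddCommGroup M] [Module A M]
    (b : M →ₗ[A] M) (hb : ∀ x, b (b x) = 0) : ModComplex A where
  X _ := ModuleCat.of A M
  d i j := if i - 1 = j then ModuleCat.ofHom b else 0
  shape i j h := if_neg fun e => h (by simp [← e])
  d_comp_d' i j k hij hjk := by
    have hi : i - 1 = j := by simp at hij; omega
    have hj : j - 1 = k := by simp at hjk; omega
    rw [if_pos hi, if_pos hj, ← ModuleCat.ofHom_comp, ← ModuleCat.ofHom_zero]
    congr 1
    ext x
    exact hb x

theorem constComplex_d {A : Type u} [Ring A] {M : Type u} [AddCommGroup M] [Module A M]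
    (b : M →ₗ[A] M) (hb : ∀ x, b (b x) = 0) {i j : ℤ} (h : i - 1 = j) (x : M) :
    ((constComplex b hb).d i j).hom x = b x := by
  change (ModuleCat.Hom.hom (if i - 1 = j then ModuleCat.ofHom b else
    (0 : ModuleCat.of A M ⟶ ModuleCat.of A M))) x = b x
  rw [if_pos h]
  rfl

/-- A relation between `RΓ`-modules that is compatible with the module structures and assigns
exactly one element to every element is given by a linear map. -/
theorem exists_linearMap_of_rel {R Γ : Type u} [Ring R] [Group Γ] {M N : Type*} [AddCommGroup M]
    [Module (MonoidAlgebra R Γ) M] [AddCommGroup N] [Module (MonoidAlgebra R Γ) N]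
    (P : M → N → Prop) (hex : ∀ z, ∃ r, P z r) (huniq : ∀ z r r', P z r → P z r' → r = r')
    (hadd : ∀ z z' r r', P z r → P z' r' → P (z + z') (r + r'))
    (hsmul : ∀ (g : Γ) (s : R) z r, P z r →
      P ((MonoidAlgebra.single g s : MonoidAlgebra R Γ) • z)
        ((MonoidAlgebra.single g s : MonoidAlgebra R Γ) • r)) :
    ∃ p : M →ₗ[MonoidAlgebra R Γ] N, ∀ z, P z (p z) := by
  choose f hf using hex
  refine ⟨AddMonoidHom.toGroupRingLinearMap (AddMonoidHom.mk' f fun z z' => ?_) fun g s z => ?_, hf⟩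
  · exact huniq _ _ _ (hf _) (hadd _ _ _ _ (hf z) (hf z'))
  · exact huniq _ _ _ (hf _) (hsmul g s _ _ (hf z))

namespace Singular

variable {R : Type*} [Ring R]

/-- A relative cycle of a degree without relative homology is a relative boundary. -/
theorem IsRelBasis.exists_eq_add_bdry {X : Type*} [TopologicalSpace X] {A Y : Set X} {d e : ℕ}
    {ι : Type*} {b : ι → Chain R (Sing X)} (hb : IsRelBasis (chainsIn R Y) (chainsIn R A) e b)
    (hde : d ≠ e) {z : Chain R (Sing X)} (hz : z ∈ chainsIn R Y) (hd : IsHomog d z)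
    (hdz : bdry R z ∈ chainsIn R A) :
    ∃ x ∈ chainsIn R A, IsHomog d x ∧ ∃ y ∈ chainsIn R Y, IsHomog (d + 1) y ∧
      z = x + bdry R y := by
  obtain ⟨r, y, hy, h⟩ := hb.span z hz hdz
  refine ⟨_, homogPart_mem h d, isHomog_homogPart R d _, _, homogPart_mem hy (d + 1),
    isHomog_homogPart R _ _, ?_⟩
  have : homogPart R d (Finsupp.linearCombination R b r) = 0 := by
    rw [Finsupp.apply_linearCombination, Finsupp.linearCombination_apply]
    refine Finset.sum_eq_zero fun i _ => ?_
    change r i • homogPart R d (b i) = 0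
    rw [← hb.homog i, homogPart_homogPart, if_neg hde.symm, smul_zero]
  rw [map_sub, map_sub, this, sub_zero, homogPart_bdry, hd, sub_add_cancel]

variable (R) in
/-- The unaugmented differential: the simplex without vertices is left out. -/
def bdry₀ {X : Type*} [TopologicalSpace X] : Chain R (Sing X) →ₗ[R] Chain R (Sing X) :=
  bdry R - homogPart R 0 ∘ₗ bdry R

section

variable {X : Type*} [TopologicalSpace X]

theorem bdry₀_apply (c : Chain R (Sing X)) : bdry₀ R c = bdry R c - homogPart R 0 (bdry R c) := rfl

theorem bdry_homogPart_zero (c : Chain R (Sing X)) : bdry R (homogPart R 0 c) = 0 := by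
  suffices h : bdry R ∘ₗ homogPart R 0 = (0 : Chain R (Sing X) →ₗ[R] Chain R (Sing X)) from
    LinearMap.congr_fun h c
  refine chain_hom_ext fun n x => ?_
  rw [LinearMap.comp_apply, homogPart_gen]
  split_ifs with h
  · subst h
    exact bdry_gen_zero R x
  · exact map_zero _

theorem bdry₀_bdry₀ (c : Chain R (Sing X)) : bdry₀ R (bdry₀ R c) = 0 := by
  rw [bdry₀_apply, bdry₀_apply c, map_sub, bdry_bdry, bdry_homogPart_zero, sub_zero, map_zero,
    sub_zero]

theorem bdry₀_eq_bdry {d : ℕ} {c : Chain R (Sing X)} (hc : IsHomog (d + 2) c) :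
    bdry₀ R c = bdry R c := by
  rw [bdry₀_apply, homogPart_bdry, ← hc, homogPart_homogPart, if_neg (by omega), map_zero, sub_zero]

theorem bdry₀_eq_zero {c : Chain R (Sing X)} (hc : IsHomog 1 c) : bdry₀ R c = 0 := by
  rw [bdry₀_apply, homogPart_bdry, hc, sub_self]

theorem bdry₀_sub_bdry_mem (A : Set X) (c : Chain R (Sing X)) :
    bdry₀ R c - bdry R c ∈ chainsIn R A := by
  refine chainsIn_mono R (Set.empty_subset A) (mem_chainsIn_empty_iff.2 ?_)
  rw [bdry₀_apply, sub_sub_cancel_left, IsHomog, map_neg, homogPart_homogPart, if_pos rfl]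

theorem bdry₀_funMap {f : X → X} (hf : Continuous f) (c : Chain R (Sing X)) :
    bdry₀ R (funMap R f c) = funMap R f (bdry₀ R c) := by
  have hc : c ∈ chainsIn R (Set.univ : Set X) := by rw [chainsIn_univ]; trivial
  rw [bdry₀_apply, bdry₀_apply, bdry_funMap R hf.continuousOn hc, homogPart_funMap, map_sub]

variable (R X) in
/-- The chains of degree `j` of the unaugmented singular complex: the simplices of dimension `j`
have `j + 1` vertices. -/
def homogAt (j : ℤ) : Submodule R (Chain R (Sing X)) :=
  if 0 ≤ j then LinearMap.eqLocus (homogPart R (j.toNat + 1)) LinearMap.id else ⊥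

theorem mem_homogAt_natCast {j : ℕ} {c : Chain R (Sing X)} :
    c ∈ homogAt R X j ↔ IsHomog (j + 1) c := by
  rw [homogAt, if_pos (by omega), Int.toNat_natCast]
  exact Iff.rfl

theorem homogAt_of_neg {j : ℤ} (hj : j < 0) : homogAt R X j = ⊥ := if_neg (by omega)

end

end Singular

namespace GammaCW

open Singular

variable {R Γ Ω : Type u} [Ring R] [Group Γ] [TopologicalSpace Ω] [MulAction Γ Ω]

section translation

variable [ContinuousConstSMul Γ Ω]

theorem mapDomain_smul_eq_funMap (g : Γ) (c : Chain R (Sing Ω)) :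
    Finsupp.mapDomain (g • ·) c = funMap R (g • · : Ω → Ω) c := by
  refine LinearMap.congr_fun (f := Finsupp.lmapDomain R R (g • ·)) (g := funMap R (g • · : Ω → Ω))
    (chain_hom_ext fun n σ => ?_) c
  rw [funMap_gen R σ ((continuous_const_smul g).comp σ.continuous)]
  exact Finsupp.mapDomain_single

variable (R Γ Ω) in
/-- The module of all singular chains, with the action of the group by translation. -/
abbrev ChainModule : Type u := PermutationModule R (Σ n, Sing Ω n) Γ

variable (Γ) in
/-- An element of the module of chains as a chain. -/
abbrev chain (x : ChainModule R Γ Ω) : Chain R (Sing Ω) := PermutationModule.toFinsupp x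

theorem chain_single_smul (g : Γ) (r : R) (x : ChainModule R Γ Ω) :
    chain Γ ((MonoidAlgebra.single g r : MonoidAlgebra R Γ) • x) =
      r • funMap R (g • · : Ω → Ω) (chain Γ x) :=
  (PermutationModule.toFinsupp_single_smul g r x).trans
    (congrArg (r • ·) (mapDomain_smul_eq_funMap g _))

variable (R Γ Ω) in
/-- The differential of the singular complex, as a map of `RΓ`-modules. -/
def differential : ChainModule R Γ Ω →ₗ[MonoidAlgebra R Γ] ChainModule R Γ Ω :=
  PermutationModule.mkLinear (bdry₀ R) fun g t => by
    have h : (Finsupp.single (g • t) 1 : Chain R (Sing Ω)) =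
        Finsupp.mapDomain (g • ·) (Finsupp.single t 1) := Finsupp.mapDomain_single.symm
    rw [h, mapDomain_smul_eq_funMap, mapDomain_smul_eq_funMap]
    exact bdry₀_funMap (continuous_const_smul g) _

variable (R Γ Ω) in
/-- The complex that has the module of all singular chains in every degree. It contains the
singular complexes of the invariant subspaces as subcomplexes. -/
def allChains : ModComplex (MonoidAlgebra R Γ) :=
  constComplex (differential R Γ Ω) fun x => bdry₀_bdry₀ (chain Γ x)

/-- The chain modules of `allChains`. -/
def chainEquiv {j : ℤ} : (allChains R Γ Ω).X j ≃+ Chain R (Sing Ω) := PermutationModule.toFinsupp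

theorem chainEquiv_d {i j : ℤ} (h : i - 1 = j) (x : (allChains R Γ Ω).X i) :
    chainEquiv (((allChains R Γ Ω).d i j).hom x) = bdry₀ R (chainEquiv x) :=
  congrArg (chain Γ) (constComplex_d _ _ h x)

theorem chainEquiv_single_smul {j : ℤ} (g : Γ) (r : R) (x : (allChains R Γ Ω).X j) :
    chainEquiv ((MonoidAlgebra.single g r : MonoidAlgebra R Γ) • x) =
      r • funMap R (g • · : Ω → Ω) (chainEquiv x) := chain_single_smul g r x

/-- A set of chains that is closed under the operations as a submodule. -/
def chainSubmodule (N : Submodule R (Chain R (Sing Ω)))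
    (hN : ∀ (g : Γ), ∀ c ∈ N, funMap R (g • · : Ω → Ω) c ∈ N) :
    Submodule (MonoidAlgebra R Γ) (ChainModule R Γ Ω) where
  carrier := {x | chain Γ x ∈ N}
  add_mem' := fun hx hy => N.add_mem hx hy
  zero_mem' := N.zero_mem
  smul_mem' a x hx := by
    induction a using MonoidAlgebra.induction_linear with
    | zero => rw [zero_smul]; exact N.zero_mem
    | add a b ha hb => rw [add_smul]; exact N.add_mem ha hb
    | single g r =>
      exact Set.mem_of_eq_of_mem (chain_single_smul g r x) (N.smul_mem r (hN g _ hx))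

theorem funMap_mem_homogAt (f : Ω → Ω) {j : ℤ} {c : Chain R (Sing Ω)} (hc : c ∈ homogAt R Ω j) :
    funMap R f c ∈ homogAt R Ω j := by
  rcases lt_or_ge j 0 with hj | hj
  · rw [homogAt_of_neg hj, Submodule.mem_bot] at hc ⊢
    rw [hc, map_zero]
  · lift j to ℕ using hj
    rw [mem_homogAt_natCast] at hc ⊢
    rw [IsHomog, homogPart_funMap, hc]

end translation

section skeleton

variable [T2Space Ω] [Topology.CWComplex (Set.univ : Set Ω)] [hΩ : Fact (IsGammaCWComplex Γ Ω)]

variable (R Γ Ω) in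
/-- The singular chains of degree `j` in the union of the cells of dimension less than `m`. -/
def skelChains (m : ℕ) (j : ℤ) : Submodule (MonoidAlgebra R Γ) ((allChains R Γ Ω).X j) :=
  chainSubmodule (chainsIn R (skel Ω m) ⊓ homogAt R Ω j) fun g _ hc =>
    ⟨funMap_mem R (fun _ hx => smul_mem_skel g hx) hc.1, funMap_mem_homogAt _ hc.2⟩

theorem mem_skelChains {m : ℕ} {j : ℤ} {x : (allChains R Γ Ω).X j} :
    x ∈ skelChains R Γ Ω m j ↔ chainEquiv x ∈ chainsIn R (skel Ω m) ∧ chainEquiv x ∈ homogAt R Ω j := Iff.rfl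

theorem skelChains_of_neg (m : ℕ) {j : ℤ} (hj : j < 0) : skelChains R Γ Ω m j = ⊥ := by
  refine (Submodule.eq_bot_iff _).2 fun x hx => ?_
  have := (mem_skelChains.1 hx).2
  rw [homogAt_of_neg hj, Submodule.mem_bot] at this
  exact chainEquiv.map_eq_zero_iff.1 this

theorem skelChains_zero (j : ℤ) : skelChains R Γ Ω 0 j = ⊥ := by
  rcases lt_or_ge j 0 with hj | hj
  · exact skelChains_of_neg 0 hj
  · lift j to ℕ using hj
    refine (Submodule.eq_bot_iff _).2 fun x hx => ?_
    have h1 : IsHomog 0 (chainEquiv x) := by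
      have := (mem_skelChains.1 hx).1
      rwa [show skel Ω 0 = ∅ from Topology.CWComplex.skeletonLT_zero_eq_empty,
        mem_chainsIn_empty_iff] at this
    have h2 : IsHomog (j + 1) (chainEquiv x) := mem_homogAt_natCast.1 (mem_skelChains.1 hx).2
    refine chainEquiv.map_eq_zero_iff.1 ?_
    rw [← h2, ← h1, homogPart_homogPart, if_neg (by omega)]

theorem skel_mono {m m' : ℕ} (h : m ≤ m') : skel Ω m ⊆ skel Ω m' :=
  Topology.RelCWComplex.skeletonLT_mono (by exact_mod_cast h)

theorem skelChains_mono {m m' : ℕ} (h : m ≤ m') (j : ℤ) :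
    skelChains R Γ Ω m j ≤ skelChains R Γ Ω m' j := fun _ hx =>
  ⟨chainsIn_mono R (skel_mono h) hx.1, hx.2⟩

theorem skelChains_d (m : ℕ) (i j : ℤ) : ∀ x ∈ skelChains R Γ Ω m i,
    ((allChains R Γ Ω).d i j).hom x ∈ skelChains R Γ Ω m j := by
  intro x hx
  by_cases hij : i - 1 = j
  · rw [mem_skelChains, chainEquiv_d hij]
    constructor
    · have := add_mem (bdry₀_sub_bdry_mem (skel Ω m) (chainEquiv x)) (bdry_mem R (mem_skelChains.1 hx).1)
      rwa [sub_add_cancel] at this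
    · rcases lt_or_ge i 0 with hi | hi
      · have := (mem_skelChains.1 hx).2
        rw [homogAt_of_neg hi, Submodule.mem_bot] at this
        rw [this, map_zero]
        exact zero_mem _
      · lift i to ℕ using hi
        have h2 : IsHomog (i + 1) (chainEquiv x) := mem_homogAt_natCast.1 (mem_skelChains.1 hx).2
        cases i with
        | zero => rw [bdry₀_eq_zero h2]; exact zero_mem _
        | succ i =>
          obtain rfl : j = (i : ℕ) := by push_cast at hij; omega
          rw [bdry₀_eq_bdry h2, mem_homogAt_natCast]
          exact h2.bdry
  · rw [(allChains R Γ Ω).shape i j (by simp; omega)]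
    exact zero_mem _

variable (R Γ) in
theorem exists_isRelBasis_skel (K : ℕ) : ∃ b : Cell Ω K → Chain R (Sing Ω),
    (∀ σ, b σ - funMap R (charMap Γ σ) (IsCellAttachment.ballChain K R) ∈
      chainsIn R (skel Ω (K + 1) ∩ (IsCellAttachment.centers (charMap Γ (Ω := Ω) (k := K)))ᶜ)) ∧
      IsRelBasis (chainsIn R (skel Ω (K + 1))) (chainsIn R (skel Ω K)) (K + 1) b :=
  (isCellAttachment_charMap K).exists_isRelBasis

/-- The pair of consecutive skeleta has relative homology in the dimension of the cells only. -/
theorem skelChains_exact (K : ℕ) {i j : ℤ} (hjK : j ≠ K) (hij : i - 1 = j)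
    {y : (allChains R Γ Ω).X j} (hy : y ∈ skelChains R Γ Ω (K + 1) j)
    (hdy : ((allChains R Γ Ω).d j (j - 1)).hom y ∈ skelChains R Γ Ω K (j - 1)) :
    ∃ x' ∈ skelChains R Γ Ω K j, ∃ y' ∈ skelChains R Γ Ω (K + 1) i,
      y = x' + ((allChains R Γ Ω).d i j).hom y' := by
  rcases lt_or_ge j 0 with hj | hj
  · rw [skelChains_of_neg _ hj, Submodule.mem_bot] at hy
    exact ⟨0, zero_mem _, 0, zero_mem _, by rw [hy, map_zero, add_zero]⟩
  · lift j to ℕ using hj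
    obtain rfl : i = (j + 1 : ℕ) := by push_cast; omega
    obtain ⟨b, -, hb⟩ := exists_isRelBasis_skel R Γ (Ω := Ω) K
    have hdy' : bdry R (chainEquiv y) ∈ chainsIn R (skel Ω K) := by
      have h1 := (mem_skelChains.1 hdy).1
      rw [chainEquiv_d rfl y] at h1
      have := sub_mem h1 (bdry₀_sub_bdry_mem (skel Ω K) (chainEquiv y))
      rwa [sub_sub_cancel] at this
    obtain ⟨x, hx, hxd, y', hy', hyd, e⟩ := hb.exists_eq_add_bdry (d := j + 1)
      (by intro h; apply hjK; omega) (mem_skelChains.1 hy).1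
      (mem_homogAt_natCast.1 (mem_skelChains.1 hy).2) hdy'
    refine ⟨chainEquiv.symm x, mem_skelChains.2 ?_, chainEquiv.symm y', mem_skelChains.2 ?_, ?_⟩
    · rw [AddEquiv.apply_symm_apply]
      exact ⟨hx, mem_homogAt_natCast.2 hxd⟩
    · rw [AddEquiv.apply_symm_apply]
      exact ⟨hy', mem_homogAt_natCast.2 hyd⟩
    · refine chainEquiv.injective ?_
      rw [map_add, chainEquiv_d (by push_cast; omega), AddEquiv.apply_symm_apply,
        AddEquiv.apply_symm_apply, bdry₀_eq_bdry hyd, e]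

/-- The relation between relative cycles of the skeleta and their classes, in terms of the basis
given by the cells. It is described by means of the complement of the centres of the cells, because
the representatives of the basis that are available there form an invariant family. -/
def IsClass (Γ : Type u) [Group Γ] [MulAction Γ Ω] [Fact (IsGammaCWComplex Γ Ω)] {K : ℕ}
    (z : Chain R (Sing Ω)) (r : Cell Ω K →₀ R) : Prop :=
  ∃ y ∈ chainsIn R (skel Ω (K + 1)), z - bdry R y - Finsupp.linearCombination R
    (fun σ => funMap R (charMap Γ σ) (IsCellAttachment.ballChain K R)) r ∈
      chainsIn R (skel Ω (K + 1) ∩ (IsCellAttachment.centers (charMap Γ (Ω := Ω) (k := K)))ᶜ)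

variable {K : ℕ}

/-- The class is unique, because the cells are independent in the homology relative to the complement
of the centres. -/
theorem IsClass.eq {z : Chain R (Sing Ω)} {r r' : Cell Ω K →₀ R} (h : IsClass Γ z r)
    (h' : IsClass Γ z r') : r = r' := by
  obtain ⟨y, hy, h⟩ := h
  obtain ⟨y', hy', h'⟩ := h'
  refine sub_eq_zero.1 ((isCellAttachment_charMap (Γ := Γ) K).isRelBasis_compl_centers.indep _
    (y' - y) (sub_mem hy' hy) ?_)
  convert sub_mem h' h using 1
  rw [map_sub, map_sub]
  abel

theorem IsClass.add {z z' : Chain R (Sing Ω)} {r r' : Cell Ω K →₀ R} (h : IsClass Γ z r)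
    (h' : IsClass Γ z' r') : IsClass Γ (z + z') (r + r') := by
  obtain ⟨y, hy, h⟩ := h
  obtain ⟨y', hy', h'⟩ := h'
  refine ⟨y + y', add_mem hy hy', ?_⟩
  convert add_mem h h' using 1
  rw [map_add, map_add]
  abel

theorem funMap_smul_charMap (g : Γ) (σ : Cell Ω K) :
    funMap R (g • · : Ω → Ω) (funMap R (charMap Γ σ) (IsCellAttachment.ballChain K R)) =
      funMap R (charMap Γ (g • σ)) (IsCellAttachment.ballChain K R) := by
  refine map_eq_of_chainsIn
    (f := funMap R (g • · : Ω → Ω) ∘ₗ funMap R (charMap Γ σ)) (fun n τ hτ => ?_)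
    ((IsCellAttachment.isRelBasis_ballChain K R).mem ())
  have hc : ∀ σ : Cell Ω K, Continuous fun x => charMap Γ σ (τ x) := fun σ =>
    ((isCellAttachment_charMap K).continuousOn σ).comp_continuous τ.continuous
      fun t => Metric.ball_subset_closedBall (hτ t)
  rw [LinearMap.comp_apply, funMap_gen R τ (hc σ), funMap_gen R τ (hc _)]
  refine (funMap_gen R _ ((continuous_const_smul g).comp (hc σ))).trans ?_
  refine congrArg (fun τ : Sing Ω n => gen R τ) (ContinuousMap.ext fun t => ?_)
  exact (charMap_smul g σ (Metric.ball_subset_closedBall (hτ t))).symm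

theorem smul_mem_centers {g : Γ} {x : Ω}
    (hx : x ∈ IsCellAttachment.centers (charMap Γ (Ω := Ω) (k := K))) :
    g • x ∈ IsCellAttachment.centers (charMap Γ (Ω := Ω) (k := K)) := by
  obtain ⟨σ, rfl⟩ := hx
  exact ⟨g • σ, charMap_smul g σ (Metric.mem_closedBall_self zero_le_one)⟩

theorem IsClass.smul {z : Chain R (Sing Ω)} {r : Cell Ω K →₀ R} (h : IsClass Γ z r) (g : Γ)
    (s : R) : IsClass Γ (s • funMap R (g • · : Ω → Ω) z) (s • Finsupp.mapDomain (g • ·) r) := by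
  obtain ⟨y, hy, h⟩ := h
  have hg : Continuous (g • · : Ω → Ω) := continuous_const_smul g
  refine ⟨s • funMap R (g • · : Ω → Ω) y,
    Submodule.smul_mem _ _ (funMap_mem R (fun _ hx => smul_mem_skel g hx) hy), ?_⟩
  have hmaps : Set.MapsTo (g • · : Ω → Ω)
      (skel Ω (K + 1) ∩ (IsCellAttachment.centers (charMap Γ (Ω := Ω) (k := K)))ᶜ)
      (skel Ω (K + 1) ∩ (IsCellAttachment.centers (charMap Γ (Ω := Ω) (k := K)))ᶜ) := by
    refine fun x hx => ⟨smul_mem_skel g hx.1, fun hc => hx.2 ?_⟩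
    have := smul_mem_centers (g := g⁻¹) hc
    rwa [inv_smul_smul] at this
  convert Submodule.smul_mem _ s (funMap_mem R hmaps h) using 1
  rw [map_smul, map_smul, bdry_funMap R hg.continuousOn hy, ← smul_sub, ← smul_sub, map_sub,
    map_sub, Finsupp.apply_linearCombination, Finsupp.linearCombination_mapDomain]
  congr 4
  exact funext fun σ => (funMap_smul_charMap g σ).symm

/-- The relative homology of consecutive skeleta is the permutation module of the cells. -/
theorem exists_skelChains_class (K : ℕ) {k : ℤ} (hk : k = K)
    (W : Submodule (MonoidAlgebra R Γ) ((allChains R Γ Ω).X k))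
    (hW : W = skelChains R Γ Ω (K + 1) k ⊓
      (skelChains R Γ Ω K (k - 1)).comap ((allChains R Γ Ω).d k (k - 1)).hom) :
    ∃ p : W →ₗ[MonoidAlgebra R Γ] PermutationModule R (Cell Ω K) Γ, Function.Surjective p ∧
      ∀ i, i - 1 = k → ∀ z, p z = 0 ↔ ∃ x' ∈ skelChains R Γ Ω K k,
        ∃ y' ∈ skelChains R Γ Ω (K + 1) i,
          (z : (allChains R Γ Ω).X k) = x' + ((allChains R Γ Ω).d i k).hom y' := by
  subst hk
  obtain ⟨b, hbΦ, hb⟩ := exists_isRelBasis_skel R Γ (Ω := Ω) K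
  have hmem : ∀ z : W, chainEquiv (z : (allChains R Γ Ω).X K) ∈ chainsIn R (skel Ω (K + 1)) ∧
      IsHomog (K + 1) (chainEquiv (z : (allChains R Γ Ω).X K)) ∧
      bdry R (chainEquiv (z : (allChains R Γ Ω).X K)) ∈ chainsIn R (skel Ω K) := fun z => by
    have hz := hW.le z.2
    refine ⟨(mem_skelChains.1 hz.1).1, mem_homogAt_natCast.1 (mem_skelChains.1 hz.1).2, ?_⟩
    have h1 := (mem_skelChains.1 (Submodule.mem_comap.1 hz.2)).1
    rw [chainEquiv_d rfl] at h1
    have := sub_mem h1 (bdry₀_sub_bdry_mem (skel Ω K) (chainEquiv (z : (allChains R Γ Ω).X K)))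
    rwa [sub_sub_cancel] at this
  have hlin : ∀ r : Cell Ω K →₀ R, Finsupp.linearCombination R b r -
      Finsupp.linearCombination R (fun σ => funMap R (charMap Γ σ)
        (IsCellAttachment.ballChain K R)) r ∈ chainsIn R
        (skel Ω (K + 1) ∩ (IsCellAttachment.centers (charMap Γ (Ω := Ω) (k := K)))ᶜ) := fun r => by
    simp only [Finsupp.linearCombination_apply, Finsupp.sum]
    rw [← Finset.sum_sub_distrib]
    refine Submodule.sum_mem _ fun σ _ => ?_
    rw [← smul_sub]
    exact Submodule.smul_mem _ _ (hbΦ σ)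
  have hsub := chainsIn_mono R (isCellAttachment_charMap (Γ := Γ) (Ω := Ω) K).base_subset_compl
  have hspan : ∀ z : W, ∃ r : Cell Ω K →₀ R, ∃ y ∈ chainsIn R (skel Ω (K + 1)),
      chainEquiv (z : (allChains R Γ Ω).X K) - bdry R y - Finsupp.linearCombination R b r ∈
        chainsIn R (skel Ω K) ∧ IsClass Γ (chainEquiv (z : (allChains R Γ Ω).X K)) r := fun z => by
    obtain ⟨r, y, hy, h⟩ := hb.span _ (hmem z).1 (hmem z).2.2
    refine ⟨r, y, hy, h, y, hy, ?_⟩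
    have := add_mem (hsub h) (hlin r)
    rwa [sub_add_sub_cancel] at this
  obtain ⟨p, hp⟩ := exists_linearMap_of_rel
    (fun (z : W) (r : PermutationModule R (Cell Ω K) Γ) =>
      IsClass Γ (chainEquiv (z : (allChains R Γ Ω).X K)) (PermutationModule.toFinsupp r))
    (fun z => by
      obtain ⟨r, _, _, _, h⟩ := hspan z
      exact ⟨PermutationModule.toFinsupp.symm r, h⟩)
    (fun z r r' h h' => PermutationModule.toFinsupp.injective (h.eq h'))
    (fun z z' r r' h h' => h.add h')
    (fun g s z r h => by
      rw [PermutationModule.toFinsupp_single_smul]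
      have e : chainEquiv (((MonoidAlgebra.single g s : MonoidAlgebra R Γ) • z : W) :
          (allChains R Γ Ω).X K) = _ := chainEquiv_single_smul g s z.1
      rw [e]
      exact h.smul g s)
  refine ⟨p, fun r => ?_, fun i hi z => ⟨fun hz => ?_, ?_⟩⟩
  · have hc := linearCombination_mem hb.mem (PermutationModule.toFinsupp r)
    have hh : IsHomog (K + 1) (Finsupp.linearCombination R b (PermutationModule.toFinsupp r)) := by
      rw [IsHomog, Finsupp.apply_linearCombination]
      congr 2
      exact funext hb.homog
    have hdc : bdry R (Finsupp.linearCombination R b (PermutationModule.toFinsupp r)) ∈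
        chainsIn R (skel Ω K) := by
      rw [Finsupp.apply_linearCombination]
      exact linearCombination_mem hb.bdry_mem _
    have hx : (chainEquiv.symm (Finsupp.linearCombination R b (PermutationModule.toFinsupp r)) :
        (allChains R Γ Ω).X K) ∈ skelChains R Γ Ω (K + 1) K := by
      rw [mem_skelChains, AddEquiv.apply_symm_apply]
      exact ⟨hc, mem_homogAt_natCast.2 hh⟩
    refine ⟨⟨_, hW.ge ⟨hx, Submodule.mem_comap.2 (mem_skelChains.2
      ⟨?_, (mem_skelChains.1 (skelChains_d (K + 1) K (K - 1) _ hx)).2⟩)⟩⟩, ?_⟩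
    · rw [chainEquiv_d rfl, AddEquiv.apply_symm_apply]
      have := add_mem (bdry₀_sub_bdry_mem (skel Ω K)
        (Finsupp.linearCombination R b (PermutationModule.toFinsupp r))) hdc
      rwa [sub_add_cancel] at this
    · refine PermutationModule.toFinsupp.injective ((hp _).eq ⟨0, zero_mem _, ?_⟩)
      rw [map_zero, sub_zero, AddEquiv.apply_symm_apply]
      exact hlin _
  · obtain rfl : i = (K + 1 : ℕ) := by push_cast; omega
    obtain ⟨r, y, hy, h, hr⟩ := hspan z
    have hr0 : r = 0 := by
      have := hp z
      rw [hz] at this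
      exact hr.eq this
    rw [hr0, map_zero, sub_zero] at h
    refine ⟨chainEquiv.symm (homogPart R (K + 1) (chainEquiv (z : (allChains R Γ Ω).X K) -
      bdry R y)), mem_skelChains.2 ?_, chainEquiv.symm (homogPart R (K + 2) y),
      mem_skelChains.2 ?_, ?_⟩
    · rw [AddEquiv.apply_symm_apply]
      exact ⟨homogPart_mem h (K + 1), mem_homogAt_natCast.2 (isHomog_homogPart R _ _)⟩
    · rw [AddEquiv.apply_symm_apply]
      exact ⟨homogPart_mem hy _, mem_homogAt_natCast.2 (isHomog_homogPart R _ _)⟩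
    · refine chainEquiv.injective ?_
      rw [map_add, chainEquiv_d (by push_cast; omega), AddEquiv.apply_symm_apply,
        AddEquiv.apply_symm_apply, bdry₀_eq_bdry (isHomog_homogPart R (K + 2) y), ← homogPart_bdry,
        ← map_add, sub_add_cancel]
      exact (hmem z).2.1.symm
  · rintro ⟨x', hx', y', hy', e⟩
    obtain rfl : i = (K + 1 : ℕ) := by push_cast; omega
    refine PermutationModule.toFinsupp.injective
      ((hp z).eq ⟨chainEquiv y', (mem_skelChains.1 hy').1, ?_⟩)
    rw [map_zero, map_zero, sub_zero, e, map_add, chainEquiv_d (by push_cast; omega),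
      bdry₀_eq_bdry (mem_homogAt_natCast.1 (mem_skelChains.1 hy').2), add_sub_cancel_right]
    exact hsub (mem_skelChains.1 hx').1

end skeleton

end GammaCW

end

noncomputable section

/-! ### Finiteness properties of CW-complexes with a group action -/

namespace GammaCW

open Singular Topology

/-- A permutation module on finitely many orbits is a finite sum of transitive ones. -/
theorem exists_permutationModule_equiv_pi {R Γ : Type u} [Ring R] [Group Γ] (T : Type u)
    [MulAction Γ T] [Finite (MulAction.orbitRel.Quotient Γ T)] :
    ∃ (m : ℕ) (t : Fin m → T), Nonempty (PermutationModule R T Γ ≃ₗ[MonoidAlgebra R Γ]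
      ∀ i, PermutationModule R (Γ ⧸ MulAction.stabilizer Γ (t i)) Γ) := by
  obtain ⟨m, ⟨f⟩⟩ := Finite.exists_equiv_fin (MulAction.orbitRel.Quotient Γ T)
  refine ⟨m, fun i => (f.symm i).out, ⟨?_⟩⟩
  set t : Fin m → T := fun i => (f.symm i).out with ht
  let φ : (Σ i, Γ ⧸ MulAction.stabilizer Γ (t i)) → T :=
    fun q => MulAction.ofQuotientStabilizer Γ (t q.1) q.2
  have hφ : ∀ (g : Γ) q, φ (g • q) = g • φ q := fun g q =>
    MulAction.ofQuotientStabilizer_smul Γ (t q.1) g q.2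
  have horb : ∀ q, (Quotient.mk (MulAction.orbitRel Γ T) (φ q) : MulAction.orbitRel.Quotient Γ T) =
      f.symm q.1 := by
    rintro ⟨i, q⟩
    induction q using Quotient.inductionOn with
    | h g =>
      refine Eq.trans (Quotient.sound ?_) (Quotient.out_eq (f.symm i))
      exact ⟨g, rfl⟩
  have hbij : Function.Bijective φ := by
    constructor
    · rintro ⟨i, q⟩ ⟨j, q'⟩ h
      obtain rfl : i = j := f.symm.injective
        ((horb ⟨i, q⟩).symm.trans ((congrArg (Quotient.mk _) h).trans (horb ⟨j, q'⟩)))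
      exact congrArg (Sigma.mk i) (MulAction.injective_ofQuotientStabilizer Γ (t i) h)
    · intro x
      obtain ⟨g, hg⟩ := Quotient.mk_out (s := MulAction.orbitRel Γ T) x
      have hx : t (f (Quotient.mk _ x)) = Quotient.out (Quotient.mk (MulAction.orbitRel Γ T) x) := by
        rw [ht]
        exact congrArg Quotient.out (f.symm_apply_apply _)
      refine ⟨⟨f (Quotient.mk _ x), (g⁻¹ : Γ)⟩, ?_⟩
      change g⁻¹ • t (f (Quotient.mk _ x)) = x
      rw [hx, inv_smul_eq_iff]
      exact hg.symm
  let e : PermutationModule R (Σ i, Γ ⧸ MulAction.stabilizer Γ (t i)) Γ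
      ≃ₗ[MonoidAlgebra R Γ] PermutationModule R T Γ :=
    PermutationModule.congr (Equiv.ofBijective φ hbij) hφ
  let s : PermutationModule R (Σ i, Γ ⧸ MulAction.stabilizer Γ (t i)) Γ →+
      ∀ i, PermutationModule R (Γ ⧸ MulAction.stabilizer Γ (t i)) Γ :=
    (Finsupp.sigmaFinsuppLEquivPiFinsupp (ιs := fun i => Γ ⧸ MulAction.stabilizer Γ (t i)) (M := R)
      R).toLinearMap.toAddMonoidHom
  have hs : Function.Bijective s := (Finsupp.sigmaFinsuppLEquivPiFinsupp
    (ιs := fun i => Γ ⧸ MulAction.stabilizer Γ (t i)) (M := R) R).bijective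
  refine e.symm ≪≫ₗ LinearEquiv.ofBijective (AddMonoidHom.toGroupRingLinearMap s
    fun g r x => ?_) hs
  funext i
  refine PermutationModule.toFinsupp.injective (Finsupp.ext fun q => ?_)
  exact (PermutationModule.toFinsupp_single_smul_apply g r x ⟨i, q⟩).trans
    (PermutationModule.toFinsupp_single_smul_apply g r (s x i) q).symm

variable {Γ Ω : Type u} [Group Γ] [TopologicalSpace Ω] [MulAction Γ Ω]
  [Topology.CWComplex (Set.univ : Set Ω)]

theorem exists_mem_openCell (x : Ω) : ∃ k, ∃ σ : Cell Ω k, x ∈ openCell σ := by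
  have : x ∈ ⋃ (n) (j), CWComplex.openCell (C := (Set.univ : Set Ω)) n j := by
    rw [CWComplex.iUnion_openCell_eq_complex]
    trivial
  obtain ⟨k, hk⟩ := Set.mem_iUnion.1 this
  obtain ⟨σ, hσ⟩ := Set.mem_iUnion.1 hk
  exact ⟨k, σ, hσ⟩

variable [T2Space Ω]

theorem nonempty_cell_zero [Nonempty Ω] : Nonempty (Cell Ω 0) := by
  classical
  have hex : ∃ k, Nonempty (Cell Ω k) := by
    obtain ⟨k, σ, -⟩ := exists_mem_openCell (Classical.arbitrary Ω)
    exact ⟨k, ⟨σ⟩⟩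
  obtain ⟨σ⟩ := Nat.find_spec hex
  -- the boundary of a cell of minimal dimension is empty
  rcases Nat.eq_zero_or_pos (Nat.find hex) with h | h
  · rw [← h]
    exact ⟨σ⟩
  · obtain ⟨x, hx⟩ := RelCWComplex.nonempty_cellFrontier (C := (Set.univ : Set Ω)) h.ne' σ
    obtain ⟨m, hm, τ, -⟩ := CWComplex.mem_skeletonLT_iff.1
      (RelCWComplex.cellFrontier_subset_skeletonLT (C := (Set.univ : Set Ω)) _ σ hx)
    exact absurd ⟨τ⟩ (Nat.find_min hex (by exact_mod_cast hm))

/-- A compact subset is contained in a skeleton. -/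
theorem exists_subset_skel {L : Set Ω} (hL : IsCompact L) : ∃ m, L ⊆ skel Ω m := by
  by_contra! h
  simp only [Set.not_subset] at h
  choose x hxL hx using h
  have hmem : ∀ y : Ω, ∃ m, y ∈ skel Ω m := fun y => by
    obtain ⟨k, σ, hy⟩ := exists_mem_openCell y
    exact ⟨k + 1, mem_skel_iff.2 ⟨k, Nat.lt_succ_self k, σ, hy⟩⟩
  have hlt : ∀ {i m : ℕ}, x i ∈ skel Ω m → i < m := fun {i m} hi => by
    by_contra hle
    exact hx i (skel_mono (not_lt.1 hle) hi)
  -- the points `x i` form a closed set because every closed cell contains finitely many of them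
  let t : ℕ → Set Ω := fun m => x '' Set.Ici m
  have hcl : ∀ m, IsClosed (t m) := fun m => by
    refine (CWComplex.closed (Set.univ : Set Ω) (t m) (Set.subset_univ _)).2 fun n j => ?_
    refine (((Set.finite_Iio (n + 1)).image x).subset ?_).isClosed
    rintro _ ⟨⟨i, -, rfl⟩, hi⟩
    refine ⟨i, hlt ?_, rfl⟩
    have := RelCWComplex.closedCell_subset_skeletonLT (C := (Set.univ : Set Ω)) n j hi
    exact_mod_cast this
  obtain ⟨y, hy⟩ := IsCompact.nonempty_iInter_of_sequence_nonempty_isCompact_isClosed t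
    (fun i => Set.image_mono (Set.Ici_subset_Ici.2 (Nat.le_succ i)))
    (fun i => ⟨x i, i, Set.self_mem_Ici, rfl⟩)
    (hL.of_isClosed_subset (hcl 0) (by rintro _ ⟨i, -, rfl⟩; exact hxL i)) hcl
  obtain ⟨m, hm⟩ := hmem y
  obtain ⟨i, hi, rfl⟩ := Set.mem_iInter.1 hy m
  exact (hlt hm).not_ge hi

/-- There are finitely many orbits of cells in every dimension in which the skeleton is
cocompact. -/
theorem finite_orbits [hΩ : Fact (IsGammaCWComplex Γ Ω)] {n : ℕ}
    (hcc : HasCocompactSkeleton Γ Ω n) {k : ℕ} (hk : k ≤ n) :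
    Finite (MulAction.orbitRel.Quotient Γ (Cell Ω k)) := by
  set q : Ω → Quotient (MulAction.orbitRel Γ Ω) := Quotient.mk _ with hq
  have hΦ := isCellAttachment_charMap (Γ := Γ) (Ω := Ω) k
  set Z := IsCellAttachment.centers (charMap Γ (Ω := Ω) (k := k)) with hZ
  -- every subset of the image of the centres is closed in the quotient
  have hcl : ∀ S ⊆ q '' Z, IsClosed S := fun S hS => by
    refine (isQuotientMap_quotient_mk'.isClosed_preimage (f := q)).1
      (hΦ.isClosed_of_subset_centers ?_)
    intro x hx
    obtain ⟨z, hz, e⟩ := hS hx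
    obtain ⟨g, rfl⟩ := Quotient.exact e
    have := smul_mem_centers (g := g⁻¹) hz
    rwa [inv_smul_smul] at this
  have hsub : q '' Z ⊆ q '' (CWComplex.skeleton (Set.univ : Set Ω) n : Set Ω) := by
    refine Set.image_mono (hΦ.centers_subset.trans (RelCWComplex.skeletonLT_mono ?_))
    push_cast
    gcongr
  have hdisc : IsDiscrete (q '' Z) := ⟨discreteTopology_iff_forall_isClosed.2 fun S => by
    have := (hcl (Subtype.val '' S) (by rintro _ ⟨s, -, rfl⟩; exact s.2)).preimage
      (continuous_subtype_val (p := (· ∈ q '' Z)))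
    rwa [Set.preimage_image_eq _ Subtype.val_injective] at this⟩
  have hfin : (q '' Z).Finite := (hcc.of_isClosed_subset (hcl _ subset_rfl) hsub).finite hdisc
  have := hfin.to_subtype
  refine Finite.of_injective (β := ↥(q '' Z)) (fun o => ⟨q (charMap Γ o.out 0), _, ⟨o.out, rfl⟩, rfl⟩)
    fun o o' h => ?_
  obtain ⟨g, hg⟩ := Quotient.exact (congrArg Subtype.val h)
  have hg' : charMap Γ (g • o'.out) 0 = charMap Γ o.out 0 :=
    (charMap_smul g _ (Metric.mem_closedBall_self zero_le_one)).trans hg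
  have := (hΦ.injective IsCellAttachment.zero_mem_ball IsCellAttachment.zero_mem_ball hg').1
  rw [← Quotient.out_eq o, ← Quotient.out_eq o']
  exact Quotient.sound ⟨g, this⟩

end GammaCW

end

noncomputable section

/-! ### The geometric form of the bootstrapping theorem -/

namespace GammaCW

open Singular Topology

section augmentation

variable {R : Type*} [Ring R] {X : Type*} [TopologicalSpace X]

variable (R X) in
/-- The augmentation of the singular complex. It is read off from the augmented differential. -/
def augmentation : Chain R (Sing X) →ₗ[R] R := Finsupp.lapply ⟨0, emptySimplex⟩ ∘ₗ bdry R

theorem augmentation_bdry (c : Chain R (Sing X)) : augmentation R X (bdry R c) = 0 := by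
  rw [augmentation, LinearMap.comp_apply, bdry_bdry, map_zero]

theorem bdry_eq_zero_of_augmentation {c : Chain R (Sing X)} (hc : IsHomog 1 c)
    (h : augmentation R X c = 0) : bdry R c = 0 := by
  have hb : bdry R c ∈ chainsIn R (∅ : Set X) := mem_chainsIn_empty_iff.2 hc.bdry
  obtain ⟨r, y, hy, e⟩ := isRelBasis_empty.span _ hb (by rw [bdry_bdry]; exact zero_mem _)
  have hy0 : bdry R y = 0 := map_eq_of_chainsIn (g := 0) (fun n σ hσ => by
    cases n with
    | zero => exact bdry_gen_zero R σ
    | succ n => exact (hσ (vtx 0)).elim) hy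
  rw [hy0, sub_zero, Submodule.mem_bot, sub_eq_zero, Finsupp.linearCombination_unique] at e
  have h' : (bdry R c) ⟨0, emptySimplex⟩ = 0 := h
  rw [e] at h' ⊢
  rw [Finsupp.smul_apply, gen, Finsupp.single_eq_same, smul_eq_mul, mul_one] at h'
  rw [h', zero_smul]

theorem augmentation_gen (σ : Sing X 1) : augmentation R X (gen R σ) = 1 := by
  rw [augmentation, LinearMap.comp_apply, bdry_gen_succ, Fin.sum_univ_one]
  simp only [Fin.val_zero, pow_zero, one_smul]
  rw [Subsingleton.elim (FaceMaps.face 0 σ) (emptySimplex (X := X))]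
  exact Finsupp.single_eq_same

theorem augmentation_funMap {f : X → X} (hf : Continuous f) (c : Chain R (Sing X)) :
    augmentation R X (funMap R f c) = augmentation R X c := by
  have hc : c ∈ chainsIn R (Set.univ : Set X) := by rw [chainsIn_univ]; trivial
  have key : (Finsupp.lapply ⟨0, emptySimplex⟩ ∘ₗ funMap R f : Chain R (Sing X) →ₗ[R] R) =
      Finsupp.lapply ⟨0, emptySimplex⟩ := by
    refine chain_hom_ext fun n σ => ?_
    rw [LinearMap.comp_apply, funMap_gen R σ (hf.comp σ.continuous)]
    cases n with
    | zero => exact congrArg _ (congrArg (fun τ : Sing X 0 => gen R τ) (Subsingleton.elim _ _))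
    | succ n => simp [gen]
  rw [augmentation, LinearMap.comp_apply, bdry_funMap R hf.continuousOn hc]
  exact LinearMap.congr_fun key _

end augmentation

variable {R Γ Ω : Type u} [Ring R] [Group Γ] [TopologicalSpace Ω] [T2Space Ω] [MulAction Γ Ω]
  [Topology.CWComplex (Set.univ : Set Ω)]

theorem exists_mem_chainsIn_skel (c : Chain R (Sing Ω)) : ∃ m, c ∈ chainsIn R (skel Ω m) := by
  induction c using Finsupp.induction_linear with
  | zero => exact ⟨0, zero_mem _⟩
  | add c c' hc hc' =>
    obtain ⟨m, hm⟩ := hc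
    obtain ⟨m', hm'⟩ := hc'
    exact ⟨max m m', add_mem (chainsIn_mono R (skel_mono (le_max_left m m')) hm)
      (chainsIn_mono R (skel_mono (le_max_right m m')) hm')⟩
  | single σ r =>
    obtain ⟨m, hm⟩ := exists_subset_skel (isCompact_range σ.2.continuous)
    refine ⟨m, ?_⟩
    have := Submodule.smul_mem _ r (gen_mem_chainsIn R (A := skel Ω m) (σ := σ.2)
      fun t => hm ⟨t, rfl⟩)
    rwa [gen, Finsupp.smul_single, smul_eq_mul, mul_one] at this

variable [hΩ : Fact (IsGammaCWComplex Γ Ω)]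

/-- Low-dimensional cycles in a skeleton that bound also bound in the skeleton. -/
theorem exists_bdry_eq_of_skel (Γ : Type u) [Group Γ] [MulAction Γ Ω]
    [Fact (IsGammaCWComplex Γ Ω)] {m d : ℕ} (hd : d < m) {y : Chain R (Sing Ω)}
    (hc : bdry R y ∈ chainsIn R (skel Ω m)) (hcd : IsHomog d (bdry R y)) :
    ∃ y' ∈ chainsIn R (skel Ω m), IsHomog (d + 1) y' ∧ bdry R y' = bdry R y := by
  obtain ⟨N, hN⟩ := exists_mem_chainsIn_skel y
  have key : ∀ N, m ≤ N → ∀ y ∈ chainsIn R (skel Ω N), IsHomog (d + 1) y →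
      bdry R y ∈ chainsIn R (skel Ω m) →
      ∃ y' ∈ chainsIn R (skel Ω m), IsHomog (d + 1) y' ∧ bdry R y' = bdry R y := by
    intro N hmN
    induction N, hmN using Nat.le_induction with
    | base => exact fun y hy hyd _ => ⟨y, hy, hyd, rfl⟩
    | succ N hmN ih =>
      intro y hy hyd hdy
      obtain ⟨b, -, hb⟩ := exists_isRelBasis_skel R Γ (Ω := Ω) N
      obtain ⟨x, hx, hxd, z, -, -, e⟩ := hb.exists_eq_add_bdry (by omega) hy hyd
        (chainsIn_mono R (skel_mono hmN) hdy)
      have hxy : bdry R x = bdry R y := by rw [e, map_add, bdry_bdry, add_zero]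
      obtain ⟨y', hy', hyd', h⟩ := ih x hx hxd (by rwa [hxy])
      exact ⟨y', hy', hyd', h.trans hxy⟩
  have hh : bdry R (homogPart R (d + 1) y) = bdry R y := by rw [← homogPart_bdry, hcd]
  have := key (max m N) (le_max_left m N) (homogPart R (d + 1) y)
    (homogPart_mem (chainsIn_mono R (skel_mono (le_max_right m N)) hN) _)
    (isHomog_homogPart R _ _) (by rwa [hh])
  rwa [hh] at this

variable (R Γ Ω) in
/-- The singular complex of the skeleton of dimension `k`. -/
abbrev skelComplex (k : ℕ) : ModComplex (MonoidAlgebra R Γ) :=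
  ModComplex.subComplex (allChains R Γ Ω) (skelChains R Γ Ω (k + 1)) (skelChains_d (k + 1))

variable (R Γ Ω) in
/-- The augmentation of the singular complex, as a map of `RΓ`-modules. -/
def equivariantAugmentation : (allChains R Γ Ω).X 0 →ₗ[MonoidAlgebra R Γ] TrivialModule R Γ :=
  AddMonoidHom.toGroupRingLinearMap
    (TrivialModule.toRing.symm.toAddMonoidHom.comp
      ((augmentation R Ω).toAddMonoidHom.comp chainEquiv.toAddMonoidHom)) fun g r x => by
    refine TrivialModule.toRing.injective ?_
    rw [TrivialModule.single_smul]
    change augmentation R Ω (chainEquiv _) = r * augmentation R Ω (chainEquiv x)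
    rw [chainEquiv_single_smul, map_smul, augmentation_funMap (continuous_const_smul g),
      smul_eq_mul]

theorem isAugmentation_skelComplex [Nonempty Ω] {n : ℕ}
    (hac : ∀ d, 1 ≤ d → d ≤ n → ∀ c : Chain R (Sing Ω), IsHomog d c → bdry R c = 0 →
      ∃ y, bdry R y = c) :
    ModComplex.IsAugmentation n (skelComplex R Γ Ω n)
      (equivariantAugmentation R Γ Ω ∘ₗ (skelChains R Γ Ω (n + 1) 0).subtype ∘ₗ
        (ModComplex.subEquiv (allChains R Γ Ω) _ (skelChains_d (n + 1)) 0).toLinearMap) := by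
  have hbound : ∀ (j : ℕ) (i : ℤ), j < n → i - 1 = j → ∀ x : (allChains R Γ Ω).X j,
      x ∈ skelChains R Γ Ω (n + 1) j → bdry R (chainEquiv x) = 0 →
      ∃ y ∈ skelChains R Γ Ω (n + 1) i, ((allChains R Γ Ω).d i j).hom y = x := by
    intro j i hj hi x hx hdx
    obtain rfl : i = (j + 1 : ℕ) := by push_cast; omega
    obtain ⟨hx1, hx2⟩ := mem_skelChains.1 hx
    obtain ⟨y, hy⟩ := hac (j + 1) (by omega) (by omega) _ (mem_homogAt_natCast.1 hx2) hdx
    obtain ⟨y', hy', hyd, e⟩ := exists_bdry_eq_of_skel Γ (m := n + 1) (d := j + 1) (by omega)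
      (by rwa [hy]) (by rw [hy]; exact mem_homogAt_natCast.1 hx2)
    refine ⟨chainEquiv.symm y', mem_skelChains.2 ?_, chainEquiv.injective ?_⟩
    · rw [AddEquiv.apply_symm_apply]
      exact ⟨hy', mem_homogAt_natCast.2 hyd⟩
    · rw [chainEquiv_d (by push_cast; omega), AddEquiv.apply_symm_apply, bdry₀_eq_bdry hyd, e, hy]
  refine ⟨fun j hj => ?_, fun l => ?_, fun i hi x => ?_, fun hn i hi x hx => ?_,
    fun j hj hjn i hi x hx => ?_⟩
  · refine (ModComplex.subEquiv (allChains R Γ Ω) _ (skelChains_d (n + 1)) j).toEquiv.subsingleton_congr.2 ?_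
    rw [skelChains_of_neg _ hj]
    infer_instance
  · obtain ⟨σ⟩ := nonempty_cell_zero (Ω := Ω)
    obtain ⟨x, hx⟩ := RelCWComplex.openCell_nonempty (C := (Set.univ : Set Ω)) 0 σ
    set c : Chain R (Sing Ω) := TrivialModule.toRing l • gen R (G := Sing Ω) (n := 1)
      (ContinuousMap.const _ x) with hc
    have hmem : (chainEquiv.symm c : (allChains R Γ Ω).X 0) ∈ skelChains R Γ Ω (n + 1) 0 := by
      rw [mem_skelChains, AddEquiv.apply_symm_apply]
      refine ⟨Submodule.smul_mem _ _ (gen_mem_chainsIn R fun _ =>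
        mem_skel_iff.2 ⟨0, Nat.succ_pos n, σ, hx⟩), (mem_homogAt_natCast (j := 0)).2 ?_⟩
      rw [IsHomog, hc, map_smul, homogPart_gen, if_pos rfl]
    refine ⟨(ModComplex.subEquiv _ _ (skelChains_d (n + 1)) 0).symm ⟨_, hmem⟩,
      TrivialModule.toRing.injective ?_⟩
    change augmentation R Ω (chainEquiv (chainEquiv.symm c : (allChains R Γ Ω).X 0)) = _
    rw [AddEquiv.apply_symm_apply, hc, map_smul, augmentation_gen, smul_eq_mul, mul_one]
  · refine TrivialModule.toRing.injective ?_
    set y := ModComplex.subEquiv (allChains R Γ Ω) _ (skelChains_d (n + 1)) i x with hy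
    change augmentation R Ω (chainEquiv (((allChains R Γ Ω).d i 0).hom
      (y : (allChains R Γ Ω).X i))) = 0
    obtain rfl : i = (0 + 1 : ℕ) := by push_cast; omega
    rw [chainEquiv_d (by simp), bdry₀_eq_bdry (mem_homogAt_natCast.1 (mem_skelChains.1 y.2).2),
      augmentation_bdry]
  · set y := ModComplex.subEquiv (allChains R Γ Ω) _ (skelChains_d (n + 1)) 0 x with hy
    have h0 : augmentation R Ω (chainEquiv (y : (allChains R Γ Ω).X 0)) = 0 := hx
    obtain ⟨z, hz, e⟩ := hbound 0 i hn (by push_cast; exact hi) y y.2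
      (bdry_eq_zero_of_augmentation
        ((mem_homogAt_natCast (j := 0)).1 (mem_skelChains.1 y.2).2) h0)
    exact ⟨(ModComplex.subEquiv _ _ (skelChains_d (n + 1)) i).symm ⟨z, hz⟩, Subtype.ext e⟩
  · lift j to ℕ using hj.le
    obtain ⟨j, rfl⟩ := Nat.exists_eq_succ_of_ne_zero (n := j) (by omega)
    set y := ModComplex.subEquiv (allChains R Γ Ω) _ (skelChains_d (n + 1)) _ x with hy
    have hyd := mem_homogAt_natCast.1 (mem_skelChains.1 y.2).2
    have hdy : bdry R (chainEquiv (y : (allChains R Γ Ω).X (j + 1 : ℕ))) = 0 := by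
      rw [← bdry₀_eq_bdry hyd, ← chainEquiv_d rfl]
      exact chainEquiv.map_eq_zero_iff.2 (congrArg Subtype.val hx)
    obtain ⟨z, hz, e⟩ := hbound (j + 1) i (by omega) hi y y.2 hdy
    exact ⟨(ModComplex.subEquiv _ _ (skelChains_d (n + 1)) i).symm ⟨z, hz⟩, Subtype.ext e⟩

/-- The geometric form of the bootstrapping theorem, in terms of singular chains. -/
theorem associatedClass_of_acyclic [Nontrivial R] {C : GroupClass.{u}} {B : EquivariantFamily R}
    (hB : IsEquivariantlyBootstrappable R C B) (hΓ : C Γ) [Nonempty Ω] {n : ℕ}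
    (hac : ∀ d, 1 ≤ d → d ≤ n → ∀ c : Chain R (Sing Ω), IsHomog d c → bdry R c = 0 →
      ∃ y, bdry R y = c)
    (hcc : HasCocompactSkeleton Γ Ω n)
    (hst : ∀ k ≤ n, ∀ σ : Cell Ω k, associatedClass R C B (n - k) (cellStabilizer Γ σ)) :
    associatedClass R C B n Γ := by
  refine associatedClass_of_filtration hB hΓ n (skelComplex R Γ Ω)
    (fun k => ModComplex.subInclusion (allChains R Γ Ω) _ _ (skelChains_d (k + 1))
      (skelChains_d (k + 2)) (skelChains_mono (Nat.le_succ _)))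
    (fun k => PermutationModule R (Cell Ω k) Γ) ?_ ?_ (fun k _ => ?_) (fun k hk => ?_)
    (isAugmentation_skelComplex hac)
  · have := nonempty_cell_zero (Ω := Ω)
    exact inferInstanceAs (Nontrivial (Cell Ω 0 →₀ R))
  · obtain ⟨p, hp, hpk⟩ := exists_skelChains_class (R := R) (Γ := Γ) (Ω := Ω) 0 (k := 0) rfl
      (skelChains R Γ Ω 1 0 ⊓ LinearMap.ker ((allChains R Γ Ω).d 0 (0 - 1)).hom)
      (by rw [skelChains_zero, Submodule.comap_bot])
    refine ModComplex.hasHomologyOnlyAt_subComplex _ _ _ (fun j hj i hi x hx hdx => ?_) p hp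
      fun i hi z => (hpk i hi z).trans ?_
    · obtain ⟨x', hx', y, hy, e⟩ := skelChains_exact 0 (by exact_mod_cast hj) hi hx
        (by rw [hdx]; exact zero_mem _)
      rw [skelChains_zero, Submodule.mem_bot] at hx'
      exact ⟨y, hy, by rw [e, hx', zero_add]⟩
    · constructor
      · rintro ⟨x', hx', y, hy, e⟩
        rw [skelChains_zero, Submodule.mem_bot] at hx'
        exact ⟨y, hy, by rw [e, hx', zero_add]⟩
      · rintro ⟨y, hy, e⟩
        exact ⟨0, zero_mem _, y, hy, by rw [e, zero_add]⟩
  · obtain ⟨p, hp, hpk⟩ := exists_skelChains_class (R := R) (Γ := Γ) (Ω := Ω) (k + 1) rfl _ rfl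
    exact ModComplex.hasRelHomologyOnlyAt_subInclusion _ _ _ _ _ _
      (fun j hj i hi y hy hdy => skelChains_exact (k + 1) hj hi hy hdy) p hp hpk
  · have := finite_orbits hcc hk
    obtain ⟨m, t, e⟩ := exists_permutationModule_equiv_pi (R := R) (Γ := Γ) (Cell Ω k)
    exact ⟨m, _, fun i => by rw [stabilizer_eq]; exact hst k hk (t i), e⟩

end GammaCW

end

noncomputable section

/-! ### Comparison with the singular homology of Mathlib -/

namespace Singular

open GammaCW (augmentation augmentation_gen)

open Simplicial

variable (R : Type u) [Ring R] (X : Type u) [TopologicalSpace X]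

/-- The singular simplicial set of a space. -/
abbrev singularSet : SSet.{u} := TopCat.toSSet.obj (TopCat.of X)

/-- The singular chain complex of Mathlib, with coefficients in `R`. -/
abbrev mathlibComplex : ChainComplex (ModuleCat.{u} R) ℕ :=
  (singularSet X).chainComplex (ModuleCat.of R R)

variable {X}

/-- A simplex of dimension `j` of the singular simplicial set has `j + 1` vertices. -/
def toSing {j : ℕ} : (singularSet X) _⦋j⦌ ≃ Sing X (j + 1) :=
  TopCat.toSSetObjEquiv (TopCat.of X) (Opposite.op ⦋j⦌)

theorem aff_vtx_comp {m n : ℕ} (f : Fin m → Fin n) (x : Splx m) :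
    aff (vtx ∘ f) x = stdSimplex.map f x := by
  refine Subtype.ext (funext fun j => ?_)
  change _ = FunOnFinite.linearMap ℝ ℝ f x.1 j
  rw [FunOnFinite.linearMap_apply_apply, aff_val, Finset.sum_apply, Finset.sum_filter]
  refine Finset.sum_congr rfl fun i _ => ?_
  simp [vtx, Pi.single_apply, eq_comm]

theorem toSing_δ {j : ℕ} (i : Fin (j + 2)) (x : (singularSet X) _⦋j + 1⦌) :
    toSing ((singularSet X).δ i x) = FaceMaps.face (G := Sing X) i (toSing x) := by
  refine ContinuousMap.ext fun t => ?_
  change _ = toSing x (aff (vtx ∘ i.succAbove) t)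
  rw [aff_vtx_comp]
  rfl

/-- The generator of the Mathlib complex given by a simplex. -/
def mathlibGen {j : ℕ} (x : (singularSet X) _⦋j⦌) : (mathlibComplex R X).X j :=
  ((singularSet X).ιChainComplex x : ModuleCat.of R R ⟶ _).hom (1 : R)

theorem mathlibComplex_d {j : ℕ} (x : (singularSet X) _⦋j + 1⦌) :
    ((mathlibComplex R X).d (j + 1) j).hom (mathlibGen R x) =
      ∑ i : Fin (j + 2), (-1 : R) ^ (i : ℕ) • mathlibGen R ((singularSet X).δ i x) := by
  have h := congrArg (fun f => f.hom (1 : R))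
    ((singularSet X).ιChainComplex_d (R := ModuleCat.of R R) x)
  refine h.trans ?_
  simp only [ModuleCat.hom_sum, LinearMap.sum_apply]
  refine Finset.sum_congr rfl fun i _ => ?_
  rcases Nat.even_or_odd (i : ℕ) with hi | hi
  · rw [hi.neg_one_pow, hi.neg_one_pow, one_smul, one_smul]
    rfl
  · rw [hi.neg_one_pow, hi.neg_one_pow, neg_one_smul, neg_one_smul]
    rfl

theorem mathlibComplex_hom_ext {j : ℕ} {M : Type u} [AddCommGroup M] [Module R M]
    {f g : (mathlibComplex R X).X j →ₗ[R] M}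
    (h : ∀ x : (singularSet X) _⦋j⦌, f (mathlibGen R x) = g (mathlibGen R x)) : f = g := by
  have : ModuleCat.ofHom f = ModuleCat.ofHom g := SSet.chainComplex_hom_ext fun x => by
    ext
    exact h x
  exact congrArg ModuleCat.Hom.hom this

/-- The comparison from chains to the Mathlib complex. It kills the simplices of the other
dimensions. -/
def toMathlib (j : ℕ) : Chain R (Sing X) →ₗ[R] (mathlibComplex R X).X j :=
  extend R fun n σ => if h : n = j + 1 then mathlibGen R (toSing.symm (h ▸ σ)) else 0

theorem toMathlib_gen {j : ℕ} (σ : Sing X (j + 1)) :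
    toMathlib R j (gen R σ) = mathlibGen R (toSing.symm σ) := by
  rw [toMathlib, extend_gen, dif_pos rfl]

theorem toMathlib_gen_of_ne {j n : ℕ} (h : n ≠ j + 1) (σ : Sing X n) :
    toMathlib R j (gen R σ) = 0 := by
  rw [toMathlib, extend_gen, dif_neg h]

theorem toMathlib_bdry (j : ℕ) (c : Chain R (Sing X)) :
    toMathlib R j (bdry R c) = ((mathlibComplex R X).d (j + 1) j).hom (toMathlib R (j + 1) c) := by
  refine LinearMap.congr_fun (f := toMathlib R j ∘ₗ bdry R)
    (g := ((mathlibComplex R X).d (j + 1) j).hom ∘ₗ toMathlib R (j + 1))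
    (chain_hom_ext fun n σ => ?_) c
  rw [LinearMap.comp_apply, LinearMap.comp_apply]
  by_cases h : n = j + 2
  · subst h
    rw [bdry_gen_succ, toMathlib_gen, mathlibComplex_d]
    simp only [map_sum, map_smul, toMathlib_gen]
    refine Finset.sum_congr rfl fun i _ => congrArg (fun x => (-1 : R) ^ (i : ℕ) • mathlibGen R x) ?_
    rw [Equiv.symm_apply_eq, toSing_δ, Equiv.apply_symm_apply]
  · rw [toMathlib_gen_of_ne R h, map_zero]
    cases n with
    | zero => rw [bdry_gen_zero, map_zero]
    | succ n =>
      rw [bdry_gen_succ]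
      simp only [map_sum, map_smul, toMathlib_gen_of_ne R (show n ≠ j + 1 by omega), smul_zero,
        Finset.sum_const_zero]

/-- The comparison from the Mathlib complex to chains. -/
def ofMathlib (j : ℕ) : (mathlibComplex R X).X j →ₗ[R] Chain R (Sing X) :=
  (Cofan.IsColimit.desc ((singularSet X).isColimitChainComplexXCofan (ModuleCat.of R R) j)
    (A := ModuleCat.of R (Chain R (Sing X)))
    fun x => ModuleCat.ofHom (LinearMap.toSpanSingleton R _ (gen R (toSing x)))).hom

theorem ofMathlib_gen {j : ℕ} (x : (singularSet X) _⦋j⦌) :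
    ofMathlib R j (mathlibGen R x) = gen R (toSing x) := by
  have h := congrArg (fun f => f.hom (1 : R))
    (Cofan.IsColimit.fac ((singularSet X).isColimitChainComplexXCofan (ModuleCat.of R R) j)
      (A := ModuleCat.of R (Chain R (Sing X)))
      (fun x => ModuleCat.ofHom (LinearMap.toSpanSingleton R _ (gen R (toSing x)))) x)
  exact h.trans (one_smul R _)

theorem ofMathlib_d (j : ℕ) (z : (mathlibComplex R X).X (j + 1)) :
    ofMathlib R j (((mathlibComplex R X).d (j + 1) j).hom z) = bdry R (ofMathlib R (j + 1) z) := by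
  refine LinearMap.congr_fun (f := ofMathlib R j ∘ₗ ((mathlibComplex R X).d (j + 1) j).hom)
    (g := bdry R ∘ₗ ofMathlib R (j + 1)) (mathlibComplex_hom_ext R fun x => ?_) z
  rw [LinearMap.comp_apply, LinearMap.comp_apply, mathlibComplex_d, ofMathlib_gen, bdry_gen_succ]
  simp only [map_sum, map_smul, ofMathlib_gen, toSing_δ]

theorem ofMathlib_toMathlib (j : ℕ) (c : Chain R (Sing X)) :
    ofMathlib R j (toMathlib R j c) = homogPart R (j + 1) c := by
  refine LinearMap.congr_fun (f := ofMathlib R j ∘ₗ toMathlib R j) (g := homogPart R (j + 1))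
    (chain_hom_ext fun n σ => ?_) c
  rw [LinearMap.comp_apply, homogPart_gen]
  split_ifs with h
  · subst h
    rw [toMathlib_gen, ofMathlib_gen, Equiv.apply_symm_apply]
  · rw [toMathlib_gen_of_ne R h, map_zero]

theorem exists_bdry_eq_of_exactAt {j : ℕ} (hX : (mathlibComplex R X).ExactAt (j + 1))
    {c : Chain R (Sing X)} (hc : IsHomog (j + 2) c) (hdc : bdry R c = 0) :
    ∃ y, bdry R y = c := by
  have hex : ((mathlibComplex R X).sc' (j + 2) (j + 1) j).Exact :=
    ((mathlibComplex R X).exactAt_iff' _ _ _ (by simp) (by simp)).1 hX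
  obtain ⟨w, hw⟩ := (ShortComplex.moduleCat_exact_iff _).1 hex (toMathlib R (j + 1) c)
    (by
      refine (toMathlib_bdry R j c).symm.trans ?_
      rw [hdc, map_zero]
      rfl)
  refine ⟨ofMathlib R (j + 2) w, (ofMathlib_d R (j + 1) w).symm.trans ?_⟩
  refine (congrArg (ofMathlib R (j + 1)) hw).trans ?_
  rw [ofMathlib_toMathlib]
  exact hc

/-- Points in the same component of the singular simplicial set are homologous. -/
theorem exists_bdry_eq_of_π₀_eq {x y : (singularSet X) _⦋0⦌} (h : SSet.π₀.mk x = SSet.π₀.mk y) :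
    ∃ z, bdry R z = gen R (toSing x) - gen R (toSing y) := by
  let S := ShortComplex.mk _ _
    (SSet.π₀.d_fromChainComplexXZero (singularSet X) (ModuleCat.of R R) 1)
  have hS : S.Exact := ShortComplex.exact_of_g_is_cokernel _
    (SSet.isColimitCokernelCoforkChainComplexDOneZero _ _)
  have hv : ∀ x : (singularSet X) _⦋0⦌, S.g.hom (mathlibGen R x) =
      (Sigma.ι (fun _ : SSet.π₀ (singularSet X) => ModuleCat.of R R) (SSet.π₀.mk x)).hom (1 : R) :=
    fun x => congrArg (fun f => f.hom (1 : R))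
      (SSet.π₀.comp_fromChainComplexXZero (singularSet X) (ModuleCat.of R R) x)
  obtain ⟨w, hw⟩ := (ShortComplex.moduleCat_exact_iff _).1 hS
    (mathlibGen R x - mathlibGen R y)
    (by
      refine (map_sub S.g.hom _ _).trans (sub_eq_zero.2 ?_)
      rw [hv, hv, h])
  refine ⟨ofMathlib R 1 w, (ofMathlib_d R 0 w).symm.trans ?_⟩
  refine (congrArg (ofMathlib R 0) hw).trans ?_
  rw [map_sub, ofMathlib_gen, ofMathlib_gen]

/-- If the map to the point induces an isomorphism in degree `0`, then any two points are
homologous. -/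
theorem exists_bdry_eq_of_isIso [IsIso ((singularHomology R 0).map (toPoint X))]
    (x y : (singularSet X) _⦋0⦌) :
    ∃ z, bdry R z = gen R (toSing x) - gen R (toSing y) := by
  let φ : mathlibComplex R X ⟶ mathlibComplex R PUnit.{u + 1} :=
    SSet.chainComplexMap (TopCat.toSSet.map (toPoint X)) (ModuleCat.of R R)
  have hφ : IsIso (HomologicalComplex.homologyMap φ 0) :=
    inferInstanceAs (IsIso ((singularHomology R 0).map (toPoint X)))
  have hop : IsIso (HomologicalComplex.opcyclesMap φ 0) := by
    have : HomologicalComplex.opcyclesMap φ 0 =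
      (mathlibComplex R X).isoHomologyι₀.inv ≫ HomologicalComplex.homologyMap φ 0 ≫
        (mathlibComplex R PUnit.{u + 1}).isoHomologyι₀.hom := by
      rw [← Category.assoc, ChainComplex.isoHomologyι₀_inv_naturality, Category.assoc,
        Iso.inv_hom_id, Category.comp_id]
    rw [this]
    infer_instance
  have hp : ((mathlibComplex R X).pOpcycles 0).hom (mathlibGen R x - mathlibGen R y) = 0 := by
    refine (ModuleCat.mono_iff_injective (HomologicalComplex.opcyclesMap φ 0)).1 inferInstance ?_
    have hφ : ∀ x : (singularSet X) _⦋0⦌, (φ.f 0).hom (mathlibGen R x) =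
        mathlibGen R (toSing.symm (ContinuousMap.const _ PUnit.unit)) := fun x => by
      refine (congrArg (fun f => f.hom (1 : R))
        (SSet.ι_chainComplexMap_f _ _ (TopCat.toSSet.map (toPoint X)) (ModuleCat.of R R) x)).trans ?_
      exact congrArg (mathlibGen R) (toSing.injective (ContinuousMap.ext fun _ => rfl))
    have hcomm := congrArg (fun f => f.hom (mathlibGen R x - mathlibGen R y))
      (HomologicalComplex.p_opcyclesMap φ 0)
    refine hcomm.trans ((congrArg (((mathlibComplex R PUnit.{u + 1}).pOpcycles 0).hom)
      (?_ : (φ.f 0).hom (mathlibGen R x - mathlibGen R y) = 0)).trans ?_)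
    · rw [map_sub, hφ, hφ, sub_self]
    · exact (map_zero _).trans (map_zero _).symm
  let S := ShortComplex.mk ((mathlibComplex R X).d 1 0) ((mathlibComplex R X).pOpcycles 0) (by simp)
  have hS : S.Exact := ShortComplex.exact_of_g_is_cokernel _
    ((mathlibComplex R X).opcyclesIsCokernel 1 0 (by simp))
  obtain ⟨w, hw⟩ := (ShortComplex.moduleCat_exact_iff _).1 hS _ hp
  refine ⟨ofMathlib R 1 w, (ofMathlib_d R 0 w).symm.trans ?_⟩
  refine (congrArg (ofMathlib R 0) hw).trans ?_
  rw [map_sub, ofMathlib_gen, ofMathlib_gen]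

/-- The homology in degree `0` is free on the path components, so that over a ring with invariant
basis number its rank determines their number. -/
theorem subsingleton_π₀ [InvariantBasisNumber R]
    (e : (singularHomology R 0).obj (TopCat.of X) ≅
      (singularHomology R 0).obj (TopCat.of PUnit.{u + 1})) :
    Subsingleton (SSet.π₀ (singularSet X)) := by
  have hpt : Subsingleton (SSet.π₀ (singularSet PUnit.{u + 1})) := by
    refine ⟨fun a b => ?_⟩
    obtain ⟨x, rfl⟩ := SSet.π₀.mk_surjective a
    obtain ⟨y, rfl⟩ := SSet.π₀.mk_surjective b
    exact congrArg _ (toSing.injective (ContinuousMap.ext fun _ => rfl))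
  classical
  let E : ∀ T : Type u, (∐ fun _ : T => ModuleCat.of R R) ≅ ModuleCat.of R (T →₀ R) :=
    fun T => ModuleCat.coprodIsoDirectSum _ ≪≫ (finsuppLEquivDirectSum R R T).symm.toModuleIso
  let e' : (SSet.π₀ (singularSet X) →₀ R) ≃ₗ[R] (SSet.π₀ (singularSet PUnit.{u + 1}) →₀ R) :=
    ((E _).symm ≪≫ ((singularSet X).homology₀Iso (ModuleCat.of R R)).symm ≪≫ e ≪≫
      (singularSet PUnit.{u + 1}).homology₀Iso (ModuleCat.of R R) ≪≫ E _).toLinearEquiv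
  exact ((Finsupp.basisSingleOne (R := R)).indexEquiv
    (Finsupp.basisSingleOne.map e'.symm)).injective.subsingleton

/-- In an acyclic space, cycles of the augmented singular complex bound. -/
theorem exists_bdry_eq_of_isAcyclicBelow [Nontrivial R] [Nonempty X] {n : ℕ}
    (h : IsAcyclicBelow R n X) {d : ℕ} (hd : 1 ≤ d) (hdn : d ≤ n) {c : Chain R (Sing X)}
    (hc : IsHomog d c) (hdc : bdry R c = 0) : ∃ y, bdry R y = c := by
  obtain ⟨⟨e⟩, hiso⟩ := h (d - 1) (by omega)
  obtain - | - | j := d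
  · omega
  · have hpts : ∀ x y : Sing X 1, ∃ z, bdry R z = gen R x - gen R y := by
      intro x y
      by_cases hR : InvariantBasisNumber R
      · have := subsingleton_π₀ R e
        simpa using exists_bdry_eq_of_π₀_eq R (x := toSing.symm x) (y := toSing.symm y)
          (Subsingleton.elim _ _)
      · have := hiso rfl hR
        simpa using exists_bdry_eq_of_isIso R (toSing.symm x) (toSing.symm y)
    let x₀ : Sing X 1 := ContinuousMap.const _ (Classical.arbitrary X)
    have key : ∀ c : Chain R (Sing X), homogPart R 1 c - augmentation R X (homogPart R 1 c) •
        gen R x₀ ∈ LinearMap.range (bdry R : Chain R (Sing X) →ₗ[R] _) := by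
      let P := LinearMap.range (bdry R : Chain R (Sing X) →ₗ[R] _)
      suffices hF : P.mkQ ∘ₗ (LinearMap.id - LinearMap.toSpanSingleton R _ (gen R x₀) ∘ₗ
          augmentation R X) ∘ₗ homogPart R 1 = (0 : Chain R (Sing X) →ₗ[R] _) from
        fun c => (Submodule.Quotient.mk_eq_zero P).1 (LinearMap.congr_fun hF c)
      refine chain_hom_ext fun n σ => ?_
      rw [LinearMap.comp_apply, LinearMap.comp_apply, homogPart_gen]
      split_ifs with hn
      · subst hn
        refine (Submodule.Quotient.mk_eq_zero P).2 ?_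
        change gen R σ - augmentation R X (gen R σ) • gen R x₀ ∈ P
        rw [augmentation_gen, one_smul]
        exact hpts σ x₀
      · rw [map_zero, map_zero, LinearMap.zero_apply]
    have := key c
    rw [hc, augmentation, LinearMap.comp_apply, hdc, map_zero, zero_smul, sub_zero] at this
    exact this
  · refine exists_bdry_eq_of_exactAt R ?_ hc hdc
    refine (HomologicalComplex.exactAt_iff_isZero_homology _ _).2 (IsZero.of_iso ?_ e)
    exact AlgebraicTopology.isZero_singularHomologyFunctor_of_totallyDisconnectedSpace _ _ _ _
      (Nat.succ_ne_zero j)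

end Singular

end

/-- Bootstrapping theorem for groups, in its algebraic form and for actions on CW-complexes. -/
theorem mainTheorem1 {R : Type u} [Ring R] [Nontrivial R]
    (C : GroupClass.{u}) (hC : IsISClass C)
    (B : ℤ → GroupClass.{u}) (hB : IsBootstrappableGroupProperty R C B)
    (Γ : Type u) [Group Γ] (hΓ : C Γ) (n : ℕ) :
    (∀ X : ModComplex (MonoidAlgebra R Γ), X.IsNonneg →
      Nonempty (X.homology 0 ≅ ModuleCat.of (MonoidAlgebra R Γ) (TrivialModule R Γ)) →
      (∀ j : ℤ, j ≤ n - 1 → j ≠ 0 → IsZero (X.homology j)) →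
      (∀ j : ℤ, 0 ≤ j → j ≤ n → ∃ (m : ℕ) (H : Fin m → Subgroup Γ),
        (∀ i, B (n - j) (H i)) ∧
        Nonempty (X.X j ≅ ModuleCat.of (MonoidAlgebra R Γ)
          (DirectSum (Fin m) fun i => PermutationModule R (Γ ⧸ H i) Γ))) →
      B n Γ) ∧
    (∀ (Ω : Type u) [TopologicalSpace Ω] [T2Space Ω] [Nonempty Ω] [MulAction Γ Ω]
      [Topology.CWComplex (Set.univ : Set Ω)], IsGammaCWComplex Γ Ω →
      IsAcyclicBelow R n Ω →
      HasCocompactSkeleton Γ Ω n →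
      (∀ (k : ℕ), k ≤ n → ∀ σ : Topology.CWComplex.cell (Set.univ : Set Ω) k,
        B (n - k) (cellStabilizer Γ σ)) →
      B n Γ) := by
  obtain ⟨F, hF, hBF⟩ := hB
  refine ⟨fun X hX ⟨e⟩ hX' hM => ?_, fun Ω _ _ _ _ _ hΩ hac hcc hst => ?_⟩
  · refine (hBF n Γ).2 (associatedClass_of_complex hF hΓ n X hX e hX' fun j hj hjn => ?_)
    obtain ⟨m, H, hH, ⟨f⟩⟩ := hM j hj hjn
    exact ⟨m, H, fun i => (hBF _ _).1 (hH i),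
      ⟨f.toLinearEquiv ≪≫ₗ DirectSum.linearEquivFunOnFintype _ _ _⟩⟩
  · have := Fact.mk hΩ
    exact (hBF n Γ).2 (GammaCW.associatedClass_of_acyclic hF hΓ
      (fun d hd hdn c hc hdc => Singular.exists_bdry_eq_of_isAcyclicBelow R hac hd hdn hc hdc)
      hcc fun k hk σ => (hBF _ _).1 (hst k hk σ))
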